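/- **Setting.** Let $\theta_1,\theta_2,\theta_3,\theta_\infty\in\mathbb C$ with $\theta_\infty\neq 0,\ \pm(\theta_1+\theta_2+\theta_3)$. Let PVI be the sixth Painlevé equation $$y''=\tfrac12\Big[\tfrac1y+\tfrac1{y-1}+\tfrac1{y-x}\Big]y'^2-\Big[\tfrac1x+\tfrac1{x-1}+\tfrac1{y-x}\Big]y'+\tfrac{y(y-1)(y-x)}{x^2(x-1)^2}\Big[\alpha+\tfrac{\beta x}{y^2}+\tfrac{\gamma(x-1)}{(y-1)^2}+\tfrac{\delta x(x-1)}{(y-x)^2}\Big]$$ with $2\alpha=(\theta_\infty-1)^2$, $2\beta=-\theta_1^2$, $2\gamma=\theta_3^2$, $2\delta=1-\theta_2^2$. Let $y(x)$ be a solution holomorphic at $x=0$, not one of the singular solutions $y\equiv0$, $y\equiv1$, $y\equiv x$. Put $\Omega_{ii}=-\theta_i$ and, near $x=0$ in the plane cut along $(-\infty,0]$, $$\Omega_{12}=\tfrac{k_1}{k_2}\,\tfrac{(x^2-x)y'+(\theta_\infty-1)y^2+(\theta_2-\theta_1+1-(\theta_\infty+\theta_2)x)y+\theta_1x}{2(x-1)y},\quad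 \Omega_{21}=\tfrac{k_2}{k_1}\,\tfrac{(x^2-x)y'+(\theta_\infty-1)y^2+(\theta_1-\theta_2+1-(\theta_\infty-\theta_2)x)y-\theta_1x}{2(x-y)},$$ $$\Omega_{13}=k_1\,\tfrac{(x-x^2)y'+(1-\theta_\infty)y^2+((\theta_1-\theta_3)x+\theta_\infty+\theta_3-1)y-\theta_1x}{2(x-1)y},\quad \Omega_{31}=\tfrac1{k_1}\,\tfrac{(x-x^2)y'+(1-\theta_\infty)y^2+((\theta_3-\theta_1)x+\theta_\infty-\theta_3-1)y+\theta_1x}{2x(y-1)},$$ $$\Omega_{23}=k_2\,\tfrac{(x-x^2)y'+(1-\theta_\infty)y^2+((\theta_\infty-\theta_2)x+\theta_\infty+\theta_3-1)y-x(\theta_\infty-\theta_2+\theta_3)}{2(x-y)},\quad \Omega_{32}=\tfrac1{k_2}\,\tfrac{(x-x^2)y'+(1-\theta_\infty)y^2+((\theta_\infty+\theta_2)x+\theta_\infty-\theta_3-1)y-x(\theta_\infty+\theta_2-\theta_3)}{2x(1-y)},$$ where $k_j=k_j^0\exp\int^x l_j$, $k_j^0\in\mathbb C\setminus\{0\}$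 arbitrary, the primitive is arbitrary, and $$l_1=\tfrac{x(1-x)y'+(\theta_2-\theta_1-\theta_3+1)y^2+((\theta_1+\theta_3)x+\theta_1-\theta_2-1)y-\theta_1x}{2x(x-1)(y-1)y},$$ $$l_2=\tfrac{-x(x-1)^2y'+((\theta_1-3\theta_2+\theta_3+1)x-\theta_1+\theta_2+\theta_3-1)y^2+((2\theta_2-\theta_1-\theta_3)x^2+(3\theta_2-3\theta_3-1)x+\theta_1-\theta_2+1)y+((\theta_1-2\theta_2+2\theta_3)x-\theta_1)x}{2x(1-x)(1-y)(x-y)}.$$ Say that $y$ satisfies the *vanishing condition* (V) if $\Omega(x)$ extends holomorphically to $x=0$ and $\Omega_{12}(0)=\Omega_{21}(0)=0$; then $\Omega_0:=\Omega(0)$. For $N\in\mathbb Z\setminus\{0\}$ let $\mathcal N_N=\{0,\pm2,\dots,\pm(|N|-1)\}$ if $N$ is odd and $\mathcal N_N=\{\pm1,\pm3,\dots,\pm(|N|-1)\}$ if $N$ is even. The tabulated families of Taylor branches at $x=0$ are: * (G) $\theta_\infty\ne1$, and $y(0)=\frac{\theta_\infty-1+\theta_3}{\theta_\infty-1}$ with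 $\theta_\infty+\theta_3\notin\mathbb Z$, or $y(0)=\frac{\theta_\infty-1-\theta_3}{\theta_\infty-1}$ with $\theta_\infty-\theta_3\notin\mathbb Z$; * (F) $\theta_3=0$, $\theta_\infty=1$, $y(0)\neq0$ free; * (T1) $N\in\mathbb Z\setminus\{0\}$, $\theta_\infty\neq1$, $y(0)=\frac N{\theta_\infty-1}$, with $\theta_\infty-1+\theta_3=N$ or $\theta_\infty-1-\theta_3=N$, and such that $\theta_\infty-1$ is an integer strictly between $0$ and $N$, or $\theta_1-\theta_2\in\mathcal N_N$, or $\theta_1+\theta_2\in\mathcal N_N$; * (T2$^-$) $\theta_1-\theta_2\notin\mathbb Z$, $y(0)=0$, $y'(0)=\frac{\theta_1}{\theta_1-\theta_2}$; (T2$^+$) $\theta_1+\theta_2\notin\mathbb Z$, $y(0)=0$, $y'(0)=\frac{\theta_1}{\theta_1+\theta_2}$; * (T3) $\theta_1=\theta_2=0$, $y(0)=0$, $y'(0)$ free; * (T4) $N\in\mathbb Z\setminus\{0\}$, $y(0)=0$, $y'(0)=\frac{\theta_1}N$, with $\theta_1-\theta_2=N$ or $\theta_1+\theta_2=N$, and such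 that $\theta_1\in\{0,N\}$, or $\theta_1$ is an integer strictly between $0$ and $N$, or $\{\theta_3+\theta_\infty-1,-\theta_3+\theta_\infty-1\}\cap\mathcal N_N\ne\emptyset$. **Classification.** (V) fails for every member of (G) and (F). In (T1), (V) holds if and only if $N\le-1$ and $\theta_1-\theta_2=\pm(N+1)$. (V) holds for every member of (T2$^-$) and of (T3). In (T2$^+$), (V) holds if and only if $\theta_2=0$. In (T4), (V) holds if and only if $\theta_1-\theta_2=N$ or $\theta_1\in\{0,N\}$. **Reduction.** Suppose (V) holds and consider $\frac{dY}{dz}=\big(\mathrm{diag}(0,0,1)+\frac{\Omega_0}z\big)Y$ on $\mathbb C\setminus(-\infty,0]$. We say that it *reduces with exponent $\mu$* to a scalar equation if there is a constant invertible $G$ with $G^{-1}\Omega_0G=\mathrm{diag}(m_1,m_2,m_3)$, $m_1=\mu$, such that for every solution $Y$, with $\widetilde Y=G^{-1}Y$, the function $w=z^{-\mu}\widetilde Y_1$ solves the scalar equation and $\widetilde Y_2,\widetilde Y_3$ are obtained by quadratures $(z^{-m_j}\widetilde Y_j)'=\kappa_jz^{\mu-m_j}w'$ with constants $\kappa_j$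 not depending on $Y$. Let $\mathrm{CH}(a,b)$ be the confluent hypergeometric equation $zw''+(b-z)w'-aw=0$, and $\mathrm{CH}(a,b;\rho)$ the inhomogeneous equation $zw''+(b-z)w'-aw=Cz^{\rho}$, where the constant $C$ may depend on the solution $Y$. * (T1), $N=-1$, $\theta_1=\theta_2$: exponent $0$, $\mathrm{CH}(\theta_2,\theta_2+\theta_3)$. * (T1), $N\le-2$, $\theta_\infty-1-\theta_3=N$: exponent $0$; $\mathrm{CH}(\theta_2,\theta_2+\theta_3;-\theta_1)$ if $\theta_1-\theta_2=-(N+1)$, and $\mathrm{CH}(\theta_1,\theta_1+\theta_3;-\theta_2)$ if $\theta_1-\theta_2=N+1$. * (T1), $N\le-2$, $\theta_\infty-1+\theta_3=N$: put $c=\theta_1$ if $\theta_1-\theta_2=-(N+1)$ and $c=\theta_2$ if $\theta_1-\theta_2=N+1$. If $c\ne0$: exponent $0$, $\mathrm{CH}(c,c+\theta_3)$. If $c=0$: exponent $-\theta_3$, $\mathrm{CH}(-\theta_3,-\theta_3)$. * (T3): exponent $\frac{\theta_\infty-\theta_3}2$, $\mathrm{CH}\big(\frac{\theta_\infty-\theta_3}2,\theta_\infty\big)$.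 * (T4) with $\theta_1\in\{0,N\}$: let $M=\theta_1+\theta_2\in\mathbb Z\setminus\{0\}$ and $\mu=\frac{\theta_\infty-\theta_3-M}2$; exponent $\mu$, $\mathrm{CH}(\mu+M,\theta_\infty)$ if $M>0$ and $\mathrm{CH}(\mu+M,\theta_\infty;-\mu)$ if $M<0$. * (T2$^-$), and (T4) with $\theta_1-\theta_2=N$: exponent $\frac{\theta_\infty-\theta_1-\theta_2-\theta_3}2$, the $(2,2)$ generalised hypergeometric equation $z^2w'''+z(b_2+a_2z)w''+(b_1+a_1z)w'+a_0w=0$ with $a_0=\frac14(\theta_1+\theta_2+\theta_3-\theta_\infty)(\theta_1+\theta_2-\theta_3+\theta_\infty)-\theta_1\theta_2$, $a_1=\theta_3-\theta_\infty-1$, $a_2=-1$, $b_1=-\frac{\theta_\infty}2(\theta_1+\theta_2+\theta_3-\theta_\infty)$, $b_2=\frac{2+3\theta_\infty-\theta_1-\theta_2-\theta_3}2$. -/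

import Mathlib

open Filter Topology Matrix

noncomputable section

namespace PVI

/-- The four parameters of the sixth Painlevé equation. -/
structure Params where
  θ₁ : ℂ
  θ₂ : ℂ
  θ₃ : ℂ
  θinf : ℂ

/-- The numbers `0`, `(θinf - θ₁ - θ₂ - θ₃) / 2`, `(-θinf - θ₁ - θ₂ - θ₃) / 2` (the eigenvalues of
the residue matrix) are pairwise distinct. -/
def Params.DistinctEigenvalues (θ : Params) : Prop :=
  θ.θinf ≠ 0 ∧ θ.θinf ≠ θ.θ₁ + θ.θ₂ + θ.θ₃ ∧ θ.θinf ≠ -(θ.θ₁ + θ.θ₂ + θ.θ₃)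

/-- Right-hand side of PVI at `(x, y, y')`, with `2α = (θinf - 1)²`, `2β = -θ₁²`, `2γ = θ₃²`,
`2δ = 1 - θ₂²`. -/
def rhs (θ : Params) (x y p : ℂ) : ℂ :=
  (1 / 2) * (1 / y + 1 / (y - 1) + 1 / (y - x)) * p ^ 2
    - (1 / x + 1 / (x - 1) + 1 / (y - x)) * p
    + y * (y - 1) * (y - x) / (x ^ 2 * (x - 1) ^ 2)
      * ((θ.θinf - 1) ^ 2 / 2 + (-θ.θ₁ ^ 2 / 2) * (x / y ^ 2)
          + (θ.θ₃ ^ 2 / 2) * ((x - 1) / (y - 1) ^ 2)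
          + ((1 - θ.θ₂ ^ 2) / 2) * (x * (x - 1) / (y - x) ^ 2))

/-- A branch of a PVI transcendent that is holomorphic at `x = 0`: `y` is analytic at `0`, and
on a punctured neighbourhood of `0` it avoids the values `0`, `1`, `x` (so it is not one of the
singular solutions `y ≡ 0`, `y ≡ 1`, `y ≡ x`) and satisfies PVI. -/
def IsHolomorphicBranch (θ : Params) (y : ℂ → ℂ) : Prop :=
  AnalyticAt ℂ y 0 ∧
    ∀ᶠ x in 𝓝[≠] (0 : ℂ), y x ≠ 0 ∧ y x ≠ 1 ∧ y x ≠ x ∧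
      deriv (deriv y) x = rhs θ x (y x) (deriv y x)

/-! ### The matrix `Ω` attached to a transcendent -/

/-- Logarithmic derivative of `k₁`, as a function of `x`, `y`, `p = y'`. -/
def l₁ (θ : Params) (x y p : ℂ) : ℂ :=
  (x * (1 - x) * p + (θ.θ₂ - θ.θ₁ - θ.θ₃ + 1) * y ^ 2
      + ((θ.θ₁ + θ.θ₃) * x + θ.θ₁ - θ.θ₂ - 1) * y - θ.θ₁ * x)
    / (2 * x * (x - 1) * (y - 1) * y)

/-- Logarithmic derivative of `k₂`, as a function of `x`, `y`, `p = y'`. -/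
def l₂ (θ : Params) (x y p : ℂ) : ℂ :=
  (-x * (x - 1) ^ 2 * p
      + ((θ.θ₁ - 3 * θ.θ₂ + θ.θ₃ + 1) * x - θ.θ₁ + θ.θ₂ + θ.θ₃ - 1) * y ^ 2
      + ((2 * θ.θ₂ - θ.θ₁ - θ.θ₃) * x ^ 2 + (3 * θ.θ₂ - 3 * θ.θ₃ - 1) * x
          + θ.θ₁ - θ.θ₂ + 1) * y
      + ((θ.θ₁ - 2 * θ.θ₂ + 2 * θ.θ₃) * x - θ.θ₁) * x)
    / (2 * x * (1 - x) * (1 - y) * (x - y))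

/-- `k` is a branch, near `0` in the plane cut along `(-∞, 0]`, of `k⁰ · exp (∫ l dx)` with
`k⁰ ≠ 0`; the indefinite integral is any primitive `L` of `l`. -/
def IsExpPrimitive (l k : ℂ → ℂ) : Prop :=
  ∃ (k0 : ℂ) (L : ℂ → ℂ), k0 ≠ 0 ∧
    ∀ᶠ x in 𝓝[Complex.slitPlane] (0 : ℂ), HasDerivAt L (l x) x ∧ k x = k0 * Complex.exp (L x)

/-- `k₁`, `k₂` are admissible factors for the transcendent `y`. -/
def AreFactors (θ : Params) (y k₁ k₂ : ℂ → ℂ) : Prop :=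
  IsExpPrimitive (fun x => l₁ θ x (y x) (deriv y x)) k₁ ∧
    IsExpPrimitive (fun x => l₂ θ x (y x) (deriv y x)) k₂

/-- The matrix `Z` as a function of `x`, `y`, `p = y'`; `Ω = K Z K⁻¹`, `K = diag (k₁, k₂, 1)`. -/
def Z (θ : Params) (x y p : ℂ) : Matrix (Fin 3) (Fin 3) ℂ :=
  !![-θ.θ₁,
      ((x ^ 2 - x) * p + (θ.θinf - 1) * y ^ 2
        + (θ.θ₂ - θ.θ₁ + 1 - (θ.θinf + θ.θ₂) * x) * y + θ.θ₁ * x) / (2 * (x - 1) * y),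
      ((x - x ^ 2) * p + (1 - θ.θinf) * y ^ 2
        + ((θ.θ₁ - θ.θ₃) * x + θ.θinf + θ.θ₃ - 1) * y - θ.θ₁ * x) / (2 * (x - 1) * y);
    ((x ^ 2 - x) * p + (θ.θinf - 1) * y ^ 2
        + (θ.θ₁ - θ.θ₂ + 1 - (θ.θinf - θ.θ₂) * x) * y - θ.θ₁ * x) / (2 * (x - y)),
      -θ.θ₂,
      ((x - x ^ 2) * p + (1 - θ.θinf) * y ^ 2
        + ((θ.θinf - θ.θ₂) * x + θ.θinf + θ.θ₃ - 1) * y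
        - x * (θ.θinf - θ.θ₂ + θ.θ₃)) / (2 * (x - y));
    ((x - x ^ 2) * p + (1 - θ.θinf) * y ^ 2
        + ((θ.θ₃ - θ.θ₁) * x + θ.θinf - θ.θ₃ - 1) * y + θ.θ₁ * x) / (2 * x * (y - 1)),
      ((x - x ^ 2) * p + (1 - θ.θinf) * y ^ 2
        + ((θ.θinf + θ.θ₂) * x + θ.θinf - θ.θ₃ - 1) * y
        - x * (θ.θinf + θ.θ₂ - θ.θ₃)) / (2 * x * (1 - y)),
      -θ.θ₃]

/-- The matrix `Ω(x)` attached to the transcendent `y` and the factors `k₁`, `k₂`: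
`Ω i j = (k i / k j) Z i j` with `k = (k₁, k₂, 1)`. -/
def Omega (θ : Params) (y k₁ k₂ : ℂ → ℂ) (x : ℂ) : Matrix (Fin 3) (Fin 3) ℂ :=
  Matrix.of fun i j =>
    (![k₁ x, k₂ x, 1] i / ![k₁ x, k₂ x, 1] j) * Z θ x (y x) (deriv y x) i j

/-- `Ω` is holomorphic at `x = 0` with value `Ω₀` there, and `Ω₁₂`, `Ω₂₁` vanish at `x = 0`. -/
def IsCoalescentValue (Ω : ℂ → Matrix (Fin 3) (Fin 3) ℂ) (Ω₀ : Matrix (Fin 3) (Fin 3) ℂ) :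
    Prop :=
  (∃ W : ℂ → Matrix (Fin 3) (Fin 3) ℂ, (∀ i j, AnalyticAt ℂ (fun x => W x i j) 0) ∧
      (∀ᶠ x in 𝓝[Complex.slitPlane] (0 : ℂ), Ω x = W x) ∧ W 0 = Ω₀) ∧
    Ω₀ 0 1 = 0 ∧ Ω₀ 1 0 = 0

/-- `Ω` is holomorphic at `x = 0` and `Ω₁₂, Ω₂₁ → 0` as `x → 0`. -/
def VanishingCondition (Ω : ℂ → Matrix (Fin 3) (Fin 3) ℂ) : Prop :=
  ∃ Ω₀, IsCoalescentValue Ω Ω₀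

/-! ### The tabulated families of Taylor series at `x = 0` -/

/-- `c` is not an integer. -/
def NotInt (c : ℂ) : Prop := ∀ n : ℤ, c ≠ n

/-- `c` is an integer lying strictly between `0` and `N`. -/
def StrictlyBetween (N : ℤ) (c : ℂ) : Prop :=
  ∃ m : ℤ, c = m ∧ ((0 < m ∧ m < N) ∨ (N < m ∧ m < 0))

/-- `{0, ±2, …, ±(|N|-1)}` for `N` odd, `{±1, ±3, …, ±(|N|-1)}` for `N` even. -/
def setN (N : ℤ) : Set ℂ := {c | ∃ m : ℤ, c = m ∧ |m| ≤ |N| - 1 ∧ Odd (m - N)}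

/-- `y = y₀ + O(x)` with `y₀ = (θinf - 1 ± θ₃) / (θinf - 1)`, `θinf ± θ₃ ∉ ℤ`, `θinf ≠ 1`. -/
def FamilyGeneric (θ : Params) (y : ℂ → ℂ) : Prop :=
  θ.θinf ≠ 1 ∧
    ((NotInt (θ.θinf + θ.θ₃) ∧ y 0 = (θ.θinf - 1 + θ.θ₃) / (θ.θinf - 1)) ∨
      (NotInt (θ.θinf - θ.θ₃) ∧ y 0 = (θ.θinf - 1 - θ.θ₃) / (θ.θinf - 1)))

/-- `y = y₀ + O(x)` with `y₀ ≠ 0` free, `θ₃ = 0`, `θinf = 1`. -/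
def FamilyFree (θ : Params) (y : ℂ → ℂ) : Prop :=
  θ.θ₃ = 0 ∧ θ.θinf = 1 ∧ y 0 ≠ 0

/-- Family (T1): `y = N / (θinf - 1) + O(x)`. -/
def FamilyT1 (θ : Params) (N : ℤ) (y : ℂ → ℂ) : Prop :=
  N ≠ 0 ∧ θ.θinf ≠ 1 ∧ y 0 = N / (θ.θinf - 1) ∧
    (θ.θinf - 1 + θ.θ₃ = N ∨ θ.θinf - 1 - θ.θ₃ = N) ∧
    (StrictlyBetween N (θ.θinf - 1) ∨ θ.θ₁ - θ.θ₂ ∈ setN N ∨ θ.θ₁ + θ.θ₂ ∈ setN N)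

/-- Family (T2), first case: `y = θ₁ / (θ₁ - θ₂) x + O(x²)`. -/
def FamilyT2Minus (θ : Params) (y : ℂ → ℂ) : Prop :=
  NotInt (θ.θ₁ - θ.θ₂) ∧ y 0 = 0 ∧ deriv y 0 = θ.θ₁ / (θ.θ₁ - θ.θ₂)

/-- Family (T2), second case: `y = θ₁ / (θ₁ + θ₂) x + O(x²)`. -/
def FamilyT2Plus (θ : Params) (y : ℂ → ℂ) : Prop :=
  NotInt (θ.θ₁ + θ.θ₂) ∧ y 0 = 0 ∧ deriv y 0 = θ.θ₁ / (θ.θ₁ + θ.θ₂)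

/-- Family (T3): `θ₁ = θ₂ = 0`, `y = y₀' x + O(x²)` with `y₀'` free. -/
def FamilyT3 (θ : Params) (y : ℂ → ℂ) : Prop :=
  θ.θ₁ = 0 ∧ θ.θ₂ = 0 ∧ y 0 = 0

/-- Family (T4): `y = (θ₁ / N) x + O(x²)`. -/
def FamilyT4 (θ : Params) (N : ℤ) (y : ℂ → ℂ) : Prop :=
  N ≠ 0 ∧ y 0 = 0 ∧ deriv y 0 = θ.θ₁ / N ∧
    (θ.θ₁ - θ.θ₂ = N ∨ θ.θ₁ + θ.θ₂ = N) ∧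
    (θ.θ₁ = 0 ∨ θ.θ₁ = N ∨ StrictlyBetween N θ.θ₁ ∨
      θ.θ₃ + θ.θinf - 1 ∈ setN N ∨ -θ.θ₃ + θ.θinf - 1 ∈ setN N)

/-! ### The system at `x = 0` and its reduction to scalar equations -/

/-- `Y` solves `dY/dz = (diag (0, 0, 1) + A / z) Y` on the plane cut along `(-∞, 0]`. -/
def SolvesSystem (A : Matrix (Fin 3) (Fin 3) ℂ) (Y : ℂ → Fin 3 → ℂ) : Prop :=
  ∀ z ∈ Complex.slitPlane,
    HasDerivAt Y ((Matrix.diagonal ![(0 : ℂ), 0, 1] + z⁻¹ • A) *ᵥ Y z) z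

/-- Inhomogeneous confluent hypergeometric equation `z w'' + (b - z) w' - a w = f`. -/
def ConfluentEq (a b : ℂ) (f w : ℂ → ℂ) : Prop :=
  ∀ z ∈ Complex.slitPlane,
    z * iteratedDeriv 2 w z + (b - z) * deriv w z - a * w z = f z

/-- The homogeneous confluent hypergeometric equation. -/
def Confluent (a b : ℂ) (w : ℂ → ℂ) : Prop := ConfluentEq a b (fun _ => 0) w

/-- The confluent hypergeometric equation with right-hand side `C z ^ ρ`, `C` a constant. -/
def ConfluentInhom (a b ρ : ℂ) (w : ℂ → ℂ) : Prop :=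
  ∃ C : ℂ, ConfluentEq a b (fun z => C * z ^ ρ) w

/-- Generalised hypergeometric equation of type `(2, 2)`:
`z² w''' + z (b₂ + a₂ z) w'' + (b₁ + a₁ z) w' + a₀ w = 0`. -/
def GenHypergeometric (a₀ a₁ a₂ b₁ b₂ : ℂ) (w : ℂ → ℂ) : Prop :=
  ∀ z ∈ Complex.slitPlane,
    z ^ 2 * iteratedDeriv 3 w z + z * (b₂ + a₂ * z) * iteratedDeriv 2 w z
      + (b₁ + a₁ * z) * deriv w z + a₀ * w z = 0

/-- The system with residue matrix `A` reduces to the scalar equation `E`: there is a constant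
gauge `Y = G Ỹ` diagonalising `A`, `G⁻¹ A G = diag m` with `m 0 = μ`, such that for every solution
`Y` the function `w` in `Ỹ 0 = z ^ μ w` satisfies `E`, and the other components of `Ỹ` are obtained
from `w` by a quadrature: `(z ^ (-m j) Ỹ j)' = κ j z ^ (μ - m j) w'`. -/
def ReducesTo (A : Matrix (Fin 3) (Fin 3) ℂ) (μ : ℂ) (E : (ℂ → ℂ) → Prop) : Prop :=
  ∃ (G : Matrix (Fin 3) (Fin 3) ℂ) (m κ : Fin 3 → ℂ),
    IsUnit G.det ∧ G⁻¹ * A * G = Matrix.diagonal m ∧ m 0 = μ ∧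
    ∀ (Y : ℂ → Fin 3 → ℂ) (w : ℂ → ℂ), SolvesSystem A Y → (w = fun z : ℂ => z ^ (-μ) * (G⁻¹ *ᵥ Y z) 0) →
      E w ∧
      ∀ j : Fin 3, j ≠ 0 → ∀ z ∈ Complex.slitPlane,
        HasDerivAt (fun s : ℂ => s ^ (-m j) * (G⁻¹ *ᵥ Y s) j)
          (κ j * z ^ (μ - m j) * deriv w z) z

/-- Reduction to the `(2, 2)` equation with the parameters occurring in families (T2), (T4). -/
def ReducesToGenHypergeometric (θ : Params) (A : Matrix (Fin 3) (Fin 3) ℂ) : Prop :=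
  ReducesTo A ((θ.θinf - θ.θ₁ - θ.θ₂ - θ.θ₃) / 2)
    (GenHypergeometric
      ((θ.θ₁ + θ.θ₂ + θ.θ₃ - θ.θinf) * (θ.θ₁ + θ.θ₂ - θ.θ₃ + θ.θinf) / 4 - θ.θ₁ * θ.θ₂)
      (θ.θ₃ - θ.θinf - 1)
      (-1)
      (-θ.θinf * (θ.θ₁ + θ.θ₂ + θ.θ₃ - θ.θinf) / 2)
      ((2 + 3 * θ.θinf - θ.θ₁ - θ.θ₂ - θ.θ₃) / 2))

end PVI

end

/-!
# Coalescence of branches of PVI transcendents at `x = 0`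

Write `ν = θ₁ - θ₂`. The matrix `Ω = K Z K⁻¹` attached to a transcendent has a characteristic
polynomial that does not depend on `x` (`Z_offDiag_products`, `Z_det_expansion`), and by PVI its
entries satisfy a closed system of differential equations with simple poles at `x = 0`
(`hasDerivAt_Omega_01` and its companions). In the comments the entries of `Ω`, `Z`, `Ỹ` are
numbered from `1`.

**Vanishing condition, `y(0) ≠ 0`.** The product `Ω₁₂Ω₂₁ = Z₁₂Z₂₁` is holomorphic at `0`, and its
value there is a multiple of `(σ + 1 - ν)(σ + 1 + ν)` with `σ = (θ∞ - 1) y(0)`. If it vanishes,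
one of `Ω₁₂`, `Ω₂₁` equals `x ^ (-(σ + 1))` times a holomorphic unit, so that `σ + 1 = -n` with a
natural number `n` and `ν = ± n` (`VanishingCondition.exists_nat`). This excludes the generic and
the free family and gives one direction for (T1). For the other direction `k₁`, `k₂` are integral
powers of `x` times units; four of the off-diagonal entries of `Ω` are then visibly holomorphic,
and the other two, which may have a pole of order `n`, form a solution of a linear system with a
regular singular point. Its residue matrix has the eigenvalues `-n` and `0`, and the component
along `-n` vanishes (`exists_eq_pow_mul_of_regularSingular`), whence holomorphy
(`PlusData.of_sub_eq` etc.).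

**Vanishing condition, `y(0) = 0`.** Here everything is governed by the identity `ν y'(0) = θ₁`.
It is sufficient (`vanishingCondition_of_slope`), and necessary for `y'(0) ≠ 0, 1`
(`VanishingCondition.slope_eq`). In the exceptional cases `y'(0) = 0` (then `θ₁ = 0`) and
`y'(0) = 1` (then `θ₂ = 0`) the transcendent is tangent to a singular solution; the order of contact is
found from the indicial equation of PVI (`exponent_at_zero`, `exponent_at_diagonal`) and gives the
exponents of `k₁`, `k₂`.

**Reduction.** The eigenvalues of `Ω(0)` are distinct, hence there is a diagonalising gauge `G`,
in which the three components of the system are coupled only through `Y₃ = ∑ G 2 j Ỹ j`. All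
coefficients of the scalar equation for `w` are expressed by the eigenvalues and by the moments
`∑ G 2 j G⁻¹ j 2 (m j) ^ k` for `k = 0, 1, 2`, which are entries of powers of `Ω(0)`
(`Diagonalizes.reducesTo_genHypergeometric`). The order drops to two when the weight
`G 2 2 G⁻¹ 2 2` vanishes, and the equation is homogeneous when the factor `G 2 2` does
(`Diagonalizes.reducesTo_confluent`, `Diagonalizes.reducesTo_confluentInhom`). Which of these
happens depends on the vanishing of single entries of `Ω(0)`, which are known from the first part.
-/

set_option linter.unusedSimpArgs false

noncomputable section

namespace PVI

/-! ### The characteristic polynomial of `Z` -/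

/-- The second elementary symmetric function of the eigenvalues of `Z` does not depend on
`x`, `y`, `y'`. -/
theorem Z_offDiag_products (θ : Params) {x y p : ℂ} (h0 : x ≠ 0) (h1 : x ≠ 1) (hy0 : y ≠ 0)
    (hy1 : y ≠ 1) (hyx : y ≠ x) :
    Z θ x y p 0 1 * Z θ x y p 1 0 + Z θ x y p 0 2 * Z θ x y p 2 0 + Z θ x y p 1 2 * Z θ x y p 2 1
      = θ.θ₁ * θ.θ₂ + θ.θ₁ * θ.θ₃ + θ.θ₂ * θ.θ₃
        - ((θ.θ₁ + θ.θ₂ + θ.θ₃) ^ 2 - θ.θinf ^ 2) / 4 := by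
  have h1' : x - 1 ≠ 0 := sub_ne_zero.2 h1
  have hy1' : y - 1 ≠ 0 := sub_ne_zero.2 hy1
  have hyx' : x - y ≠ 0 := sub_ne_zero.2 hyx.symm
  have e : (1 - y) = -(y - 1) := by ring
  simp only [Z, Matrix.of_apply, Matrix.cons_val', Matrix.cons_val_zero, Matrix.cons_val_one,
    Matrix.cons_val_fin_one, Matrix.cons_val, e]
  field_simp
  ring

/-- The determinant of `Z` vanishes; the expansion uses that the diagonal entries are
`-θ₁`, `-θ₂`, `-θ₃`. -/
theorem Z_det_expansion (θ : Params) {x y p : ℂ} (h0 : x ≠ 0) (h1 : x ≠ 1) (hy0 : y ≠ 0)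
    (hy1 : y ≠ 1) (hyx : y ≠ x) :
    Z θ x y p 0 1 * Z θ x y p 1 2 * Z θ x y p 2 0 + Z θ x y p 0 2 * Z θ x y p 1 0 * Z θ x y p 2 1
      + θ.θ₁ * (Z θ x y p 1 2 * Z θ x y p 2 1) + θ.θ₂ * (Z θ x y p 0 2 * Z θ x y p 2 0)
      + θ.θ₃ * (Z θ x y p 0 1 * Z θ x y p 1 0) = θ.θ₁ * θ.θ₂ * θ.θ₃ := by
  have h1' : x - 1 ≠ 0 := sub_ne_zero.2 h1
  have hy1' : y - 1 ≠ 0 := sub_ne_zero.2 hy1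
  have hyx' : x - y ≠ 0 := sub_ne_zero.2 hyx.symm
  have e : (1 - y) = -(y - 1) := by ring
  simp only [Z, Matrix.of_apply, Matrix.cons_val', Matrix.cons_val_zero, Matrix.cons_val_one,
    Matrix.cons_val_fin_one, Matrix.cons_val, e]
  field_simp
  ring

/-! ### The differential equations of the entries of `Ω` -/

/-- The numerators of all off-diagonal entries of `Z` have this form, with `P = y'`. -/
theorem hasDerivAt_numerator {y P : ℂ → ℂ} {x q : ℂ} (hy : HasDerivAt y (P x) x)
    (hP : HasDerivAt P q x) (ε e c₁ c₀ d : ℂ) :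
    HasDerivAt (fun s => ε * ((s ^ 2 - s) * P s) + e * y s ^ 2 + (c₁ * s + c₀) * y s + d * s)
      (ε * ((2 * x - 1) * P x + (x ^ 2 - x) * q) + e * (2 * y x * P x)
        + (c₁ * y x + (c₁ * x + c₀) * P x) + d) x := by
  have hx := hasDerivAt_id' x
  have h := ((((((hx.pow 2).sub hx).mul hP).const_mul ε).add ((hy.pow 2).const_mul e)).add
    (((hx.const_mul c₁).add_const c₀).mul hy)).add (hx.const_mul d)
  exact h.congr_deriv (by simp)

/-- A point `x` off the singular locus where `y` solves PVI and `K₁`, `K₂` solve the linear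
equations `K' = l K` of the factors. -/
def RegularPoint (θ : Params) (y K₁ K₂ : ℂ → ℂ) (x : ℂ) : Prop :=
  x ≠ 0 ∧ x ≠ 1 ∧ y x ≠ 0 ∧ y x ≠ 1 ∧ y x ≠ x ∧ HasDerivAt y (deriv y x) x ∧
    HasDerivAt (deriv y) (rhs θ x (y x) (deriv y x)) x ∧ K₁ x ≠ 0 ∧ K₂ x ≠ 0 ∧
    HasDerivAt K₁ (l₁ θ x (y x) (deriv y x) * K₁ x) x ∧
    HasDerivAt K₂ (l₂ θ x (y x) (deriv y x) * K₂ x) x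

/-- Together with the five statements below: `Ω` satisfies `Ω' = [V, Ω]`, where the nonzero
entries of `V` are those of `Ω` divided by `x` (positions 12, 21) and by `x - 1` (positions 23,
32). Each entry is differentiated directly, PVI being used to eliminate `y''`. -/
theorem hasDerivAt_Omega_01 {θ : Params} {y K₁ K₂ : ℂ → ℂ} {x : ℂ}
    (h : RegularPoint θ y K₁ K₂ x) :
    HasDerivAt (fun s => Omega θ y K₁ K₂ s 0 1)
      ((θ.θ₁ - θ.θ₂) / x * Omega θ y K₁ K₂ x 0 1
        - Omega θ y K₁ K₂ x 0 2 * Omega θ y K₁ K₂ x 2 1 / (x - 1)) x := by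
  obtain ⟨h0, h1, hy0, hy1, hyx, hy, hP, hn₁, hn₂, hK₁, hK₂⟩ := h
  have h1' : x - 1 ≠ 0 := sub_ne_zero.2 h1
  have hy1' : y x - 1 ≠ 0 := sub_ne_zero.2 hy1
  have hyx' : x - y x ≠ 0 := sub_ne_zero.2 hyx.symm
  have e : (1 - y x) = -(y x - 1) := by ring
  have e' : (1 - x) = -(x - 1) := by ring
  have e2 : (y x - x) = -(x - y x) := by ring
  have hd : HasDerivAt (fun s => 2 * (s - 1) * y s) _ x :=
    ((hasDerivAt_id x |>.sub_const 1).const_mul 2).mul hy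
  have H := (hK₁.div hK₂ hn₂).mul ((hasDerivAt_numerator hy hP 1 (θ.θinf - 1) (-(θ.θinf + θ.θ₂))
    (θ.θ₂ - θ.θ₁ + 1) θ.θ₁).div hd (mul_ne_zero (mul_ne_zero two_ne_zero h1') hy0))
  have hf : (fun s => Omega θ y K₁ K₂ s 0 1) = fun s => (K₁ s / K₂ s) *
      ((1 * ((s ^ 2 - s) * deriv y s) + (θ.θinf - 1) * y s ^ 2
        + ((-(θ.θinf + θ.θ₂)) * s + (θ.θ₂ - θ.θ₁ + 1)) * y s + θ.θ₁ * s)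
        / (2 * (s - 1) * y s)) := by
    funext s
    simp only [Omega, Z, Matrix.of_apply, Matrix.cons_val', Matrix.cons_val_zero,
      Matrix.cons_val_one, Matrix.cons_val_fin_one, Matrix.cons_val]
    ring
  rw [hf]
  refine H.congr_deriv ?_
  simp only [Omega, Z, l₁, l₂, rhs, Matrix.of_apply, Matrix.cons_val', Matrix.cons_val_zero,
    Matrix.cons_val_one, Matrix.cons_val_fin_one, Matrix.cons_val, id_eq, Pi.div_apply, e, e', e2]
  generalize y x = Y at *
  generalize deriv y x = p at *
  generalize K₁ x = k at *
  generalize K₂ x = k' at *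
  field_simp
  ring

theorem hasDerivAt_Omega_02 {θ : Params} {y K₁ K₂ : ℂ → ℂ} {x : ℂ}
    (h : RegularPoint θ y K₁ K₂ x) :
    HasDerivAt (fun s => Omega θ y K₁ K₂ s 0 2)
      (-(Omega θ y K₁ K₂ x 0 1 * Omega θ y K₁ K₂ x 1 2) / (x * (x - 1))) x := by
  obtain ⟨h0, h1, hy0, hy1, hyx, hy, hP, hn₁, hn₂, hK₁, hK₂⟩ := h
  have h1' : x - 1 ≠ 0 := sub_ne_zero.2 h1
  have hy1' : y x - 1 ≠ 0 := sub_ne_zero.2 hy1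
  have hyx' : x - y x ≠ 0 := sub_ne_zero.2 hyx.symm
  have e : (1 - y x) = -(y x - 1) := by ring
  have e' : (1 - x) = -(x - 1) := by ring
  have e2 : (y x - x) = -(x - y x) := by ring
  have hd : HasDerivAt (fun s => 2 * (s - 1) * y s) _ x :=
    ((hasDerivAt_id x |>.sub_const 1).const_mul 2).mul hy
  have H := (hK₁.div_const 1).mul ((hasDerivAt_numerator hy hP (-1) (1 - θ.θinf) (θ.θ₁ - θ.θ₃)
    (θ.θinf + θ.θ₃ - 1) (-θ.θ₁)).div hd (mul_ne_zero (mul_ne_zero two_ne_zero h1') hy0))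
  have hf : (fun s => Omega θ y K₁ K₂ s 0 2) = fun s => (K₁ s / 1) *
      (((-1) * ((s ^ 2 - s) * deriv y s) + (1 - θ.θinf) * y s ^ 2
        + ((θ.θ₁ - θ.θ₃) * s + (θ.θinf + θ.θ₃ - 1)) * y s + (-θ.θ₁) * s)
        / (2 * (s - 1) * y s)) := by
    funext s
    simp only [Omega, Z, Matrix.of_apply, Matrix.cons_val', Matrix.cons_val_zero,
      Matrix.cons_val_one, Matrix.cons_val_fin_one, Matrix.cons_val]
    ring
  rw [hf]
  refine H.congr_deriv ?_
  simp only [Omega, Z, l₁, l₂, rhs, Matrix.of_apply, Matrix.cons_val', Matrix.cons_val_zero,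
    Matrix.cons_val_one, Matrix.cons_val_fin_one, Matrix.cons_val, id_eq, Pi.div_apply, e, e', e2]
  generalize y x = Y at *
  generalize deriv y x = p at *
  generalize K₁ x = k at *
  generalize K₂ x = k' at *
  field_simp
  ring

theorem hasDerivAt_Omega_10 {θ : Params} {y K₁ K₂ : ℂ → ℂ} {x : ℂ}
    (h : RegularPoint θ y K₁ K₂ x) :
    HasDerivAt (fun s => Omega θ y K₁ K₂ s 1 0)
      ((θ.θ₂ - θ.θ₁) / x * Omega θ y K₁ K₂ x 1 0
        + Omega θ y K₁ K₂ x 1 2 * Omega θ y K₁ K₂ x 2 0 / (x - 1)) x := by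
  obtain ⟨h0, h1, hy0, hy1, hyx, hy, hP, hn₁, hn₂, hK₁, hK₂⟩ := h
  have h1' : x - 1 ≠ 0 := sub_ne_zero.2 h1
  have hy1' : y x - 1 ≠ 0 := sub_ne_zero.2 hy1
  have hyx' : x - y x ≠ 0 := sub_ne_zero.2 hyx.symm
  have e : (1 - y x) = -(y x - 1) := by ring
  have e' : (1 - x) = -(x - 1) := by ring
  have e2 : (y x - x) = -(x - y x) := by ring
  have hd : HasDerivAt (fun s => 2 * (s - y s)) _ x := ((hasDerivAt_id x).sub hy).const_mul 2
  have H := (hK₂.div hK₁ hn₁).mul ((hasDerivAt_numerator hy hP 1 (θ.θinf - 1) (-(θ.θinf - θ.θ₂))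
    (θ.θ₁ - θ.θ₂ + 1) (-θ.θ₁)).div hd (mul_ne_zero two_ne_zero hyx'))
  have hf : (fun s => Omega θ y K₁ K₂ s 1 0) = fun s => (K₂ s / K₁ s) *
      ((1 * ((s ^ 2 - s) * deriv y s) + (θ.θinf - 1) * y s ^ 2
        + ((-(θ.θinf - θ.θ₂)) * s + (θ.θ₁ - θ.θ₂ + 1)) * y s + (-θ.θ₁) * s)
        / (2 * (s - y s))) := by
    funext s
    simp only [Omega, Z, Matrix.of_apply, Matrix.cons_val', Matrix.cons_val_zero,
      Matrix.cons_val_one, Matrix.cons_val_fin_one, Matrix.cons_val]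
    ring
  rw [hf]
  refine H.congr_deriv ?_
  simp only [Omega, Z, l₁, l₂, rhs, Matrix.of_apply, Matrix.cons_val', Matrix.cons_val_zero,
    Matrix.cons_val_one, Matrix.cons_val_fin_one, Matrix.cons_val, id_eq, Pi.div_apply, e, e', e2]
  generalize y x = Y at *
  generalize deriv y x = p at *
  generalize K₁ x = k at *
  generalize K₂ x = k' at *
  field_simp
  ring

theorem hasDerivAt_Omega_12 {θ : Params} {y K₁ K₂ : ℂ → ℂ} {x : ℂ}
    (h : RegularPoint θ y K₁ K₂ x) :
    HasDerivAt (fun s => Omega θ y K₁ K₂ s 1 2)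
      (Omega θ y K₁ K₂ x 1 0 * Omega θ y K₁ K₂ x 0 2 / x
        + (θ.θ₂ - θ.θ₃) / (x - 1) * Omega θ y K₁ K₂ x 1 2) x := by
  obtain ⟨h0, h1, hy0, hy1, hyx, hy, hP, hn₁, hn₂, hK₁, hK₂⟩ := h
  have h1' : x - 1 ≠ 0 := sub_ne_zero.2 h1
  have hy1' : y x - 1 ≠ 0 := sub_ne_zero.2 hy1
  have hyx' : x - y x ≠ 0 := sub_ne_zero.2 hyx.symm
  have e : (1 - y x) = -(y x - 1) := by ring
  have e' : (1 - x) = -(x - 1) := by ring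
  have e2 : (y x - x) = -(x - y x) := by ring
  have hd : HasDerivAt (fun s => 2 * (s - y s)) _ x := ((hasDerivAt_id x).sub hy).const_mul 2
  have H := (hK₂.div_const 1).mul ((hasDerivAt_numerator hy hP (-1) (1 - θ.θinf) (θ.θinf - θ.θ₂)
    (θ.θinf + θ.θ₃ - 1) (-(θ.θinf - θ.θ₂ + θ.θ₃))).div hd (mul_ne_zero two_ne_zero hyx'))
  have hf : (fun s => Omega θ y K₁ K₂ s 1 2) = fun s => (K₂ s / 1) *
      (((-1) * ((s ^ 2 - s) * deriv y s) + (1 - θ.θinf) * y s ^ 2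
        + ((θ.θinf - θ.θ₂) * s + (θ.θinf + θ.θ₃ - 1)) * y s + (-(θ.θinf - θ.θ₂ + θ.θ₃)) * s)
        / (2 * (s - y s))) := by
    funext s
    simp only [Omega, Z, Matrix.of_apply, Matrix.cons_val', Matrix.cons_val_zero,
      Matrix.cons_val_one, Matrix.cons_val_fin_one, Matrix.cons_val]
    ring
  rw [hf]
  refine H.congr_deriv ?_
  simp only [Omega, Z, l₁, l₂, rhs, Matrix.of_apply, Matrix.cons_val', Matrix.cons_val_zero,
    Matrix.cons_val_one, Matrix.cons_val_fin_one, Matrix.cons_val, id_eq, Pi.div_apply, e, e', e2]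
  generalize y x = Y at *
  generalize deriv y x = p at *
  generalize K₁ x = k at *
  generalize K₂ x = k' at *
  field_simp
  ring

theorem hasDerivAt_Omega_20 {θ : Params} {y K₁ K₂ : ℂ → ℂ} {x : ℂ}
    (h : RegularPoint θ y K₁ K₂ x) :
    HasDerivAt (fun s => Omega θ y K₁ K₂ s 2 0)
      (Omega θ y K₁ K₂ x 2 1 * Omega θ y K₁ K₂ x 1 0 / (x * (x - 1))) x := by
  obtain ⟨h0, h1, hy0, hy1, hyx, hy, hP, hn₁, hn₂, hK₁, hK₂⟩ := h
  have h1' : x - 1 ≠ 0 := sub_ne_zero.2 h1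
  have hy1' : y x - 1 ≠ 0 := sub_ne_zero.2 hy1
  have hyx' : x - y x ≠ 0 := sub_ne_zero.2 hyx.symm
  have e : (1 - y x) = -(y x - 1) := by ring
  have e' : (1 - x) = -(x - 1) := by ring
  have e2 : (y x - x) = -(x - y x) := by ring
  have hd : HasDerivAt (fun s => 2 * s * (y s - 1)) _ x :=
    ((hasDerivAt_id x).const_mul 2).mul (hy.sub_const 1)
  have H := ((hasDerivAt_const x (1 : ℂ)).div hK₁ hn₁).mul
    ((hasDerivAt_numerator hy hP (-1) (1 - θ.θinf) (θ.θ₃ - θ.θ₁)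
    (θ.θinf - θ.θ₃ - 1) θ.θ₁).div hd (mul_ne_zero (mul_ne_zero two_ne_zero h0) hy1'))
  have hf : (fun s => Omega θ y K₁ K₂ s 2 0) = fun s => (1 / K₁ s) *
      (((-1) * ((s ^ 2 - s) * deriv y s) + (1 - θ.θinf) * y s ^ 2
        + ((θ.θ₃ - θ.θ₁) * s + (θ.θinf - θ.θ₃ - 1)) * y s + θ.θ₁ * s)
        / (2 * s * (y s - 1))) := by
    funext s
    simp only [Omega, Z, Matrix.of_apply, Matrix.cons_val', Matrix.cons_val_zero,
      Matrix.cons_val_one, Matrix.cons_val_fin_one, Matrix.cons_val]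
    ring
  rw [hf]
  refine H.congr_deriv ?_
  simp only [Omega, Z, l₁, l₂, rhs, Matrix.of_apply, Matrix.cons_val', Matrix.cons_val_zero,
    Matrix.cons_val_one, Matrix.cons_val_fin_one, Matrix.cons_val, id_eq, Pi.div_apply, e, e', e2]
  generalize y x = Y at *
  generalize deriv y x = p at *
  generalize K₁ x = k at *
  generalize K₂ x = k' at *
  field_simp
  ring

theorem hasDerivAt_Omega_21 {θ : Params} {y K₁ K₂ : ℂ → ℂ} {x : ℂ}
    (h : RegularPoint θ y K₁ K₂ x) :
    HasDerivAt (fun s => Omega θ y K₁ K₂ s 2 1)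
      (-(Omega θ y K₁ K₂ x 2 0 * Omega θ y K₁ K₂ x 0 1) / x
        + (θ.θ₃ - θ.θ₂) / (x - 1) * Omega θ y K₁ K₂ x 2 1) x := by
  obtain ⟨h0, h1, hy0, hy1, hyx, hy, hP, hn₁, hn₂, hK₁, hK₂⟩ := h
  have h1' : x - 1 ≠ 0 := sub_ne_zero.2 h1
  have hy1' : y x - 1 ≠ 0 := sub_ne_zero.2 hy1
  have hyx' : x - y x ≠ 0 := sub_ne_zero.2 hyx.symm
  have e : (1 - y x) = -(y x - 1) := by ring
  have e' : (1 - x) = -(x - 1) := by ring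
  have e2 : (y x - x) = -(x - y x) := by ring
  have hd : HasDerivAt (fun s => 2 * s * (1 - y s)) _ x :=
    ((hasDerivAt_id x).const_mul 2).mul (hy.const_sub 1)
  have H := ((hasDerivAt_const x (1 : ℂ)).div hK₂ hn₂).mul
    ((hasDerivAt_numerator hy hP (-1) (1 - θ.θinf) (θ.θinf + θ.θ₂)
    (θ.θinf - θ.θ₃ - 1) (-(θ.θinf + θ.θ₂ - θ.θ₃))).div hd
      (mul_ne_zero (mul_ne_zero two_ne_zero h0) (sub_ne_zero.2 hy1.symm)))
  have hf : (fun s => Omega θ y K₁ K₂ s 2 1) = fun s => (1 / K₂ s) *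
      (((-1) * ((s ^ 2 - s) * deriv y s) + (1 - θ.θinf) * y s ^ 2
        + ((θ.θinf + θ.θ₂) * s + (θ.θinf - θ.θ₃ - 1)) * y s + (-(θ.θinf + θ.θ₂ - θ.θ₃)) * s)
        / (2 * s * (1 - y s))) := by
    funext s
    simp only [Omega, Z, Matrix.of_apply, Matrix.cons_val', Matrix.cons_val_zero,
      Matrix.cons_val_one, Matrix.cons_val_fin_one, Matrix.cons_val]
    ring
  rw [hf]
  refine H.congr_deriv ?_
  simp only [Omega, Z, l₁, l₂, rhs, Matrix.of_apply, Matrix.cons_val', Matrix.cons_val_zero,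
    Matrix.cons_val_one, Matrix.cons_val_fin_one, Matrix.cons_val, id_eq, Pi.div_apply, e, e', e2]
  generalize y x = Y at *
  generalize deriv y x = p at *
  generalize K₁ x = k at *
  generalize K₂ x = k' at *
  field_simp
  ring

/-! ### Diagonalisation of the system and its scalar equations -/

theorem exists_diagonalization {A : Matrix (Fin 3) (Fin 3) ℂ} {m : Fin 3 → ℂ}
    (hm : Function.Injective m) (h : ∀ j, (A - m j • (1 : Matrix (Fin 3) (Fin 3) ℂ)).det = 0) :
    ∃ G : Matrix (Fin 3) (Fin 3) ℂ, IsUnit G.det ∧ G⁻¹ * A * G = Matrix.diagonal m := by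
  have h' : ∀ j, ∃ v : Fin 3 → ℂ, v ≠ 0 ∧ A *ᵥ v = m j • v := fun j => by
    obtain ⟨v, hv, e⟩ := Matrix.exists_mulVec_eq_zero_iff.2 (h j)
    refine ⟨v, hv, ?_⟩
    rw [Matrix.sub_mulVec, Matrix.smul_mulVec, Matrix.one_mulVec, sub_eq_zero] at e
    exact e
  choose v hv0 hv using h'
  have hli : LinearIndependent ℂ v :=
    Module.End.eigenvectors_linearIndependent' (Matrix.toLin' A) m hm v fun j => by
      rw [Module.End.hasEigenvector_iff, Module.End.mem_eigenspace_iff]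
      exact ⟨by simpa using hv j, hv0 j⟩
  set G : Matrix (Fin 3) (Fin 3) ℂ := (Matrix.of v)ᵀ with hG
  have hu : IsUnit G := by
    rw [← Matrix.linearIndependent_cols_iff_isUnit]
    exact hli
  have hdet : IsUnit G.det := (Matrix.isUnit_iff_isUnit_det _).1 hu
  refine ⟨G, hdet, ?_⟩
  have hAG : A * G = G * Matrix.diagonal m := by
    ext i j
    rw [Matrix.mul_diagonal]
    have := congrFun (hv j) i
    simpa [hG, Matrix.mul_apply, Matrix.mulVec, dotProduct, mul_comm] using this
  rw [Matrix.mul_assoc, hAG, ← Matrix.mul_assoc, Matrix.nonsing_inv_mul _ hdet, Matrix.one_mul]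

/-- `G` diagonalises `A` with eigenvalues `m`. -/
def Diagonalizes (A G : Matrix (Fin 3) (Fin 3) ℂ) (m : Fin 3 → ℂ) : Prop :=
  IsUnit G.det ∧ G⁻¹ * A * G = Matrix.diagonal m

namespace Diagonalizes

variable {A G : Matrix (Fin 3) (Fin 3) ℂ} {m : Fin 3 → ℂ}

theorem inv_mul_eq (h : Diagonalizes A G m) : G⁻¹ * A = Matrix.diagonal m * G⁻¹ := by
  rw [← h.2, Matrix.mul_assoc _ G, Matrix.mul_nonsing_inv _ h.1, Matrix.mul_one]

theorem eq_mul (h : Diagonalizes A G m) : A = G * (Matrix.diagonal m * G⁻¹) := by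
  rw [← h.inv_mul_eq, ← Matrix.mul_assoc, Matrix.mul_nonsing_inv _ h.1, Matrix.one_mul]

/-- The products of the third components of the dual eigenvectors sum to `1`. -/
theorem sum_weights (h : Diagonalizes A G m) :
    G 2 0 * G⁻¹ 0 2 + G 2 1 * G⁻¹ 1 2 + G 2 2 * G⁻¹ 2 2 = 1 := by
  have := congrFun (congrFun (Matrix.mul_nonsing_inv _ h.1) 2) 2
  rw [Matrix.mul_apply, Fin.sum_univ_three] at this
  simpa using this

theorem sum_weights_mul (h : Diagonalizes A G m) :
    G 2 0 * G⁻¹ 0 2 * m 0 + G 2 1 * G⁻¹ 1 2 * m 1 + G 2 2 * G⁻¹ 2 2 * m 2 = A 2 2 := by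
  have := congrFun (congrFun h.eq_mul 2) 2
  rw [Matrix.mul_apply, Fin.sum_univ_three] at this
  simp only [Matrix.diagonal_mul] at this
  rw [this]
  ring

theorem sum_weights_mul_sq (h : Diagonalizes A G m) :
    G 2 0 * G⁻¹ 0 2 * m 0 ^ 2 + G 2 1 * G⁻¹ 1 2 * m 1 ^ 2 + G 2 2 * G⁻¹ 2 2 * m 2 ^ 2
      = (A * A) 2 2 := by
  have e : A * A = G * (Matrix.diagonal m * (Matrix.diagonal m * G⁻¹)) := by
    conv_lhs => rw [h.eq_mul]
    have : G⁻¹ * G = 1 := Matrix.nonsing_inv_mul _ h.1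
    calc _ = G * (Matrix.diagonal m * ((G⁻¹ * G) * (Matrix.diagonal m * G⁻¹))) := by
          simp only [Matrix.mul_assoc]
      _ = _ := by rw [this, Matrix.one_mul]
  rw [e, Matrix.mul_apply, Fin.sum_univ_three]
  simp only [Matrix.diagonal_mul]
  ring

/-- In the diagonal gauge the system decouples up to the common inhomogeneity `Y₃`. -/
theorem hasDerivAt_gauge (h : Diagonalizes A G m) {Y : ℂ → Fin 3 → ℂ} (hY : SolvesSystem A Y)
    {z : ℂ} (hz : z ∈ Complex.slitPlane) (j : Fin 3) :
    HasDerivAt (fun s => (G⁻¹ *ᵥ Y s) j) (m j / z * (G⁻¹ *ᵥ Y z) j + G⁻¹ j 2 * Y z 2) z := by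
  have h1 := hasDerivAt_pi.1 (hY z hz)
  have h2 : HasDerivAt (fun s => ∑ i, G⁻¹ j i * Y s i)
      (∑ i, G⁻¹ j i * ((Matrix.diagonal ![(0 : ℂ), 0, 1] + z⁻¹ • A) *ᵥ Y z) i) z :=
    HasDerivAt.fun_sum fun i _ => (h1 i).const_mul _
  refine (h2.congr_deriv ?_ : HasDerivAt (fun s => (G⁻¹ *ᵥ Y s) j) _ z)
  have e1 : ∑ i, G⁻¹ j i * ((Matrix.diagonal ![(0 : ℂ), 0, 1] + z⁻¹ • A) *ᵥ Y z) i
      = (G⁻¹ *ᵥ (Matrix.diagonal ![(0 : ℂ), 0, 1] *ᵥ Y z)) j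
        + z⁻¹ * ((G⁻¹ * A) *ᵥ Y z) j := by
    rw [← Matrix.mulVec_mulVec, Matrix.add_mulVec, Matrix.smul_mulVec]
    simp only [Matrix.mulVec, dotProduct, Pi.add_apply, Pi.smul_apply, smul_eq_mul, mul_add,
      Finset.sum_add_distrib]
    rw [Finset.mul_sum]
    congr 1
    exact Finset.sum_congr rfl fun i _ => by ring
  rw [e1, h.inv_mul_eq, ← Matrix.mulVec_mulVec, Matrix.mulVec_diagonal]
  have e2 : (G⁻¹ *ᵥ (Matrix.diagonal ![(0 : ℂ), 0, 1] *ᵥ Y z)) j = G⁻¹ j 2 * Y z 2 := by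
    simp [Matrix.mulVec, dotProduct, Fin.sum_univ_three, Matrix.diagonal_apply]
  rw [e2]
  ring

theorem third_component (h : Diagonalizes A G m) (v : Fin 3 → ℂ) :
    G 2 0 * (G⁻¹ *ᵥ v) 0 + G 2 1 * (G⁻¹ *ᵥ v) 1 + G 2 2 * (G⁻¹ *ᵥ v) 2 = v 2 := by
  have e : G *ᵥ (G⁻¹ *ᵥ v) = v := by
    rw [Matrix.mulVec_mulVec, Matrix.mul_nonsing_inv _ h.1, Matrix.one_mulVec]
  have := congrFun e 2
  rwa [Matrix.mulVec, dotProduct, Fin.sum_univ_three] at this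

/-- The quadratures: `(z ^ (-m j) Ỹ j)'` is proportional to `z ^ (-m j) Y₃`. -/
theorem hasDerivAt_cpow_gauge (h : Diagonalizes A G m) {Y : ℂ → Fin 3 → ℂ}
    (hY : SolvesSystem A Y) {z : ℂ} (hz : z ∈ Complex.slitPlane) (j : Fin 3) :
    HasDerivAt (fun s => s ^ (-m j) * (G⁻¹ *ᵥ Y s) j) (z ^ (-m j) * (G⁻¹ j 2 * Y z 2)) z := by
  have hz0 : z ≠ 0 := Complex.slitPlane_ne_zero hz
  have h1 := ((hasDerivAt_id z).cpow_const (c := -m j) hz).mul (h.hasDerivAt_gauge hY hz j)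
  refine h1.congr_deriv ?_
  simp only [id, Complex.cpow_sub _ _ hz0, Complex.cpow_one]
  field_simp
  ring

/-- An eigenvector of `A` for `m 2` with vanishing third component forces the corresponding column
of `G` to have vanishing third component, the eigenvalue being simple. -/
theorem apply_two_two_eq_zero (h : Diagonalizes A G m) (hm : Function.Injective m)
    (hv : ∃ v : Fin 3 → ℂ, v ≠ 0 ∧ v 2 = 0 ∧ A *ᵥ v = m 2 • v) : G 2 2 = 0 := by
  obtain ⟨v, hv0, hv2, e⟩ := hv
  have e1 : Matrix.diagonal m *ᵥ (G⁻¹ *ᵥ v) = m 2 • (G⁻¹ *ᵥ v) := by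
    rw [Matrix.mulVec_mulVec, ← h.inv_mul_eq, ← Matrix.mulVec_mulVec, e, Matrix.mulVec_smul]
  have e2 : ∀ j, j ≠ 2 → (G⁻¹ *ᵥ v) j = 0 := fun j hj => by
    have := congrFun e1 j
    rw [Matrix.mulVec_diagonal, Pi.smul_apply, smul_eq_mul] at this
    have h3 : (m j - m 2) * (G⁻¹ *ᵥ v) j = 0 := by linear_combination this
    exact (mul_eq_zero.1 h3).resolve_left (sub_ne_zero.2 fun he => hj (hm he))
  have e3 := h.third_component v
  rw [e2 0 (by decide), e2 1 (by decide), hv2] at e3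
  have e4 : (G⁻¹ *ᵥ v) 2 ≠ 0 := fun h0 => hv0 <| by
    have : G⁻¹ *ᵥ v = 0 := by
      ext j
      fin_cases j
      · exact e2 0 (by decide)
      · exact e2 1 (by decide)
      · exact h0
    have e : G *ᵥ (G⁻¹ *ᵥ v) = v := by
      rw [Matrix.mulVec_mulVec, Matrix.mul_nonsing_inv _ h.1, Matrix.one_mulVec]
    rw [← e, this, Matrix.mulVec_zero]
  simpa [e4] using e3

/-- The rows of `G⁻¹` are left eigenvectors of `A`. -/
theorem inv_apply_two_ne_zero (h : Diagonalizes A G m) (j : Fin 3)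
    (hl : ∀ l : Fin 3 → ℂ, l ᵥ* A = m j • l → l 2 = 0 → l = 0) : G⁻¹ j 2 ≠ 0 := by
  intro h0
  have e : (G⁻¹ j) ᵥ* A = m j • G⁻¹ j := by
    ext k
    have := congrFun (congrFun h.inv_mul_eq j) k
    rw [Matrix.diagonal_mul] at this
    simpa [Matrix.mul_apply, Matrix.vecMul, dotProduct] using this
  have h1 := hl _ e h0
  have h2 := congrFun (congrFun (Matrix.nonsing_inv_mul _ h.1) j) j
  simp [Matrix.mul_apply, h1] at h2

/-- The moments `∑ G 2 j (m j) ^ k Ỹ j` of the solution, in terms of which all derivatives of `w`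
are expressed. -/
def moment (G : Matrix (Fin 3) (Fin 3) ℂ) (m : Fin 3 → ℂ) (Y : ℂ → Fin 3 → ℂ) (k : ℕ) (z : ℂ) : ℂ :=
  G 2 0 * m 0 ^ k * (G⁻¹ *ᵥ Y z) 0 + G 2 1 * m 1 ^ k * (G⁻¹ *ᵥ Y z) 1
    + G 2 2 * m 2 ^ k * (G⁻¹ *ᵥ Y z) 2

theorem moment_zero (h : Diagonalizes A G m) (Y : ℂ → Fin 3 → ℂ) (z : ℂ) :
    moment G m Y 0 z = Y z 2 := by
  simp [moment, ← h.third_component (Y z)]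

theorem hasDerivAt_moment (h : Diagonalizes A G m) {Y : ℂ → Fin 3 → ℂ} (hY : SolvesSystem A Y)
    {z : ℂ} (hz : z ∈ Complex.slitPlane) (k : ℕ) :
    HasDerivAt (moment G m Y k) (moment G m Y (k + 1) z / z
      + (G 2 0 * G⁻¹ 0 2 * m 0 ^ k + G 2 1 * G⁻¹ 1 2 * m 1 ^ k + G 2 2 * G⁻¹ 2 2 * m 2 ^ k)
        * Y z 2) z := by
  have H := ((((h.hasDerivAt_gauge hY hz 0).const_mul (G 2 0 * m 0 ^ k)).add
    ((h.hasDerivAt_gauge hY hz 1).const_mul (G 2 1 * m 1 ^ k))).add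
    ((h.hasDerivAt_gauge hY hz 2).const_mul (G 2 2 * m 2 ^ k)))
  refine (H.congr_deriv ?_ : HasDerivAt (moment G m Y k) _ z)
  simp only [moment]
  ring

theorem hasDerivAt_moment_zero (h : Diagonalizes A G m) {Y : ℂ → Fin 3 → ℂ}
    (hY : SolvesSystem A Y) {z : ℂ} (hz : z ∈ Complex.slitPlane) :
    HasDerivAt (moment G m Y 0) (moment G m Y 1 z / z + moment G m Y 0 z) z := by
  refine (h.hasDerivAt_moment hY hz 0).congr_deriv ?_
  rw [h.moment_zero]
  have := h.sum_weights
  simp only [pow_zero, mul_one]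
  rw [this, one_mul]

theorem hasDerivAt_moment_one (h : Diagonalizes A G m) {Y : ℂ → Fin 3 → ℂ}
    (hY : SolvesSystem A Y) {z : ℂ} (hz : z ∈ Complex.slitPlane) :
    HasDerivAt (moment G m Y 1) (moment G m Y 2 z / z + A 2 2 * moment G m Y 0 z) z := by
  refine (h.hasDerivAt_moment hY hz 1).congr_deriv ?_
  rw [h.moment_zero]
  have := h.sum_weights_mul
  simp only [pow_one]
  rw [this]

/-- The function `w` attached to a solution. -/
def scalar (G : Matrix (Fin 3) (Fin 3) ℂ) (m : Fin 3 → ℂ) (Y : ℂ → Fin 3 → ℂ) (z : ℂ) : ℂ :=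
  z ^ (-m 0) * (G⁻¹ *ᵥ Y z) 0

theorem hasDerivAt_scalar (h : Diagonalizes A G m) {Y : ℂ → Fin 3 → ℂ} (hY : SolvesSystem A Y)
    {z : ℂ} (hz : z ∈ Complex.slitPlane) :
    HasDerivAt (scalar G m Y) (z ^ (-m 0) * (G⁻¹ 0 2 * moment G m Y 0 z)) z := by
  rw [h.moment_zero]
  exact h.hasDerivAt_cpow_gauge hY hz 0

/-- Differentiation of `z ^ (-μ) f`. -/
theorem hasDerivAt_cpow_mul {f : ℂ → ℂ} {f' z : ℂ} (hz : z ∈ Complex.slitPlane)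
    (hf : HasDerivAt f f' z) (μ c : ℂ) :
    HasDerivAt (fun s => s ^ (-μ) * (c * f s)) (z ^ (-μ) * (c * (f' - μ / z * f z))) z := by
  have hz0 : z ≠ 0 := Complex.slitPlane_ne_zero hz
  have h1 := ((hasDerivAt_id z).cpow_const (c := -μ) hz).mul (hf.const_mul c)
  refine h1.congr_deriv ?_
  simp only [id, Complex.cpow_sub _ _ hz0, Complex.cpow_one]
  field_simp
  ring

theorem deriv_scalar_eventuallyEq (h : Diagonalizes A G m) {Y : ℂ → Fin 3 → ℂ}
    (hY : SolvesSystem A Y) {z : ℂ} (hz : z ∈ Complex.slitPlane) :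
    deriv (scalar G m Y) =ᶠ[𝓝 z] fun s => s ^ (-m 0) * (G⁻¹ 0 2 * moment G m Y 0 s) := by
  filter_upwards [Complex.isOpen_slitPlane.mem_nhds hz] with s hs
  exact (h.hasDerivAt_scalar hY hs).deriv

theorem hasDerivAt_deriv_scalar (h : Diagonalizes A G m) {Y : ℂ → Fin 3 → ℂ}
    (hY : SolvesSystem A Y) {z : ℂ} (hz : z ∈ Complex.slitPlane) :
    HasDerivAt (deriv (scalar G m Y)) (z ^ (-m 0) * (G⁻¹ 0 2 *
      (moment G m Y 1 z / z + moment G m Y 0 z - m 0 / z * moment G m Y 0 z))) z :=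
  (hasDerivAt_cpow_mul hz (h.hasDerivAt_moment_zero hY hz) (m 0) (G⁻¹ 0 2)).congr_of_eventuallyEq
    (h.deriv_scalar_eventuallyEq hY hz)

theorem iteratedDeriv_two_scalar (h : Diagonalizes A G m) {Y : ℂ → Fin 3 → ℂ}
    (hY : SolvesSystem A Y) {z : ℂ} (hz : z ∈ Complex.slitPlane) :
    iteratedDeriv 2 (scalar G m Y) z = z ^ (-m 0) * (G⁻¹ 0 2 *
      (moment G m Y 1 z / z + moment G m Y 0 z - m 0 / z * moment G m Y 0 z)) := by
  rw [iteratedDeriv_succ, iteratedDeriv_one]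
  exact (h.hasDerivAt_deriv_scalar hY hz).deriv

theorem iteratedDeriv_three_scalar (h : Diagonalizes A G m) {Y : ℂ → Fin 3 → ℂ}
    (hY : SolvesSystem A Y) {z : ℂ} (hz : z ∈ Complex.slitPlane) :
    iteratedDeriv 3 (scalar G m Y) z = z ^ (-m 0) * (G⁻¹ 0 2 / z ^ 2 *
      (moment G m Y 2 z + z * A 2 2 * moment G m Y 0 z - moment G m Y 1 z
        + (z - m 0) * (moment G m Y 1 z + z * moment G m Y 0 z) + m 0 * moment G m Y 0 z
        - m 0 * (moment G m Y 1 z + (z - m 0) * moment G m Y 0 z))) := by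
  have hz0 : z ≠ 0 := Complex.slitPlane_ne_zero hz
  rw [iteratedDeriv_succ]
  have he : iteratedDeriv 2 (scalar G m Y) =ᶠ[𝓝 z] fun s => s ^ (-m 0) * (G⁻¹ 0 2 *
      (moment G m Y 1 s / s + moment G m Y 0 s - m 0 / s * moment G m Y 0 s)) := by
    filter_upwards [Complex.isOpen_slitPlane.mem_nhds hz] with s hs
    exact h.iteratedDeriv_two_scalar hY hs
  rw [he.deriv_eq]
  have h0 := h.hasDerivAt_moment_zero hY hz
  have h1 := h.hasDerivAt_moment_one hY hz
  have hf := ((h1.div (hasDerivAt_id z) hz0).add h0).sub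
    (((hasDerivAt_const z (m 0)).div (hasDerivAt_id z) hz0).mul h0)
  have := (hasDerivAt_cpow_mul hz hf (m 0) (G⁻¹ 0 2)).deriv
  refine Eq.trans this ?_
  simp only [id, Pi.div_apply, Pi.add_apply, Pi.sub_apply, Pi.mul_apply]
  field_simp
  ring

/-- The quadratures hold as soon as the dual eigenvector for `m 0` has nonzero third component, so
that a scalar equation for `w` is all that remains to be checked. -/
theorem reducesTo (h : Diagonalizes A G m) (hu : G⁻¹ 0 2 ≠ 0) {E : (ℂ → ℂ) → Prop}
    (hE : ∀ Y, SolvesSystem A Y → E (scalar G m Y)) : ReducesTo A (m 0) E := by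
  refine ⟨G, m, fun j => G⁻¹ j 2 / G⁻¹ 0 2, h.1, h.2, rfl, fun Y w hY hw => ?_⟩
  have hw' : w = scalar G m Y := hw
  subst hw'
  refine ⟨hE Y hY, fun j _ z hz => ?_⟩
  have hz0 : z ≠ 0 := Complex.slitPlane_ne_zero hz
  refine (h.hasDerivAt_cpow_gauge hY hz j).congr_deriv ?_
  rw [(h.hasDerivAt_scalar hY hz).deriv, h.moment_zero, Complex.cpow_sub _ _ hz0,
    Complex.cpow_neg, Complex.cpow_neg]
  have h1 : z ^ m 0 ≠ 0 := by simp [Complex.cpow_eq_zero_iff, hz0]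
  have h2 : z ^ m j ≠ 0 := by simp [Complex.cpow_eq_zero_iff, hz0]
  field_simp

/-- The defect of `w` in the confluent hypergeometric equation comes from the third component. -/
theorem confluent_defect (h : Diagonalizes A G m) (hp : G 2 2 * G⁻¹ 2 2 = 0) {Y : ℂ → Fin 3 → ℂ}
    (hY : SolvesSystem A Y) {z : ℂ} (hz : z ∈ Complex.slitPlane) :
    z * iteratedDeriv 2 (scalar G m Y) z + (m 0 - m 1 - z) * deriv (scalar G m Y) z
        - (A 2 2 - m 1) * scalar G m Y z
      = z ^ (-m 0) * (G⁻¹ 0 2 * G 2 2 * (m 2 - m 1) * (G⁻¹ *ᵥ Y z) 2) := by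
  have hz0 : z ≠ 0 := Complex.slitPlane_ne_zero hz
  rw [h.iteratedDeriv_two_scalar hY hz, (h.hasDerivAt_scalar hY hz).deriv]
  have h1 := h.sum_weights
  have h2 := h.sum_weights_mul
  simp only [moment, scalar, pow_zero, pow_one]
  generalize z ^ (-m 0) = Q
  generalize (G⁻¹ *ᵥ Y z) 0 = y0
  generalize (G⁻¹ *ᵥ Y z) 1 = y1
  generalize (G⁻¹ *ᵥ Y z) 2 = y2
  field_simp
  linear_combination (Q * y0) * (h2 - m 1 * h1) + (Q * y0 * (m 1 - m 2)) * hp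

/-- If the third column of `G` has vanishing third component, then `Ỹ₃` does not enter `Y₃`, and the
equations for `Ỹ₁`, `Ỹ₂` separate from it. -/
theorem reducesTo_confluent (h : Diagonalizes A G m) (hu : G⁻¹ 0 2 ≠ 0) (hv : G 2 2 = 0) :
    ReducesTo A (m 0) (Confluent (A 2 2 - m 1) (m 0 - m 1)) :=
  h.reducesTo hu fun Y hY z hz => by
    rw [h.confluent_defect (by simp [hv]) hY hz, hv]
    ring

/-- If the third dual eigenvector has vanishing third component, then `z ^ (-m 2) Ỹ₃` is
constant, which produces the inhomogeneity. -/
theorem reducesTo_confluentInhom (h : Diagonalizes A G m) (hu : G⁻¹ 0 2 ≠ 0)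
    (hp : G 2 2 * G⁻¹ 2 2 = 0) :
    ReducesTo A (m 0) (ConfluentInhom (A 2 2 - m 1) (m 0 - m 1) (m 2 - m 0)) := by
  refine h.reducesTo hu fun Y hY => ?_
  rcases mul_eq_zero.1 hp with hv | hu2
  · refine ⟨0, fun z hz => ?_⟩
    rw [h.confluent_defect hp hY hz, hv]
    ring
  · have hd : ∀ z ∈ Complex.slitPlane,
        HasDerivAt (fun s => s ^ (-m 2) * (G⁻¹ *ᵥ Y s) 2) 0 z := fun z hz =>
      (h.hasDerivAt_cpow_gauge hY hz 2).congr_deriv (by simp [hu2])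
    have hc : ∀ z ∈ Complex.slitPlane, z ^ (-m 2) * (G⁻¹ *ᵥ Y z) 2
        = (fun s : ℂ => s ^ (-m 2) * (G⁻¹ *ᵥ Y s) 2) 1 := fun z hz =>
      Complex.isOpen_slitPlane.is_const_of_deriv_eq_zero
        (Complex.starConvex_one_slitPlane.isPathConnected
          Complex.one_mem_slitPlane).isConnected.isPreconnected
        (fun w hw => (hd w hw).differentiableAt.differentiableWithinAt)
        (fun w hw => (hd w hw).deriv) hz Complex.one_mem_slitPlane
    refine ⟨G⁻¹ 0 2 * G 2 2 * (m 2 - m 1) * (fun s : ℂ => s ^ (-m 2) * (G⁻¹ *ᵥ Y s) 2) 1,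
      fun z hz => ?_⟩
    have hz0 : z ≠ 0 := Complex.slitPlane_ne_zero hz
    rw [h.confluent_defect hp hY hz, ← hc z hz]
    simp only [Complex.cpow_sub _ _ hz0, Complex.cpow_neg]
    have h1 : z ^ m 0 ≠ 0 := by simp [Complex.cpow_eq_zero_iff, hz0]
    have h2 : z ^ m 2 ≠ 0 := by simp [Complex.cpow_eq_zero_iff, hz0]
    field_simp

/-- The derivatives of `w` up to order three involve the three moments only; eliminating these gives
the third order equation. -/
theorem reducesTo_genHypergeometric (h : Diagonalizes A G m) (hu : G⁻¹ 0 2 ≠ 0) :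
    ReducesTo A (m 0) (GenHypergeometric
      (-((A * A) 2 2 - (m 1 + m 2) * A 2 2 + m 1 * m 2)) (-A 2 2 - 1 + m 1 + m 2 - m 0) (-1)
      ((m 0 - m 1) * (m 0 - m 2)) (2 * m 0 - m 1 - m 2 + 1)) := by
  refine h.reducesTo hu fun Y hY z hz => ?_
  have hz0 : z ≠ 0 := Complex.slitPlane_ne_zero hz
  rw [h.iteratedDeriv_three_scalar hY hz, h.iteratedDeriv_two_scalar hY hz,
    (h.hasDerivAt_scalar hY hz).deriv]
  have h1 := h.sum_weights
  have h2 := h.sum_weights_mul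
  have h3 := h.sum_weights_mul_sq
  simp only [moment, scalar, pow_zero, pow_one]
  generalize z ^ (-m 0) = Q
  generalize (G⁻¹ *ᵥ Y z) 0 = y0
  generalize (G⁻¹ *ᵥ Y z) 1 = y1
  generalize (G⁻¹ *ᵥ Y z) 2 = y2
  rw [← h3]
  field_simp
  linear_combination (Q * y0) * (m 1 * m 2 * h1 - (m 1 + m 2) * h2)

end Diagonalizes

/-! ### Reduction of a residue matrix with prescribed spectrum -/

/-- The algebraic properties of the values `Ω(0)` in the vanishing case: the diagonal of `Ω`, the
two vanishing entries and the two nontrivial coefficients of the characteristic polynomial. -/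
structure IsResidue (θ : Params) (A : Matrix (Fin 3) (Fin 3) ℂ) : Prop where
  e00 : A 0 0 = -θ.θ₁
  e11 : A 1 1 = -θ.θ₂
  e22 : A 2 2 = -θ.θ₃
  e01 : A 0 1 = 0
  e10 : A 1 0 = 0
  minors : A 0 2 * A 2 0 + A 1 2 * A 2 1 = θ.θ₁ * θ.θ₂ + θ.θ₁ * θ.θ₃ + θ.θ₂ * θ.θ₃
    - ((θ.θ₁ + θ.θ₂ + θ.θ₃) ^ 2 - θ.θinf ^ 2) / 4
  det : θ.θ₂ * (A 0 2 * A 2 0) + θ.θ₁ * (A 1 2 * A 2 1) = θ.θ₁ * θ.θ₂ * θ.θ₃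

/-- The three pairwise distinct eigenvalues of the residue matrix, in some order, given by their
elementary symmetric functions. -/
structure IsSpectrum (θ : Params) (m : Fin 3 → ℂ) : Prop where
  sum : m 0 + m 1 + m 2 = -(θ.θ₁ + θ.θ₂ + θ.θ₃)
  pairs : m 0 * m 1 + m 0 * m 2 + m 1 * m 2 = ((θ.θ₁ + θ.θ₂ + θ.θ₃) ^ 2 - θ.θinf ^ 2) / 4
  prod : m 0 * m 1 * m 2 = 0
  ne01 : m 0 ≠ m 1
  ne02 : m 0 ≠ m 2
  ne12 : m 1 ≠ m 2

theorem IsSpectrum.injective {θ : Params} {m : Fin 3 → ℂ} (h : IsSpectrum θ m) :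
    Function.Injective m := by
  intro i j hij
  fin_cases i <;> fin_cases j <;>
    first
    | rfl
    | exact absurd hij h.ne01
    | exact absurd hij h.ne02
    | exact absurd hij h.ne12
    | exact absurd hij.symm h.ne01
    | exact absurd hij.symm h.ne02
    | exact absurd hij.symm h.ne12

/-- No nonzero row vector `(l₁, l₂, 0)` is a left eigenvector of `A` for `μ`. -/
def LeftNondegenerate (A : Matrix (Fin 3) (Fin 3) ℂ) (μ : ℂ) : Prop :=
  ∀ l : Fin 3 → ℂ, l ᵥ* A = μ • l → l 2 = 0 → l = 0

/-- Some nonzero column vector `(v₁, v₂, 0)` is an eigenvector of `A` for `μ`. -/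
def RightDegenerate (A : Matrix (Fin 3) (Fin 3) ℂ) (μ : ℂ) : Prop :=
  ∃ v : Fin 3 → ℂ, v ≠ 0 ∧ v 2 = 0 ∧ A *ᵥ v = μ • v

namespace IsResidue

variable {θ : Params} {A : Matrix (Fin 3) (Fin 3) ℂ} {m : Fin 3 → ℂ}

theorem mul_self_two_two (hA : IsResidue θ A) :
    (A * A) 2 2 = A 0 2 * A 2 0 + A 1 2 * A 2 1 + θ.θ₃ ^ 2 := by
  rw [Matrix.mul_apply, Fin.sum_univ_three, hA.e22]
  ring

theorem exists_diagonalizes (hA : IsResidue θ A) (hm : IsSpectrum θ m) :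
    ∃ G, Diagonalizes A G m := by
  refine exists_diagonalization hm.injective fun j => ?_
  have hroot : m j ^ 3 + (θ.θ₁ + θ.θ₂ + θ.θ₃) * m j ^ 2
      + ((θ.θ₁ + θ.θ₂ + θ.θ₃) ^ 2 - θ.θinf ^ 2) / 4 * m j = 0 := by
    have h0 : (m j - m 0) * (m j - m 1) * (m j - m 2) = 0 := by
      fin_cases j <;> simp
    linear_combination h0 + m j ^ 2 * hm.sum - m j * hm.pairs + hm.prod
  rw [Matrix.det_fin_three]
  simp only [Matrix.sub_apply, Matrix.smul_apply, Matrix.one_apply, smul_eq_mul, hA.e00, hA.e11,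
    hA.e22, hA.e01, hA.e10]
  simp
  linear_combination (-1 : ℂ) * hroot + m j * hA.minors + hA.det

/-- Lagrange interpolation of the moments of the weights `G 2 j * G⁻¹ j 2`: the third weight
vanishes if and only if `m 2` is `-θ₁` or `-θ₂`. -/
theorem weight_two (hA : IsResidue θ A) (hm : IsSpectrum θ m) {G} (hG : Diagonalizes A G m) :
    (m 2 - m 0) * (m 2 - m 1) * (G 2 2 * G⁻¹ 2 2) = (m 2 + θ.θ₁) * (m 2 + θ.θ₂) := by
  have h1 := hG.sum_weights
  have h2 := hG.sum_weights_mul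
  have h3 := hG.sum_weights_mul_sq
  rw [hA.e22] at h2
  rw [hA.mul_self_two_two] at h3
  have e := hm.sum
  linear_combination h3 - (m 0 + m 1) * h2 + m 0 * m 1 * h1 + hA.minors + hm.pairs
    + (θ.θ₃ - m 2) * e

/-- If the third weight vanishes, the first one is `(A 2 2 - m 1) / (m 0 - m 1)`. -/
theorem _root_.PVI.Diagonalizes.inv_apply_ne_zero {G} (hG : Diagonalizes A G m)
    (hp : G 2 2 * G⁻¹ 2 2 = 0) (hu : A 2 2 - m 1 ≠ 0 ∨ LeftNondegenerate A (m 0)) :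
    G⁻¹ 0 2 ≠ 0 := by
  rcases hu with hu | hu
  · intro h0
    have h1 := hG.sum_weights
    have h2 := hG.sum_weights_mul
    exact hu (by linear_combination (m 2 - m 1) * hp + m 1 * h1 - h2
      + (G 2 0 * (m 0 - m 1)) * h0)
  · exact hG.inv_apply_two_ne_zero 0 hu

theorem reducesTo_confluent (hA : IsResidue θ A) (hm : IsSpectrum θ m)
    (hu : -θ.θ₃ - m 1 ≠ 0 ∨ LeftNondegenerate A (m 0)) (hv : RightDegenerate A (m 2)) :
    ReducesTo A (m 0) (Confluent (-θ.θ₃ - m 1) (m 0 - m 1)) := by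
  obtain ⟨G, hG⟩ := hA.exists_diagonalizes hm
  have hv' := hG.apply_two_two_eq_zero hm.injective hv
  rw [← hA.e22] at hu ⊢
  exact hG.reducesTo_confluent (hG.inv_apply_ne_zero (by simp [hv']) hu) hv'

theorem reducesTo_confluentInhom (hA : IsResidue θ A) (hm : IsSpectrum θ m)
    (hu : -θ.θ₃ - m 1 ≠ 0 ∨ LeftNondegenerate A (m 0)) (h2 : m 2 = -θ.θ₁ ∨ m 2 = -θ.θ₂) :
    ReducesTo A (m 0) (ConfluentInhom (-θ.θ₃ - m 1) (m 0 - m 1) (m 2 - m 0)) := by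
  obtain ⟨G, hG⟩ := hA.exists_diagonalizes hm
  have hp : G 2 2 * G⁻¹ 2 2 = 0 := by
    have h := hA.weight_two hm hG
    have h0 : (m 2 + θ.θ₁) * (m 2 + θ.θ₂) = 0 := by
      rcases h2 with h2 | h2 <;> rw [h2] <;> ring
    rw [h0] at h
    exact (mul_eq_zero.1 h).resolve_left
      (mul_ne_zero (sub_ne_zero.2 hm.ne02.symm) (sub_ne_zero.2 hm.ne12.symm))
  rw [← hA.e22] at hu ⊢
  exact hG.reducesTo_confluentInhom (hG.inv_apply_ne_zero hp hu) hp

/-- As `A 0 1 = A 1 0 = 0`, a left eigenvector `(l₁, l₂, 0)` with `θ₁ ≠ θ₂` is a multiple of the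
first or of the second basis vector. -/
theorem leftNondegenerate (hA : IsResidue θ A) {μ : ℂ} (h12 : θ.θ₁ ≠ θ.θ₂)
    (ha : μ = -θ.θ₁ → A 0 2 ≠ 0) (hb : μ = -θ.θ₂ → A 1 2 ≠ 0) : LeftNondegenerate A μ := by
  intro l hl h2
  have e0 := congrFun hl 0
  have e1 := congrFun hl 1
  have e2 := congrFun hl 2
  simp only [Matrix.vecMul, dotProduct, Fin.sum_univ_three, Pi.smul_apply, smul_eq_mul, hA.e00,
    hA.e01, hA.e10, hA.e11, h2] at e0 e1 e2
  have f0 : l 0 * (μ + θ.θ₁) = 0 := by linear_combination -e0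
  have f1 : l 1 * (μ + θ.θ₂) = 0 := by linear_combination -e1
  have key : l 0 = 0 ∧ l 1 = 0 := by
    rcases mul_eq_zero.1 f0 with h0 | h0
    · refine ⟨h0, ?_⟩
      rcases mul_eq_zero.1 f1 with h1 | h1
      · exact h1
      · rw [h0] at e2
        have : l 1 * A 1 2 = 0 := by linear_combination e2
        exact (mul_eq_zero.1 this).resolve_right (hb (by linear_combination h1))
    · have hμ : μ = -θ.θ₁ := by linear_combination h0
      have h1 : l 1 = 0 := (mul_eq_zero.1 f1).resolve_right fun h => h12 (by
        linear_combination h0 - h)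
      refine ⟨?_, h1⟩
      rw [h1] at e2
      have : l 0 * A 0 2 = 0 := by linear_combination e2
      exact (mul_eq_zero.1 this).resolve_right (ha hμ)
  ext j
  fin_cases j
  · exact key.1
  · exact key.2
  · exact h2

theorem rightDegenerate_of_apply_two_zero (hA : IsResidue θ A) (h : A 2 0 = 0) :
    RightDegenerate A (-θ.θ₁) := by
  refine ⟨![1, 0, 0], fun h0 => by simpa using congrFun h0 0, rfl, ?_⟩
  ext j
  fin_cases j <;> simp [Matrix.mulVec, dotProduct, Fin.sum_univ_three, hA.e00, hA.e10, h]

theorem rightDegenerate_of_apply_two_one (hA : IsResidue θ A) (h : A 2 1 = 0) :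
    RightDegenerate A (-θ.θ₂) := by
  refine ⟨![0, 1, 0], fun h0 => by simpa using congrFun h0 1, rfl, ?_⟩
  ext j
  fin_cases j <;> simp [Matrix.mulVec, dotProduct, Fin.sum_univ_three, hA.e01, hA.e11, h]

/-- If `θ₁ = θ₂`, the plane of vectors `(v₁, v₂, 0)` meets the kernel of the third row. -/
theorem rightDegenerate_of_eq (hA : IsResidue θ A) (h : θ.θ₁ = θ.θ₂) :
    RightDegenerate A (-θ.θ₁) := by
  by_cases h0 : A 2 0 = 0
  · exact hA.rightDegenerate_of_apply_two_zero h0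
  · refine ⟨![-A 2 1, A 2 0, 0], fun h1 => h0 (by simpa using congrFun h1 1), rfl, ?_⟩
    ext j
    fin_cases j <;>
      simp [Matrix.mulVec, dotProduct, Fin.sum_univ_three, hA.e00, hA.e11, hA.e01, hA.e10, h]
    ring

theorem reducesToGenHypergeometric (hA : IsResidue θ A) (hθ : θ.DistinctEigenvalues)
    (hu : LeftNondegenerate A ((θ.θinf - θ.θ₁ - θ.θ₂ - θ.θ₃) / 2)) :
    ReducesToGenHypergeometric θ A := by
  obtain ⟨h0, h1, h2⟩ := hθ
  set μ := (θ.θinf - θ.θ₁ - θ.θ₂ - θ.θ₃) / 2 with hμ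
  have hm : IsSpectrum θ ![μ, 0, -(θ.θinf + θ.θ₁ + θ.θ₂ + θ.θ₃) / 2] := by
    constructor <;> simp [hμ]
    · ring
    · ring
    · intro h; exact h1 (by linear_combination h)
    · intro h; exact h0 (by linear_combination h / 2)
    · intro h; exact h2 (by linear_combination 2 * h)
  obtain ⟨G, hG⟩ := hA.exists_diagonalizes hm
  have H := hG.reducesTo_genHypergeometric (hG.inv_apply_two_ne_zero 0 hu)
  rw [hA.mul_self_two_two, hA.minors, hA.e22] at H
  unfold ReducesToGenHypergeometric
  convert H using 2
  all_goals simp [hμ]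
  all_goals ring

end IsResidue

/-! ### Local analysis at `0` -/

theorem nhdsWithin_slitPlane_le : 𝓝[Complex.slitPlane] (0 : ℂ) ≤ 𝓝[≠] 0 :=
  nhdsWithin_mono _ fun _ hx => Complex.slitPlane_ne_zero hx

instance nhdsWithin_slitPlane_neBot : (𝓝[Complex.slitPlane] (0 : ℂ)).NeBot := by
  rw [← mem_closure_iff_nhdsWithin_neBot, mem_closure_iff_seq_limit]
  refine ⟨fun n : ℕ => ((1 / ((n : ℝ) + 1) : ℝ) : ℂ), fun n => ?_, ?_⟩
  · exact Complex.ofReal_mem_slitPlane.2 (by positivity)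
  · have := (Complex.continuous_ofReal.tendsto 0).comp tendsto_one_div_add_atTop_nhds_zero_nat
    simpa [Function.comp_def] using this

/-- A zero of a holomorphic function can be divided out. -/
theorem exists_eq_mul_of_apply_zero {f : ℂ → ℂ} (hf : AnalyticAt ℂ f 0) (h0 : f 0 = 0) :
    ∃ g, AnalyticAt ℂ g 0 ∧ ∀ᶠ x in 𝓝 (0 : ℂ), f x = x * g x := by
  have h1 : ((1 : ℕ) : ℕ∞) ≤ analyticOrderAt f 0 := by
    rw [Nat.cast_one, Order.one_le_iff_ne_zero, hf.analyticOrderAt_ne_zero]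
    exact h0
  obtain ⟨g, hg, h⟩ := (natCast_le_analyticOrderAt hf).1 h1
  exact ⟨g, hg, by simpa using h⟩

/-- The order of vanishing at `0`. -/
theorem exists_eq_pow_mul {f : ℂ → ℂ} (hf : AnalyticAt ℂ f 0) (h0 : ∀ᶠ x in 𝓝[≠] (0 : ℂ), f x ≠ 0) :
    ∃ (m : ℕ) (g : ℂ → ℂ), AnalyticAt ℂ g 0 ∧ g 0 ≠ 0 ∧ ∀ᶠ x in 𝓝 (0 : ℂ), f x = x ^ m * g x := by
  have h : ¬ ∀ᶠ x in 𝓝 (0 : ℂ), f x = 0 := fun h => by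
    obtain ⟨x, h1, h2⟩ := (h0.and (h.filter_mono nhdsWithin_le_nhds)).exists
    exact h1 h2
  obtain ⟨m, g, hg, hg0, hfg⟩ := hf.exists_eventuallyEq_pow_smul_nonzero_iff.2 h
  exact ⟨m, g, hg, hg0, by simpa using hfg⟩

theorem eq_of_eventuallyEq_punctured {f g : ℂ → ℂ} (hf : ContinuousAt f 0) (hg : ContinuousAt g 0)
    {l : Filter ℂ} [l.NeBot] (hl : l ≤ 𝓝 0) (h : ∀ᶠ x in l, f x = g x) : f 0 = g 0 :=
  tendsto_nhds_unique (hf.mono_left hl) ((hg.mono_left hl).congr' (h.mono fun _ hx => hx.symm))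

/-- If `l` has at most a simple pole at `0` with residue `r`, then its exponential primitives are
`x ^ r` times a nonvanishing holomorphic function. -/
theorem exists_eq_cpow_mul_of_isExpPrimitive {l k : ℂ → ℂ} (hk : IsExpPrimitive l k) {ρ : ℂ → ℂ}
    (hρ : AnalyticAt ℂ ρ 0) (hl : ∀ᶠ x in 𝓝[≠] (0 : ℂ), x * l x = ρ x) :
    ∃ h : ℂ → ℂ, AnalyticAt ℂ h 0 ∧ h 0 ≠ 0 ∧
      (∀ᶠ x in 𝓝[Complex.slitPlane] (0 : ℂ), k x = x ^ ρ 0 * h x) ∧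
      ∀ᶠ x in 𝓝[≠] (0 : ℂ), HasDerivAt h ((l x - ρ 0 / x) * h x) x := by
  obtain ⟨g, hg, hρg⟩ := exists_eq_mul_of_apply_zero (hρ.sub analyticAt_const)
    (show ρ 0 - ρ 0 = 0 from sub_self _)
  obtain ⟨k0, L, hk0, hL⟩ := hk
  have hlg : ∀ᶠ x in 𝓝[≠] (0 : ℂ), l x = ρ 0 / x + g x := by
    filter_upwards [hl, hρg.filter_mono nhdsWithin_le_nhds, self_mem_nhdsWithin] with x h1 h2 h3
    have h3 : x ≠ 0 := h3
    have h2 : ρ x - ρ 0 = x * g x := h2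
    field_simp
    linear_combination h1 + h2
  obtain ⟨ε, hε, hball⟩ : ∃ ε > 0, ∀ x ∈ Metric.ball (0 : ℂ) ε, AnalyticAt ℂ g x ∧
      (x ∈ Complex.slitPlane → (HasDerivAt L (l x) x ∧ k x = k0 * Complex.exp (L x)) ∧
        l x = ρ 0 / x + g x) := by
    have h1 := hg.eventually_analyticAt
    have h2 := (eventually_nhdsWithin_iff.1 (hL.and (hlg.filter_mono nhdsWithin_slitPlane_le)))
    obtain ⟨ε, hε, h⟩ := Metric.eventually_nhds_iff_ball.1 (h1.and h2)
    exact ⟨ε, hε, h⟩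
  obtain ⟨P, hP⟩ := DifferentiableOn.isExactOn_ball (f := g) (c := 0) (r := ε)
    fun x hx => (hball x hx).1.differentiableAt.differentiableWithinAt
  -- on the slit disc `S`, `L` and `ρ 0 log + P` are primitives of the same function
  set S := Metric.ball (0 : ℂ) ε ∩ Complex.slitPlane with hS
  have hSo : IsOpen S := Metric.isOpen_ball.inter Complex.isOpen_slitPlane
  have hp : ((ε / 2 : ℝ) : ℂ) ∈ S := ⟨by
    rw [mem_ball_zero_iff, Complex.norm_real, Real.norm_of_nonneg (by positivity)]
    linarith, Complex.ofReal_mem_slitPlane.2 (by positivity)⟩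
  have hSc : IsPreconnected S := by
    have h1 : StarConvex ℝ ((ε / 2 : ℝ) : ℂ) S :=
      ((convex_ball (0 : ℂ) ε).starConvex hp.1).inter
        (Complex.starConvex_slitPlane (by exact_mod_cast (show (0 : ℝ) < ε / 2 by positivity)))
    exact (h1.isPathConnected hp).isConnected.isPreconnected
  have hD : ∀ x ∈ S, HasDerivAt (fun s => L s - (ρ 0 * Complex.log s + P s)) 0 x := fun x hx => by
    obtain ⟨⟨h1, -⟩, h2⟩ := (hball x hx.1).2 hx.2
    have h3 := h1.sub (((Complex.hasDerivAt_log hx.2).const_mul (ρ 0)).add (hP x hx.1))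
    refine h3.congr_deriv ?_
    rw [h2]
    ring
  set c := (fun s => L s - (ρ 0 * Complex.log s + P s)) ((ε / 2 : ℝ) : ℂ) with hc
  have hconst : ∀ x ∈ S, L x - (ρ 0 * Complex.log x + P x) = c := fun x hx =>
    hSo.is_const_of_deriv_eq_zero hSc
      (fun w hw => (hD w hw).differentiableAt.differentiableWithinAt)
      (fun w hw => (hD w hw).deriv) hx hp
  have hPan : AnalyticAt ℂ P 0 := by
    refine (DifferentiableOn.analyticAt (s := Metric.ball 0 ε)
      (fun x hx => (hP x hx).differentiableAt.differentiableWithinAt) (Metric.ball_mem_nhds _ hε))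
  refine ⟨fun x => k0 * Complex.exp (c + P x), ?_, ?_, ?_, ?_⟩
  · exact analyticAt_const.mul ((analyticAt_const.add hPan).cexp)
  · exact mul_ne_zero hk0 (Complex.exp_ne_zero _)
  · have : S ∈ 𝓝[Complex.slitPlane] (0 : ℂ) :=
      Filter.inter_mem (mem_nhdsWithin_of_mem_nhds (Metric.ball_mem_nhds _ hε)) self_mem_nhdsWithin
    filter_upwards [this] with x hx
    obtain ⟨⟨-, h1⟩, -⟩ := (hball x hx.1).2 hx.2
    have hx0 := Complex.slitPlane_ne_zero hx.2
    have e : L x = Complex.log x * ρ 0 + (c + P x) := by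
      linear_combination hconst x hx
    rw [h1, e, Complex.exp_add, Complex.cpow_def_of_ne_zero hx0]
    ring
  · filter_upwards [hlg, mem_nhdsWithin_of_mem_nhds (Metric.ball_mem_nhds _ hε)] with x h1 h2
    have h3 := (((hP x h2).const_add c).cexp).const_mul k0
    refine h3.congr_deriv ?_
    rw [h1]
    ring

/-- The only powers of `x` which agree with a holomorphic function up to a holomorphic unit are
those with a natural exponent. -/
theorem exists_nat_of_cpow_mul_eq {s : ℂ} {h W : ℂ → ℂ} (hh : AnalyticAt ℂ h 0) (h0 : h 0 ≠ 0)
    (hW : AnalyticAt ℂ W 0) (e : ∀ᶠ x in 𝓝[Complex.slitPlane] (0 : ℂ), x ^ s * h x = W x) :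
    ∃ n : ℕ, s = n := by
  have hne : ∀ᶠ x in 𝓝 (0 : ℂ), h x ≠ 0 := hh.continuousAt.eventually_ne h0
  have hW0 : ¬ ∀ᶠ x in 𝓝 (0 : ℂ), W x = 0 := fun hz => by
    obtain ⟨x, ⟨⟨h1, h2⟩, h3⟩, h4⟩ := (((e.and (hne.filter_mono nhdsWithin_le_nhds)).and
      (hz.filter_mono nhdsWithin_le_nhds)).and self_mem_nhdsWithin).exists
    rw [h3] at h1
    have : x ^ s ≠ 0 := by simp [Complex.cpow_eq_zero_iff, Complex.slitPlane_ne_zero h4]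
    exact mul_ne_zero this h2 h1
  obtain ⟨n, g, hg, hg0, hWg⟩ := hW.exists_eventuallyEq_pow_smul_nonzero_iff.2 hW0
  refine ⟨n, ?_⟩
  -- the unit `u = x ^ (s - n)` satisfies `x u' = (s - n) u`; compare values at `0`
  set u : ℂ → ℂ := fun x => g x / h x with hu
  have hua : AnalyticAt ℂ u 0 := hg.div hh h0
  have hu0 : u 0 ≠ 0 := div_ne_zero hg0 h0
  have key : ∀ᶠ x in 𝓝[Complex.slitPlane] (0 : ℂ), x ^ (s - n) = u x := by
    filter_upwards [e, hne.filter_mono nhdsWithin_le_nhds, hWg.filter_mono nhdsWithin_le_nhds,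
      self_mem_nhdsWithin] with x h1 h2 h3 h4
    have hx := Complex.slitPlane_ne_zero h4
    rw [h3, sub_zero, smul_eq_mul] at h1
    rw [Complex.cpow_sub _ _ hx, Complex.cpow_natCast, hu]
    field_simp
    linear_combination h1
  have key2 : ∀ᶠ x in 𝓝[Complex.slitPlane] (0 : ℂ), x * deriv u x = (s - n) * u x := by
    have h1 := eventually_eventually_nhdsWithin.2 key
    filter_upwards [h1, self_mem_nhdsWithin] with x h2 h4
    rw [IsOpen.nhdsWithin_eq Complex.isOpen_slitPlane h4] at h2
    have hx := Complex.slitPlane_ne_zero h4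
    have h5 : deriv u x = deriv (fun x : ℂ => x ^ (s - n)) x :=
      (EventuallyEq.deriv_eq (h2.mono fun _ h => h)).symm
    have h6 := ((hasDerivAt_id x).cpow_const (c := s - n) h4).deriv
    rw [h5]
    refine (congrArg (x * ·) h6).trans ?_
    rw [← h2.self_of_nhds]
    simp only [id, Complex.cpow_sub _ _ hx, Complex.cpow_one]
    field_simp
  have h3 := eq_of_eventuallyEq_punctured (f := fun x => x * deriv u x)
    (g := fun x => (s - n) * u x) (continuousAt_id.mul hua.deriv.continuousAt)
    (continuousAt_const.mul hua.continuousAt) nhdsWithin_le_nhds key2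
  simp only [zero_mul] at h3
  exact sub_eq_zero.1 ((mul_eq_zero.1 h3.symm).resolve_right hu0)

/-- A linear system with a regular singular point whose residue matrix has eigenvalues `-n` and `0`:
a solution `(x ^ (-n) F, x ^ (-n) H)` with `F(0) = 0` has no component along the eigenvalue `-n`
and is therefore holomorphic. -/
theorem exists_eq_pow_mul_of_regularSingular {n : ℕ} {F H A B C : ℂ → ℂ}
    (hF : AnalyticAt ℂ F 0) (hH : AnalyticAt ℂ H 0) (hA : AnalyticAt ℂ A 0)
    (hB : AnalyticAt ℂ B 0) (hC : AnalyticAt ℂ C 0) (hF0 : F 0 = 0)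
    (e1 : ∀ᶠ x in 𝓝[≠] (0 : ℂ), deriv F x = A x * H x)
    (e2 : ∀ᶠ x in 𝓝[≠] (0 : ℂ), x * deriv H x = n * H x + B x * F x + x * C x * H x) :
    ∃ f g, AnalyticAt ℂ f 0 ∧ AnalyticAt ℂ g 0 ∧ (∀ᶠ x in 𝓝 0, F x = x ^ (n + 1) * f x) ∧
      ∀ᶠ x in 𝓝 0, H x = x ^ n * g x := by
  suffices h : ∀ j ≤ n, ∃ f g, AnalyticAt ℂ f 0 ∧ AnalyticAt ℂ g 0 ∧
      (∀ᶠ x in 𝓝 0, F x = x ^ (j + 1) * f x) ∧ ∀ᶠ x in 𝓝 0, H x = x ^ j * g x from h n le_rfl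
  intro j
  induction j with
  | zero =>
    intro _
    obtain ⟨f, hf, hFf⟩ := exists_eq_mul_of_apply_zero hF hF0
    exact ⟨f, H, hf, hH, by simpa using hFf, by simp⟩
  | succ j ih =>
    intro hj
    obtain ⟨f, g, hf, hg, hFf, hHg⟩ := ih (by omega)
    have dF : ∀ᶠ x in 𝓝 (0 : ℂ), deriv F x = x ^ j * ((j + 1) * f x + x * deriv f x) := by
      filter_upwards [hFf.eventually_nhds, hf.eventually_analyticAt] with x h1 h2
      rw [EventuallyEq.deriv_eq h1]
      refine (((hasDerivAt_pow (j + 1) x).mul h2.differentiableAt.hasDerivAt).deriv).trans ?_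
      rw [Nat.add_sub_cancel]
      push_cast
      ring
    have dH : ∀ᶠ x in 𝓝 (0 : ℂ), x * deriv H x = x ^ j * (j * g x + x * deriv g x) := by
      filter_upwards [hHg.eventually_nhds, hg.eventually_analyticAt] with x h1 h2
      rw [EventuallyEq.deriv_eq h1, ((hasDerivAt_pow j x).fun_mul
        h2.differentiableAt.hasDerivAt).deriv]
      rcases j with _ | j
      · simp
      · simp only [Nat.add_sub_cancel]
        ring
    have hdf := hf.deriv.continuousAt
    have hdg := hg.deriv.continuousAt
    have hcf := hf.continuousAt
    have hcg := hg.continuousAt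
    have hcA := hA.continuousAt
    have hcB := hB.continuousAt
    have hcC := hC.continuousAt
    -- compare the coefficients of `x ^ j` in both equations
    have g0 : g 0 = 0 := by
      have h1 : ∀ᶠ x in 𝓝[≠] (0 : ℂ), (j : ℂ) * g x + x * deriv g x
          = n * g x + x * (B x * f x + C x * g x) := by
        filter_upwards [e2, dH.filter_mono nhdsWithin_le_nhds, hFf.filter_mono nhdsWithin_le_nhds,
          hHg.filter_mono nhdsWithin_le_nhds, self_mem_nhdsWithin] with x h1 h2 h3 h4 h5
        rw [h2, h3, h4] at h1
        refine mul_left_cancel₀ (pow_ne_zero j (show x ≠ 0 from h5)) ?_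
        rw [h1]
        ring
      have h2 := eq_of_eventuallyEq_punctured (by fun_prop) (by fun_prop) nhdsWithin_le_nhds h1
      have h3 : ((j : ℂ) - n) * g 0 = 0 := by
        simp only [zero_mul, add_zero] at h2
        linear_combination h2
      refine (mul_eq_zero.1 h3).resolve_left (sub_ne_zero.2 ?_)
      exact_mod_cast (by omega : j ≠ n)
    have f0 : f 0 = 0 := by
      have h1 : ∀ᶠ x in 𝓝[≠] (0 : ℂ), ((j : ℂ) + 1) * f x + x * deriv f x = A x * g x := by
        filter_upwards [e1, dF.filter_mono nhdsWithin_le_nhds,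
          hHg.filter_mono nhdsWithin_le_nhds, self_mem_nhdsWithin] with x h1 h2 h4 h5
        rw [h2, h4] at h1
        refine mul_left_cancel₀ (pow_ne_zero j (show x ≠ 0 from h5)) ?_
        rw [h1]
        ring
      have h2 := eq_of_eventuallyEq_punctured (by fun_prop) (by fun_prop) nhdsWithin_le_nhds h1
      simp only [zero_mul, add_zero, g0, mul_zero] at h2
      exact (mul_eq_zero.1 h2).resolve_left (by exact_mod_cast j.succ_ne_zero)
    obtain ⟨f', hf', hff⟩ := exists_eq_mul_of_apply_zero hf f0
    obtain ⟨g', hg', hgg⟩ := exists_eq_mul_of_apply_zero hg g0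
    refine ⟨f', g', hf', hg', ?_, ?_⟩
    · filter_upwards [hFf, hff] with x h1 h2
      rw [h1, h2]
      ring
    · filter_upwards [hHg, hgg] with x h1 h2
      rw [h1, h2]
      ring

/-! ### Leading exponents of transcendents tangent to a singular solution -/

/-- The expansion `y = c₀ + c₁ x + x ^ m u` with `u 0 ≠ 0`, differentiated twice. -/
structure OrderData (y : ℂ → ℂ) (c₀ c₁ : ℂ) (m : ℕ) (u S₁ S₂ : ℂ → ℂ) : Prop where
  an_u : AnalyticAt ℂ u 0
  an_S₁ : AnalyticAt ℂ S₁ 0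
  an_S₂ : AnalyticAt ℂ S₂ 0
  u_ne : u 0 ≠ 0
  S₁_zero : S₁ 0 = m * u 0
  S₂_zero : S₂ 0 = m * (m - 1) * u 0
  eq : ∀ᶠ x in 𝓝 0, y x = c₀ + c₁ * x + x ^ m * u x
  deriv_eq : ∀ᶠ x in 𝓝 0, x * (deriv y x - c₁) = x ^ m * S₁ x
  deriv_deriv_eq : ∀ᶠ x in 𝓝 0, x ^ 2 * deriv (deriv y) x = x ^ m * S₂ x

theorem eventually_mul_deriv_pow_mul {f u : ℂ → ℂ} {m : ℕ} (hu : AnalyticAt ℂ u 0)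
    (h : ∀ᶠ x in 𝓝 (0 : ℂ), f x = x ^ m * u x) :
    ∀ᶠ x in 𝓝 (0 : ℂ), x * deriv f x = x ^ m * (m * u x + x * deriv u x) := by
  filter_upwards [h.eventually_nhds, hu.eventually_analyticAt] with x h1 h2
  rw [EventuallyEq.deriv_eq h1, ((hasDerivAt_pow m x).fun_mul
    h2.differentiableAt.hasDerivAt).deriv]
  rcases m with _ | m
  · simp
  · rw [Nat.add_sub_cancel]
    ring

theorem exists_orderData {y : ℂ → ℂ} (hy : AnalyticAt ℂ y 0) {c₀ c₁ : ℂ}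
    (hne : ∀ᶠ x in 𝓝[≠] (0 : ℂ), y x ≠ c₀ + c₁ * x) :
    ∃ m u S₁ S₂, OrderData y c₀ c₁ m u S₁ S₂ := by
  have hf : AnalyticAt ℂ (fun x => y x - c₀ - c₁ * x) 0 := by fun_prop
  obtain ⟨m, u, hu, hu0, hfu⟩ := exists_eq_pow_mul hf (hne.mono fun x hx h => hx (by
    linear_combination h))
  have hS₁ : AnalyticAt ℂ (fun x => (m : ℂ) * u x + x * deriv u x) 0 := by
    have := hu.deriv
    fun_prop
  have hd : ∀ᶠ x in 𝓝 (0 : ℂ), deriv (fun x => y x - c₀ - c₁ * x) x = deriv y x - c₁ := by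
    filter_upwards [hy.eventually_analyticAt] with x hx
    have h1 := ((hx.differentiableAt.hasDerivAt.sub_const c₀).sub
      ((hasDerivAt_id' x).const_mul c₁)).deriv
    rw [mul_one] at h1
    exact h1
  have e1 : ∀ᶠ x in 𝓝 (0 : ℂ), x * (deriv y x - c₁) = x ^ m * (m * u x + x * deriv u x) := by
    filter_upwards [eventually_mul_deriv_pow_mul hu hfu, hd] with x h1 h2
    rw [← h2, h1]
  refine ⟨m, u, _, fun x => (m - 1) * (m * u x + x * deriv u x)
    + x * deriv (fun x => (m : ℂ) * u x + x * deriv u x) x, hu, hS₁, ?_, hu0, by simp,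
    by simp; ring, ?_, e1, ?_⟩
  · have := hS₁.deriv
    fun_prop
  · filter_upwards [hfu] with x hx
    linear_combination hx
  · have h2 := eventually_mul_deriv_pow_mul hS₁ e1
    filter_upwards [h2, e1, hy.deriv.eventually_analyticAt] with x h3 h4 hx
    have h5 := ((hasDerivAt_id' x).fun_mul
      (hx.differentiableAt.hasDerivAt.sub_const c₁)).deriv
    rw [h5] at h3
    linear_combination h3 - h4

namespace OrderData

variable {y : ℂ → ℂ} {c₀ c₁ : ℂ} {m : ℕ} {u S₁ S₂ : ℂ → ℂ}

theorem exists_succ (h : OrderData y c₀ c₁ m u S₁ S₂) (h0 : y 0 = c₀) : ∃ n, m = n + 1 := by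
  rcases m with _ | m
  · have := h.eq.self_of_nhds
    simp only [h0, mul_zero, add_zero, pow_zero, one_mul, left_eq_add] at this
    exact absurd this h.u_ne
  · exact ⟨m, rfl⟩

theorem exists_add_two (h : OrderData y c₀ c₁ m u S₁ S₂) (hy : AnalyticAt ℂ y 0) (h0 : y 0 = c₀)
    (h1 : deriv y 0 = c₁) : ∃ n, m = n + 2 := by
  obtain ⟨n, rfl⟩ := h.exists_succ h0
  rcases n with _ | n
  · have e : ∀ᶠ x in 𝓝[≠] (0 : ℂ), deriv y x - c₁ = S₁ x := by
      filter_upwards [h.deriv_eq.filter_mono nhdsWithin_le_nhds, self_mem_nhdsWithin] with x hx hx0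
      exact mul_left_cancel₀ (show x ≠ 0 from hx0) (by simpa using hx)
    have e0 : deriv y 0 - c₁ = S₁ 0 := eq_of_eventuallyEq_punctured
      (hy.deriv.continuousAt.sub continuousAt_const) h.an_S₁.continuousAt nhdsWithin_le_nhds e
    have e1 := h.S₁_zero
    rw [← e0, h1, sub_self] at e1
    exact absurd (by simpa using e1.symm) h.u_ne
  · exact ⟨n, rfl⟩

end OrderData

/-- The order of vanishing of `y - 1` for a transcendent with `y(0) = 1` in the case `θ₃ = 0`. PVI
multiplied by `x ^ (2 - m)` extends continuously to `0`, and the values there give the indicial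
equation. -/
theorem exponent_at_one {θ : Params} {y : ℂ → ℂ} (hy : IsHolomorphicBranch θ y) (h3 : θ.θ₃ = 0)
    (h0 : y 0 = 1) {m : ℕ} {u S₁ S₂ : ℂ → ℂ} (h : OrderData y 1 0 m u S₁ S₂) :
    (m : ℂ) ^ 2 = (θ.θinf - 1) ^ 2 := by
  obtain ⟨n, rfl⟩ := h.exists_succ h0
  have cy := hy.1.continuousAt
  have cu := h.an_u.continuousAt
  have c1 := h.an_S₁.continuousAt
  have c2 := h.an_S₂.continuousAt
  have key : ∀ᶠ x in 𝓝[≠] (0 : ℂ), S₂ x = (1 / y x + 1 / (y x - x)) * x ^ (n + 1) * S₁ x ^ 2 / 2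
      + S₁ x ^ 2 / u x / 2 - (1 + x / (x - 1) + x / (y x - x)) * S₁ x
      + y x * u x * (y x - x) / (x - 1) ^ 2 * ((θ.θinf - 1) ^ 2 / 2
        - θ.θ₁ ^ 2 / 2 * (x / y x ^ 2) + (1 - θ.θ₂ ^ 2) / 2 * (x * (x - 1) / (y x - x) ^ 2)) := by
    have hx1 : ∀ᶠ x : ℂ in 𝓝[≠] (0 : ℂ), x ≠ 1 :=
      (continuousAt_id.eventually_ne (by simp)).filter_mono nhdsWithin_le_nhds
    filter_upwards [hy.2, h.eq.filter_mono nhdsWithin_le_nhds,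
      h.deriv_eq.filter_mono nhdsWithin_le_nhds, h.deriv_deriv_eq.filter_mono nhdsWithin_le_nhds,
      self_mem_nhdsWithin, (cu.eventually_ne h.u_ne).filter_mono nhdsWithin_le_nhds, hx1]
      with x ⟨hy0, hy1, hyx, hq⟩ e0 e1 e2 hx hu hx1
    have hx : x ≠ 0 := hx
    have hX : x ^ (n + 1) ≠ 0 := pow_ne_zero _ hx
    have ep : deriv y x = x ^ (n + 1) * S₁ x / x := by
      field_simp
      linear_combination e1
    have eS : S₂ x = x ^ 2 * rhs θ x (y x) (deriv y x) / x ^ (n + 1) := by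
      rw [← hq]
      field_simp
      linear_combination -e2
    have hyx' : y x - x ≠ 0 := sub_ne_zero.2 hyx
    have hx1' : x - 1 ≠ 0 := sub_ne_zero.2 hx1
    have ey : y x - 1 = x ^ (n + 1) * u x := by linear_combination e0
    rw [eS, ep, rhs, h3, ey]
    generalize x ^ (n + 1) = X at *
    field_simp
    ring
  have hval := eq_of_eventuallyEq_punctured c2 (by
    have a1 : (0 : ℂ) - 1 ≠ 0 := by simp
    have a2 : y 0 ≠ 0 := by simp [h0]
    have a3 : y 0 - 0 ≠ 0 := by simp [h0]
    have a4 := h.u_ne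
    have a5 : ((0 : ℂ) - 1) ^ 2 ≠ 0 := by simp
    have a6 : y 0 ^ 2 ≠ 0 := by simp [h0]
    have a7 : (y 0 - 0) ^ 2 ≠ 0 := by simp [h0]
    fun_prop (disch := assumption)) nhdsWithin_le_nhds key
  have hu := h.u_ne
  rw [h.S₁_zero, h.S₂_zero, h0] at hval
  simp at hval
  field_simp at hval
  push_cast
  linear_combination hval

/-- The order of vanishing of `y` for a transcendent with `y(0) = y'(0) = 0` in the case `θ₁ = 0`.
-/
theorem exponent_at_zero {θ : Params} {y : ℂ → ℂ} (hy : IsHolomorphicBranch θ y) (h1 : θ.θ₁ = 0)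
    (h0 : y 0 = 0) (h0' : deriv y 0 = 0) {m : ℕ} {u S₁ S₂ : ℂ → ℂ}
    (h : OrderData y 0 0 m u S₁ S₂) :
    ((m : ℂ) - 1) ^ 2 = θ.θ₂ ^ 2 := by
  obtain ⟨n, rfl⟩ := h.exists_add_two hy.1 h0 h0'
  have cy := hy.1.continuousAt
  have cu := h.an_u.continuousAt
  have c1 := h.an_S₁.continuousAt
  have c2 := h.an_S₂.continuousAt
  have key : ∀ᶠ x in 𝓝[≠] (0 : ℂ), S₂ x = S₁ x ^ 2 / u x / 2
      + x ^ (n + 2) * S₁ x ^ 2 / (y x - 1) / 2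
      + x ^ (n + 1) * S₁ x ^ 2 / (x ^ (n + 1) * u x - 1) / 2
      - (1 + x / (x - 1) + 1 / (x ^ (n + 1) * u x - 1)) * S₁ x
      + u x * (y x - 1) * (y x - x) / (x - 1) ^ 2 * ((θ.θinf - 1) ^ 2 / 2
        + θ.θ₃ ^ 2 / 2 * ((x - 1) / (y x - 1) ^ 2))
      + u x * (y x - 1) / (x - 1) * ((1 - θ.θ₂ ^ 2) / 2 / (x ^ (n + 1) * u x - 1)) := by
    have hx1 : ∀ᶠ x : ℂ in 𝓝[≠] (0 : ℂ), x ≠ 1 :=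
      (continuousAt_id.eventually_ne (by simp)).filter_mono nhdsWithin_le_nhds
    filter_upwards [hy.2, h.eq.filter_mono nhdsWithin_le_nhds,
      h.deriv_eq.filter_mono nhdsWithin_le_nhds, h.deriv_deriv_eq.filter_mono nhdsWithin_le_nhds,
      self_mem_nhdsWithin, (cu.eventually_ne h.u_ne).filter_mono nhdsWithin_le_nhds, hx1]
      with x ⟨hy0, hy1, hyx, hq⟩ e0 e1 e2 hx hu hx1
    have hx : x ≠ 0 := hx
    have hX : x ^ (n + 1) ≠ 0 := pow_ne_zero _ hx
    rw [pow_succ x (n + 1)] at e0 e1 e2 ⊢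
    have ep : deriv y x = x ^ (n + 1) * S₁ x := by
      refine mul_left_cancel₀ hx ?_
      linear_combination e1
    have eS : S₂ x = x * rhs θ x (y x) (deriv y x) / x ^ (n + 1) := by
      rw [← hq]
      field_simp
      refine mul_left_cancel₀ hx ?_
      linear_combination -e2
    have hx1' : x - 1 ≠ 0 := sub_ne_zero.2 hx1
    have hy1' : y x - 1 ≠ 0 := sub_ne_zero.2 hy1
    have ey : y x = x ^ (n + 1) * x * u x := by linear_combination e0
    have eyx : y x - x = x * (x ^ (n + 1) * u x - 1) := by linear_combination ey
    have hv : x ^ (n + 1) * u x - 1 ≠ 0 := fun h => hyx (sub_eq_zero.1 (by rw [eyx, h, mul_zero]))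
    rw [eS, ep, rhs, h1, eyx]
    generalize hT : y x - 1 = T at *
    generalize hR : x ^ (n + 1) * u x - 1 = R at *
    rw [ey]
    generalize x ^ (n + 1) = X at *
    field_simp
    ring
  have hval := eq_of_eventuallyEq_punctured c2 (by
    have a1 : (0 : ℂ) - 1 ≠ 0 := by simp
    have a3 : y 0 - 1 ≠ 0 := by simp [h0]
    have a4 := h.u_ne
    have a5 : ((0 : ℂ) - 1) ^ 2 ≠ 0 := by simp
    have a7 : (y 0 - 1) ^ 2 ≠ 0 := by simp [h0]
    have a8 : (0 : ℂ) ^ (n + 1) * u 0 - 1 ≠ 0 := by simp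
    fun_prop (disch := assumption)) nhdsWithin_le_nhds key
  have hu := h.u_ne
  rw [h.S₁_zero, h.S₂_zero, h0] at hval
  simp at hval
  field_simp at hval
  push_cast
  linear_combination hval

/-- The order of vanishing of `y - x` for a transcendent with `y(0) = 0`, `y'(0) = 1` in the case
`θ₂ = 0`. -/
theorem exponent_at_diagonal {θ : Params} {y : ℂ → ℂ} (hy : IsHolomorphicBranch θ y)
    (h2 : θ.θ₂ = 0) (h0 : y 0 = 0) (h0' : deriv y 0 = 1) {m : ℕ} {u S₁ S₂ : ℂ → ℂ}
    (h : OrderData y 0 1 m u S₁ S₂) :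
    ((m : ℂ) - 1) ^ 2 = θ.θ₁ ^ 2 := by
  obtain ⟨n, rfl⟩ := h.exists_add_two hy.1 h0 h0'
  have cy := hy.1.continuousAt
  have cu := h.an_u.continuousAt
  have c1 := h.an_S₁.continuousAt
  have c2 := h.an_S₂.continuousAt
  have key : ∀ᶠ x in 𝓝[≠] (0 : ℂ), S₂ x = S₁ x ^ 2 / u x / 2
      + (x ^ (n + 1) * S₁ x ^ 2 - u x - 2 * x ^ (n + 1) * S₁ x * u x)
        / (1 + x ^ (n + 1) * u x) / 2
      + x * (x ^ (n + 1) * S₁ x ^ 2 * (x - 1) + u x * (x - 1) - x * u x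
        - 2 * x * x ^ (n + 1) * S₁ x * u x + x * x ^ (n + 1) * u x ^ 2)
        / (y x - 1) / (x - 1) / 2
      - u x * (y x - 1) / (x - 1) ^ 2 * (θ.θ₁ ^ 2 / 2 / (1 + x ^ (n + 1) * u x))
      + x * u x * (1 + x ^ (n + 1) * u x) * (y x - 1) / (x - 1) ^ 2 * ((θ.θinf - 1) ^ 2 / 2
        + θ.θ₃ ^ 2 / 2 * ((x - 1) / (y x - 1) ^ 2)) := by
    have hx1 : ∀ᶠ x : ℂ in 𝓝[≠] (0 : ℂ), x ≠ 1 :=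
      (continuousAt_id.eventually_ne (by simp)).filter_mono nhdsWithin_le_nhds
    filter_upwards [hy.2, h.eq.filter_mono nhdsWithin_le_nhds,
      h.deriv_eq.filter_mono nhdsWithin_le_nhds, h.deriv_deriv_eq.filter_mono nhdsWithin_le_nhds,
      self_mem_nhdsWithin, (cu.eventually_ne h.u_ne).filter_mono nhdsWithin_le_nhds, hx1]
      with x ⟨hy0, hy1, hyx, hq⟩ e0 e1 e2 hx hu hx1
    have hx : x ≠ 0 := hx
    have hX : x ^ (n + 1) ≠ 0 := pow_ne_zero _ hx
    rw [pow_succ x (n + 1)] at e0 e1 e2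
    have ep : deriv y x = 1 + x ^ (n + 1) * S₁ x := by
      refine mul_left_cancel₀ hx ?_
      linear_combination e1
    have eS : S₂ x = x * rhs θ x (y x) (deriv y x) / x ^ (n + 1) := by
      rw [← hq]
      field_simp
      refine mul_left_cancel₀ hx ?_
      linear_combination -e2
    have hx1' : x - 1 ≠ 0 := sub_ne_zero.2 hx1
    have hy1' : y x - 1 ≠ 0 := sub_ne_zero.2 hy1
    have ey : y x = x * (1 + x ^ (n + 1) * u x) := by linear_combination e0
    have eyx : y x - x = x * x ^ (n + 1) * u x := by linear_combination ey
    have hv : 1 + x ^ (n + 1) * u x ≠ 0 := fun h => hy0 (by rw [ey, h, mul_zero])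
    rw [eS, ep, rhs, h2, eyx]
    rw [ey] at hy1' ⊢
    generalize x ^ (n + 1) = X at *
    field_simp
    ring
  have hval := eq_of_eventuallyEq_punctured c2 (by
    have a1 : (0 : ℂ) - 1 ≠ 0 := by simp
    have a3 : y 0 - 1 ≠ 0 := by simp [h0]
    have a4 := h.u_ne
    have a5 : ((0 : ℂ) - 1) ^ 2 ≠ 0 := by simp
    have a7 : (y 0 - 1) ^ 2 ≠ 0 := by simp [h0]
    have a8 : 1 + (0 : ℂ) ^ (n + 1) * u 0 ≠ 0 := by simp
    fun_prop (disch := assumption)) nhdsWithin_le_nhds key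
  have hu := h.u_ne
  rw [h.S₁_zero, h.S₂_zero, h0] at hval
  simp at hval
  field_simp at hval
  push_cast
  linear_combination hval

/-! ### Holomorphic extensions of the entries of `Ω` -/

/-- `f` agrees along the filter `l` with a function holomorphic at `0` whose value there is `c`. -/
def HolValue (l : Filter ℂ) (f : ℂ → ℂ) (c : ℂ) : Prop :=
  ∃ g, AnalyticAt ℂ g 0 ∧ g 0 = c ∧ ∀ᶠ x in l, f x = g x

namespace HolValue

variable {l l' : Filter ℂ} {f g : ℂ → ℂ} {a b : ℂ}

theorem of_analyticAt (hf : AnalyticAt ℂ f 0) (h0 : f 0 = a) : HolValue l f a :=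
  ⟨f, hf, h0, Eventually.of_forall fun _ => rfl⟩

theorem mono (h : HolValue l f a) (hl : l' ≤ l) : HolValue l' f a := by
  obtain ⟨F, hF, h0, e⟩ := h
  exact ⟨F, hF, h0, e.filter_mono hl⟩

theorem congr (h : HolValue l f a) (e : ∀ᶠ x in l, g x = f x) : HolValue l g a := by
  obtain ⟨F, hF, h0, e'⟩ := h
  exact ⟨F, hF, h0, by filter_upwards [e, e'] with x h1 h2 using h1.trans h2⟩

theorem mul (hf : HolValue l f a) (hg : HolValue l g b) :
    HolValue l (fun x => f x * g x) (a * b) := by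
  obtain ⟨F, hF, rfl, e⟩ := hf
  obtain ⟨G, hG, rfl, e'⟩ := hg
  exact ⟨fun x => F x * G x, hF.mul hG, rfl, by
    filter_upwards [e, e'] with x h1 h2
    rw [h1, h2]⟩

theorem sub (hf : HolValue l f a) (hg : HolValue l g b) :
    HolValue l (fun x => f x - g x) (a - b) := by
  obtain ⟨F, hF, rfl, e⟩ := hf
  obtain ⟨G, hG, rfl, e'⟩ := hg
  exact ⟨fun x => F x - G x, hF.sub hG, rfl, by
    filter_upwards [e, e'] with x h1 h2
    rw [h1, h2]⟩

theorem pow_mul (hf : HolValue l f a) (n : ℕ) :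
    HolValue l (fun x => x ^ n * f x) (0 ^ n * a) :=
  (of_analyticAt (by fun_prop) rfl : HolValue l (fun x : ℂ => x ^ n) (0 ^ n)).mul hf

theorem inv_mul (hf : HolValue (𝓝[≠] 0) f 0) : ∃ c, HolValue (𝓝[≠] 0) (fun x => x⁻¹ * f x) c := by
  obtain ⟨F, hF, h0, e⟩ := hf
  obtain ⟨G, hG, e'⟩ := exists_eq_mul_of_apply_zero hF h0
  refine ⟨G 0, G, hG, rfl, ?_⟩
  filter_upwards [e, e'.filter_mono nhdsWithin_le_nhds, self_mem_nhdsWithin] with x h1 h2 h3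
  rw [h1, h2, inv_mul_cancel_left₀ (show x ≠ 0 from h3)]

theorem unique [l.NeBot] (hl : l ≤ 𝓝 0) (hf : HolValue l f a) (hf' : HolValue l f b) : a = b := by
  obtain ⟨F, hF, rfl, e⟩ := hf
  obtain ⟨G, hG, rfl, e'⟩ := hf'
  refine eq_of_eventuallyEq_punctured hF.continuousAt hG.continuousAt hl ?_
  filter_upwards [e, e'] with x h1 h2
  rw [← h1, h2]

theorem pow_mul' (hf : HolValue l f a) (n : ℕ) :
    HolValue l (fun x => x ^ (n : ℤ) * f x) (0 ^ n * a) := by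
  simpa using hf.pow_mul n

theorem pow_succ_mul (n : ℕ)
    (hf : HolValue (𝓝[≠] 0) (fun x => x * f x) a) :
    HolValue (𝓝[≠] 0) (fun x => x ^ ((n : ℤ) + 1) * f x) (0 ^ n * a) := by
  refine (hf.pow_mul n).congr ?_
  filter_upwards [self_mem_nhdsWithin] with x hx
  rw [zpow_add_one₀ (show x ≠ 0 from hx), zpow_natCast]
  ring

theorem one_zpow_mul {a : ℂ}
    (hf : HolValue l (fun x => x * f x) a) : HolValue l (fun x => x ^ (1 : ℤ) * f x) a := by
  simpa using hf

theorem zero_zpow_mul {a : ℂ}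
    (hf : HolValue l f a) : HolValue l (fun x => x ^ (0 : ℤ) * f x) a := by
  simpa using hf

theorem neg_one_zpow_mul (hf : HolValue (𝓝[≠] 0) f 0) :
    ∃ c, HolValue (𝓝[≠] 0) (fun x => x ^ (-1 : ℤ) * f x) c := by
  simpa using hf.inv_mul

theorem eq_zero (hf : HolValue l f a) (h : a = 0) :
    HolValue l f 0 := h ▸ hf

theorem div_sub_one {a : ℂ}
    (hf : HolValue l f a) : HolValue l (fun x => f x / (x - 1)) (-a) := by
  have h1 : (0 : ℂ) - 1 ≠ 0 := by simp
  have h : HolValue l (fun x : ℂ => 1 / (x - 1)) (-1) :=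
    .of_analyticAt (by fun_prop (disch := assumption)) (by simp)
  have := hf.mul h
  rw [mul_neg_one] at this
  exact this.congr (Eventually.of_forall fun x => by ring)

theorem neg {a : ℂ}
    (hf : HolValue l f a) : HolValue l (fun x => -f x) (-a) := by
  obtain ⟨F, hF, rfl, e⟩ := hf
  exact ⟨fun x => -F x, hF.neg, rfl, e.mono fun _ hx => congrArg Neg.neg hx⟩

theorem const (c : ℂ) : HolValue l (fun _ => c) c :=
  .of_analyticAt analyticAt_const rfl

theorem of_zpow_neg_mul {k : ℕ} (hk : 1 ≤ k)
    (hf : HolValue (𝓝[≠] 0) (fun x => x ^ (-k : ℤ) * f x) a) : HolValue (𝓝[≠] 0) f 0 := by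
  have := hf.pow_mul k
  rw [zero_pow (by omega), zero_mul] at this
  refine this.congr ?_
  filter_upwards [self_mem_nhdsWithin] with x hx
  rw [_root_.zpow_neg, zpow_natCast, mul_inv_cancel_left₀ (pow_ne_zero k (show x ≠ 0 from hx))]

end HolValue

theorem AreFactors.eventually_ne_zero {θ : Params} {y k₁ k₂ : ℂ → ℂ} (hk : AreFactors θ y k₁ k₂) :
    ∀ᶠ x in 𝓝[Complex.slitPlane] (0 : ℂ), k₁ x ≠ 0 ∧ k₂ x ≠ 0 := by
  obtain ⟨⟨c1, L1, h1, e1⟩, c2, L2, h2, e2⟩ := hk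
  filter_upwards [e1, e2] with x ⟨_, h3⟩ ⟨_, h4⟩
  rw [h3, h4]
  exact ⟨mul_ne_zero h1 (Complex.exp_ne_zero _), mul_ne_zero h2 (Complex.exp_ne_zero _)⟩

theorem IsExpPrimitive.div {l l' k k' : ℂ → ℂ} (h : IsExpPrimitive l k)
    (h' : IsExpPrimitive l' k') : IsExpPrimitive (fun x => l x - l' x) fun x => k x / k' x := by
  obtain ⟨c, L, hc, e⟩ := h
  obtain ⟨c', L', hc', e'⟩ := h'
  refine ⟨c / c', fun x => L x - L' x, div_ne_zero hc hc', ?_⟩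
  filter_upwards [e, e'] with x ⟨h1, h2⟩ ⟨h3, h4⟩
  refine ⟨h1.sub h3, ?_⟩
  rw [h2, h4, Complex.exp_sub]
  field_simp

theorem IsCoalescentValue.holValue {Ω : ℂ → Matrix (Fin 3) (Fin 3) ℂ} {Ω₀}
    (h : IsCoalescentValue Ω Ω₀) (i j : Fin 3) :
    HolValue (𝓝[Complex.slitPlane] 0) (fun x => Ω x i j) (Ω₀ i j) := by
  obtain ⟨⟨W, hW, e, rfl⟩, -⟩ := h
  exact ⟨fun x => W x i j, hW i j, rfl, e.mono fun x hx => congrFun (congrFun hx i) j⟩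

theorem IsCoalescentValue.apply_eq {Ω : ℂ → Matrix (Fin 3) (Fin 3) ℂ} {Ω₀}
    (h : IsCoalescentValue Ω Ω₀) {i j : Fin 3} {c : ℂ}
    (hc : HolValue (𝓝[Complex.slitPlane] 0) (fun x => Ω x i j) c) : Ω₀ i j = c :=
  HolValue.unique nhdsWithin_le_nhds (h.holValue i j) hc

theorem vanishingCondition_of_holValue {Ω : ℂ → Matrix (Fin 3) (Fin 3) ℂ}
    (h : ∀ i j, ∃ c, HolValue (𝓝[Complex.slitPlane] 0) (fun x => Ω x i j) c)
    (h01 : HolValue (𝓝[Complex.slitPlane] 0) (fun x => Ω x 0 1) 0)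
    (h10 : HolValue (𝓝[Complex.slitPlane] 0) (fun x => Ω x 1 0) 0) : VanishingCondition Ω := by
  choose c hc using h
  have hc' := hc
  choose g hg hg0 hgΩ using hc'
  refine ⟨Matrix.of c, ⟨fun x => Matrix.of fun i j => g i j x, hg, ?_, ?_⟩, ?_, ?_⟩
  · filter_upwards [eventually_all.2 fun i => eventually_all.2 fun j => hgΩ i j] with x hx
    ext i j
    exact hx i j
  · ext i j
    exact hg0 i j
  · exact HolValue.unique nhdsWithin_le_nhds (hc 0 1) h01
  · exact HolValue.unique nhdsWithin_le_nhds (hc 1 0) h10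

theorem holValue_Omega_diag {θ : Params} {y k₁ k₂ : ℂ → ℂ} (hk : AreFactors θ y k₁ k₂)
    (i : Fin 3) : HolValue (𝓝[Complex.slitPlane] 0) (fun x => Omega θ y k₁ k₂ x i i)
      (![-θ.θ₁, -θ.θ₂, -θ.θ₃] i) := by
  refine ⟨fun _ => ![-θ.θ₁, -θ.θ₂, -θ.θ₃] i, analyticAt_const, rfl, ?_⟩
  filter_upwards [hk.eventually_ne_zero] with x ⟨h1, h2⟩
  fin_cases i <;> simp [Omega, Z, h1, h2]

theorem IsHolomorphicBranch.eventually_ne {θ : Params} {y : ℂ → ℂ} (hy : IsHolomorphicBranch θ y) :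
    ∀ᶠ x in 𝓝[≠] (0 : ℂ), x ≠ 0 ∧ x ≠ 1 ∧ y x ≠ 0 ∧ y x ≠ 1 ∧ y x ≠ x := by
  have hx1 : ∀ᶠ x : ℂ in 𝓝[≠] (0 : ℂ), x ≠ 1 :=
    (continuousAt_id.eventually_ne (by simp)).filter_mono nhdsWithin_le_nhds
  filter_upwards [hy.2, self_mem_nhdsWithin, hx1] with x ⟨h1, h2, h3, _⟩ h4 h5
  exact ⟨h4, h5, h1, h2, h3⟩

/-- The characteristic polynomial of `Ω` is constant, hence equal to that of `Ω(0)`. -/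
theorem IsCoalescentValue.isResidue {θ : Params} {y k₁ k₂ : ℂ → ℂ}
    (hy : IsHolomorphicBranch θ y) (hk : AreFactors θ y k₁ k₂) {Ω₀}
    (h : IsCoalescentValue (Omega θ y k₁ k₂) Ω₀) : IsResidue θ Ω₀ := by
  have key := hk.eventually_ne_zero.and (hy.eventually_ne.filter_mono nhdsWithin_slitPlane_le)
  have v := h.holValue
  -- the constant factors `-1` below turn sums into the differences which `HolValue.sub` covers
  refine ⟨h.apply_eq (holValue_Omega_diag hk 0), h.apply_eq (holValue_Omega_diag hk 1),
    h.apply_eq (holValue_Omega_diag hk 2), h.2.1, h.2.2, ?_, ?_⟩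
  · have h1 := (((v 0 1).mul (v 1 0)).sub (((v 0 2).mul (v 2 0)).mul
      (.of_analyticAt (f := fun _ => -1) analyticAt_const rfl))).sub (((v 1 2).mul (v 2 1)).mul
      (.of_analyticAt (f := fun _ => -1) analyticAt_const rfl))
    have h2 : HolValue (𝓝[Complex.slitPlane] 0) (fun _ => θ.θ₁ * θ.θ₂ + θ.θ₁ * θ.θ₃ + θ.θ₂ * θ.θ₃
        - ((θ.θ₁ + θ.θ₂ + θ.θ₃) ^ 2 - θ.θinf ^ 2) / 4) _ :=
      .of_analyticAt analyticAt_const rfl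
    have h3 := HolValue.unique nhdsWithin_le_nhds h1 (h2.congr (by
      filter_upwards [key] with x ⟨⟨k1, k2⟩, x0, x1, y0, y1, yx⟩
      rw [← Z_offDiag_products θ (p := deriv y x) x0 x1 y0 y1 yx]
      simp only [Omega, Matrix.of_apply, Matrix.cons_val_zero, Matrix.cons_val_one,
        Matrix.cons_val]
      field_simp
      ring))
    rw [h.2.1] at h3
    linear_combination h3
  · have h1 := ((((v 0 1).mul (v 1 2)).mul (v 2 0)).sub ((((v 0 2).mul (v 1 0)).mul (v 2 1)).mul
      (.of_analyticAt (f := fun _ => -1) analyticAt_const rfl))).sub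
      ((((v 1 2).mul (v 2 1)).mul
        (.of_analyticAt (f := fun _ => -θ.θ₁) analyticAt_const rfl)).sub
      (((v 0 2).mul (v 2 0)).mul
        (.of_analyticAt (f := fun _ => θ.θ₂) analyticAt_const rfl)))
    have h1 := h1.sub (((v 0 1).mul (v 1 0)).mul
        (.of_analyticAt (f := fun _ => -θ.θ₃) analyticAt_const rfl))
    have h2 : HolValue (𝓝[Complex.slitPlane] 0) (fun _ => θ.θ₁ * θ.θ₂ * θ.θ₃) _ :=
      .of_analyticAt analyticAt_const rfl
    have h3 := HolValue.unique nhdsWithin_le_nhds h1 (h2.congr (by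
      filter_upwards [key] with x ⟨⟨k1, k2⟩, x0, x1, y0, y1, yx⟩
      rw [← Z_det_expansion θ (p := deriv y x) x0 x1 y0 y1 yx]
      simp only [Omega, Matrix.of_apply, Matrix.cons_val_zero, Matrix.cons_val_one,
        Matrix.cons_val]
      field_simp
      ring))
    rw [h.2.1, h.2.2] at h3
    linear_combination h3

/-- The factors `k₁`, `k₂` are integral powers `x ^ n₁`, `x ^ n₂` times holomorphic units. -/
structure IntegralFactors (θ : Params) (y k₁ k₂ : ℂ → ℂ) (n₁ n₂ : ℤ) (h₁ h₂ : ℂ → ℂ) : Prop where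
  an₁ : AnalyticAt ℂ h₁ 0
  an₂ : AnalyticAt ℂ h₂ 0
  ne₁ : h₁ 0 ≠ 0
  ne₂ : h₂ 0 ≠ 0
  eq₁ : ∀ᶠ x in 𝓝[Complex.slitPlane] (0 : ℂ), k₁ x = x ^ n₁ * h₁ x
  eq₂ : ∀ᶠ x in 𝓝[Complex.slitPlane] (0 : ℂ), k₂ x = x ^ n₂ * h₂ x
  deriv₁ : ∀ᶠ x in 𝓝[≠] (0 : ℂ),
    HasDerivAt h₁ ((l₁ θ x (y x) (deriv y x) - n₁ / x) * h₁ x) x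
  deriv₂ : ∀ᶠ x in 𝓝[≠] (0 : ℂ),
    HasDerivAt h₂ ((l₂ θ x (y x) (deriv y x) - n₂ / x) * h₂ x) x

theorem AreFactors.exists_integralFactors {θ : Params} {y k₁ k₂ : ℂ → ℂ}
    (hk : AreFactors θ y k₁ k₂) {n₁ n₂ : ℤ}
    (h1 : HolValue (𝓝[≠] 0) (fun x => x * l₁ θ x (y x) (deriv y x)) n₁)
    (h2 : HolValue (𝓝[≠] 0) (fun x => x * l₂ θ x (y x) (deriv y x)) n₂) :
    ∃ h₁ h₂, IntegralFactors θ y k₁ k₂ n₁ n₂ h₁ h₂ := by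
  obtain ⟨ρ₁, a1, v1, e1⟩ := h1
  obtain ⟨ρ₂, a2, v2, e2⟩ := h2
  obtain ⟨h₁, b1, c1, d1, f1⟩ := exists_eq_cpow_mul_of_isExpPrimitive hk.1 a1 e1
  obtain ⟨h₂, b2, c2, d2, f2⟩ := exists_eq_cpow_mul_of_isExpPrimitive hk.2 a2 e2
  rw [v1] at d1 f1
  rw [v2] at d2 f2
  simp only [Complex.cpow_intCast] at d1 d2
  exact ⟨h₁, h₂, b1, b2, c1, c2, d1, d2, f1, f2⟩

namespace IntegralFactors

variable {θ : Params} {y k₁ k₂ h₁ h₂ : ℂ → ℂ} {n₁ n₂ : ℤ}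

/-- The single-valued continuation of `Ω` to a punctured neighbourhood of `0`. -/
def continuation (θ : Params) (y : ℂ → ℂ) (n₁ n₂ : ℤ) (h₁ h₂ : ℂ → ℂ) :
    ℂ → Matrix (Fin 3) (Fin 3) ℂ :=
  Omega θ y (fun x => x ^ n₁ * h₁ x) (fun x => x ^ n₂ * h₂ x)

theorem omega_eq (h : IntegralFactors θ y k₁ k₂ n₁ n₂ h₁ h₂) :
    ∀ᶠ x in 𝓝[Complex.slitPlane] (0 : ℂ),
      Omega θ y k₁ k₂ x = continuation θ y n₁ n₂ h₁ h₂ x := by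
  filter_upwards [h.eq₁, h.eq₂] with x e1 e2
  simp only [continuation, Omega, e1, e2]

theorem holValue_omega (h : IntegralFactors θ y k₁ k₂ n₁ n₂ h₁ h₂) {i j : Fin 3} {c : ℂ}
    (hc : HolValue (𝓝[≠] 0) (fun x => continuation θ y n₁ n₂ h₁ h₂ x i j) c) :
    HolValue (𝓝[Complex.slitPlane] 0) (fun x => Omega θ y k₁ k₂ x i j) c :=
  (hc.mono nhdsWithin_slitPlane_le).congr (h.omega_eq.mono fun _ hx => congrFun (congrFun hx i) j)

theorem regularPoint (h : IntegralFactors θ y k₁ k₂ n₁ n₂ h₁ h₂) (hy : IsHolomorphicBranch θ y) :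
    ∀ᶠ x in 𝓝[≠] (0 : ℂ),
      RegularPoint θ y (fun x => x ^ n₁ * h₁ x) (fun x => x ^ n₂ * h₂ x) x := by
  filter_upwards [hy.eventually_ne, hy.2, h.deriv₁, h.deriv₂,
    (h.an₁.continuousAt.eventually_ne h.ne₁).filter_mono nhdsWithin_le_nhds,
    (h.an₂.continuousAt.eventually_ne h.ne₂).filter_mono nhdsWithin_le_nhds,
    hy.1.eventually_analyticAt.filter_mono nhdsWithin_le_nhds]
    with x ⟨x0, x1, y0, y1, yx⟩ ⟨_, _, _, q⟩ d1 d2 e1 e2 ha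
  refine ⟨x0, x1, y0, y1, yx, ha.differentiableAt.hasDerivAt, ?_,
    mul_ne_zero (zpow_ne_zero _ x0) e1, mul_ne_zero (zpow_ne_zero _ x0) e2, ?_, ?_⟩
  · rw [← q]
    exact ha.deriv.differentiableAt.hasDerivAt
  · refine ((hasDerivAt_zpow n₁ x (Or.inl x0)).fun_mul d1).congr_deriv ?_
    rw [zpow_sub_one₀ x0]
    field_simp
    ring
  · refine ((hasDerivAt_zpow n₂ x (Or.inl x0)).fun_mul d2).congr_deriv ?_
    rw [zpow_sub_one₀ x0]
    field_simp
    ring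

/-- Up to a holomorphic unit, `x ^ k Ω i j` is an integral power of `x` times `Z i j`. -/
theorem holValue_zpow_mul (h : IntegralFactors θ y k₁ k₂ n₁ n₂ h₁ h₂) (i j : Fin 3) {c : ℂ}
    (k e : ℤ)
    (he : k + (![n₁, n₂, 0] i - ![n₁, n₂, 0] j) = e)
    (hc : HolValue (𝓝[≠] 0) (fun x => x ^ e * Z θ x (y x) (deriv y x) i j) c) :
    HolValue (𝓝[≠] 0) (fun x => x ^ k * continuation θ y n₁ n₂ h₁ h₂ x i j)
      (![h₁ 0, h₂ 0, 1] i / ![h₁ 0, h₂ 0, 1] j * c) := by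
  have hu : HolValue (𝓝[≠] 0) (fun x => ![h₁ x, h₂ x, 1] i / ![h₁ x, h₂ x, 1] j)
      (![h₁ 0, h₂ 0, 1] i / ![h₁ 0, h₂ 0, 1] j) := by
    have a1 := h.an₁
    have a2 := h.an₂
    have b1 := h.ne₁
    have b2 := h.ne₂
    have b3 : (1 : ℂ) ≠ 0 := one_ne_zero
    refine .of_analyticAt ?_ rfl
    fin_cases i <;> fin_cases j <;> simp only [Fin.zero_eta, Fin.mk_one, Fin.reduceFinMk,
      Matrix.cons_val_zero, Matrix.cons_val_one, Matrix.cons_val] <;>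
      fun_prop (disch := assumption)
  refine (hu.mul hc).congr ?_
  filter_upwards [self_mem_nhdsWithin] with x hx
  have hx : x ≠ 0 := hx
  rw [← he, zpow_add₀ hx, zpow_sub₀ hx]
  have e : ∀ i, ![x ^ n₁ * h₁ x, x ^ n₂ * h₂ x, 1] i
      = x ^ (![n₁, n₂, 0] i : ℤ) * ![h₁ x, h₂ x, 1] i := fun i => by
    fin_cases i <;> simp
  simp only [continuation, Omega, Matrix.of_apply]
  rw [e i, e j, mul_div_mul_comm]
  ring

theorem holValue (h : IntegralFactors θ y k₁ k₂ n₁ n₂ h₁ h₂) (i j : Fin 3) {c : ℂ} (e : ℤ)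
    (he : ![n₁, n₂, 0] i - ![n₁, n₂, 0] j = e)
    (hc : HolValue (𝓝[≠] 0) (fun x => x ^ e * Z θ x (y x) (deriv y x) i j) c) :
    HolValue (𝓝[≠] 0) (fun x => continuation θ y n₁ n₂ h₁ h₂ x i j)
      (![h₁ 0, h₂ 0, 1] i / ![h₁ 0, h₂ 0, 1] j * c) := by
  simpa using h.holValue_zpow_mul i j 0 e (by rw [he, zero_add]) hc

end IntegralFactors

/-- The linear system with eigenvalues `-n`, `0` at its regular singular point, in terms of
holomorphic extensions. -/
theorem holValue_of_regularSingular {n : ℕ} {f g A B C : ℂ → ℂ} {a b c d : ℂ}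
    (hA : HolValue (𝓝[≠] 0) A a) (hB : HolValue (𝓝[≠] 0) B b) (hC : HolValue (𝓝[≠] 0) C c)
    (hF : HolValue (𝓝[≠] 0) (fun x => x ^ (n : ℤ) * f x) 0)
    (hG : HolValue (𝓝[≠] 0) (fun x => x ^ (n : ℤ) * g x) d)
    (e1 : ∀ᶠ x in 𝓝[≠] (0 : ℂ), HasDerivAt f (-n / x * f x + A x * g x) x)
    (e2 : ∀ᶠ x in 𝓝[≠] (0 : ℂ), HasDerivAt g (B x * f x / x + C x * g x) x) :
    HolValue (𝓝[≠] 0) f 0 ∧ ∃ e, HolValue (𝓝[≠] 0) g e := by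
  obtain ⟨A', hA', -, eA⟩ := hA
  obtain ⟨B', hB', -, eB⟩ := hB
  obtain ⟨C', hC', -, eC⟩ := hC
  obtain ⟨F, hF', F0, eF⟩ := hF
  obtain ⟨G, hG', -, eG⟩ := hG
  simp only [zpow_natCast] at eF eG
  -- `x (x ^ n φ)' = n x ^ n φ + x x ^ n φ'`
  have dpow : ∀ (φ Φ : ℂ → ℂ) (φ' x : ℂ), x ≠ 0 → (∀ᶠ s in 𝓝[≠] x, s ^ n * φ s = Φ s) →
      x ^ n * φ x = Φ x → HasDerivAt φ φ' x →
      x * deriv Φ x = n * Φ x + x * (x ^ n * φ') := by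
    intro φ Φ φ' x hx h1 h2 h3
    have h4 : Φ =ᶠ[𝓝 x] fun s => s ^ n * φ s := by
      rw [eventually_nhdsWithin_iff] at h1
      filter_upwards [h1] with s hs
      by_cases hsx : s = x
      · rw [hsx, h2]
      · exact (hs hsx).symm
    rw [EventuallyEq.deriv_eq h4, ((hasDerivAt_pow n x).fun_mul h3).deriv, ← h2]
    rcases n with _ | n
    · simp
    · rw [Nat.add_sub_cancel]
      ring
  have up : ∀ {P : ℂ → Prop}, (∀ᶠ x in 𝓝[≠] (0 : ℂ), P x) →
      ∀ᶠ x in 𝓝[≠] (0 : ℂ), ∀ᶠ s in 𝓝[≠] x, P s := fun {P} hP => by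
    filter_upwards [eventually_eventually_nhdsWithin.2 hP, self_mem_nhdsWithin] with x hx hx0
    rw [IsOpen.nhdsWithin_eq isOpen_compl_singleton hx0] at hx
    exact hx.filter_mono nhdsWithin_le_nhds
  obtain ⟨f', g', hf', hg', ef, eg⟩ := exists_eq_pow_mul_of_regularSingular (n := n) hF' hG' hA'
    hB' hC' F0 (by
      filter_upwards [up eF, eF, eG, eA, e1, self_mem_nhdsWithin] with x h1 h2 h3 h4 h5 hx
      have hx : x ≠ 0 := hx
      have := dpow f F _ x hx h1 h2 h5
      refine mul_left_cancel₀ hx ?_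
      rw [this, ← h2, ← h3, ← h4]
      field_simp
      ring) (by
      filter_upwards [up eG, eF, eG, eB, eC, e2, self_mem_nhdsWithin]
        with x h1 h2 h3 h4 h5 h6 hx
      have hx : x ≠ 0 := hx
      rw [dpow g G _ x hx h1 h3 h6, ← h2, ← h3, ← h4, ← h5]
      field_simp
      ring)
  refine ⟨⟨fun x => x * f' x, analyticAt_id.mul hf', by simp, ?_⟩, g' 0, g', hg', rfl, ?_⟩
  · filter_upwards [eF, ef.filter_mono nhdsWithin_le_nhds, self_mem_nhdsWithin] with x h1 h2 hx
    refine mul_left_cancel₀ (pow_ne_zero n (show x ≠ 0 from hx)) ?_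
    rw [h1, h2]
    ring
  · filter_upwards [eG, eg.filter_mono nhdsWithin_le_nhds, self_mem_nhdsWithin] with x h1 h2 hx
    refine mul_left_cancel₀ (pow_ne_zero n (show x ≠ 0 from hx)) ?_
    rw [h1, h2]

/-! ### Branches with `y(0) ≠ 0` -/

section NonzeroValue

variable {θ : Params} {y k₁ k₂ : ℂ → ℂ}

theorem holValue_Z_01 (θ : Params) (hy : AnalyticAt ℂ y 0) (h0 : y 0 ≠ 0) :
    HolValue (𝓝[≠] 0) (fun x => Z θ x (y x) (deriv y x) 0 1)
      (-((θ.θinf - 1) * y 0 + 1 - (θ.θ₁ - θ.θ₂)) / 2) := by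
  have hd := hy.deriv
  have h1 : 2 * ((0 : ℂ) - 1) * y 0 ≠ 0 := by simp [h0]
  refine .of_analyticAt ?_ ?_ <;> simp only [Z, Matrix.of_apply, Matrix.cons_val',
    Matrix.cons_val_zero, Matrix.cons_val_one, Matrix.cons_val_fin_one, Matrix.cons_val]
  · fun_prop (disch := assumption)
  · field_simp
    ring

theorem holValue_Z_02 (θ : Params) (hy : AnalyticAt ℂ y 0) (h0 : y 0 ≠ 0) :
    HolValue (𝓝[≠] 0) (fun x => Z θ x (y x) (deriv y x) 0 2)
      (((θ.θinf - 1) * y 0 - (θ.θinf - 1 + θ.θ₃)) / 2) := by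
  have hd := hy.deriv
  have h1 : 2 * ((0 : ℂ) - 1) * y 0 ≠ 0 := by simp [h0]
  refine .of_analyticAt ?_ ?_ <;> simp only [Z, Matrix.of_apply, Matrix.cons_val',
    Matrix.cons_val_zero, Matrix.cons_val_one, Matrix.cons_val_fin_one, Matrix.cons_val]
  · fun_prop (disch := assumption)
  · field_simp
    ring

theorem holValue_Z_10 (θ : Params) (hy : AnalyticAt ℂ y 0) (h0 : y 0 ≠ 0) :
    HolValue (𝓝[≠] 0) (fun x => Z θ x (y x) (deriv y x) 1 0)
      (-((θ.θinf - 1) * y 0 + 1 + (θ.θ₁ - θ.θ₂)) / 2) := by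
  have hd := hy.deriv
  have h1 : 2 * ((0 : ℂ) - y 0) ≠ 0 := by simp [h0]
  refine .of_analyticAt ?_ ?_ <;> simp only [Z, Matrix.of_apply, Matrix.cons_val',
    Matrix.cons_val_zero, Matrix.cons_val_one, Matrix.cons_val_fin_one, Matrix.cons_val]
  · fun_prop (disch := assumption)
  · field_simp
    ring

theorem holValue_Z_12 (θ : Params) (hy : AnalyticAt ℂ y 0) (h0 : y 0 ≠ 0) :
    HolValue (𝓝[≠] 0) (fun x => Z θ x (y x) (deriv y x) 1 2)
      (((θ.θinf - 1) * y 0 - (θ.θinf - 1 + θ.θ₃)) / 2) := by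
  have hd := hy.deriv
  have h1 : 2 * ((0 : ℂ) - y 0) ≠ 0 := by simp [h0]
  refine .of_analyticAt ?_ ?_ <;> simp only [Z, Matrix.of_apply, Matrix.cons_val',
    Matrix.cons_val_zero, Matrix.cons_val_one, Matrix.cons_val_fin_one, Matrix.cons_val]
  · fun_prop (disch := assumption)
  · field_simp
    ring

/-- The poles of `l₁` and `l₂` along `y = 1` cancel in the difference. -/
theorem l₁_sub_l₂ (θ : Params) {x y p : ℂ} (h0 : x ≠ 0) (h1 : x ≠ 1) (hy0 : y ≠ 0)
    (hy1 : y ≠ 1) (hyx : y ≠ x) :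
    x * (l₁ θ x y p - l₂ θ x y p) = (x ^ 2 * (x - 1) * p
      + (2 * (θ.θ₁ - θ.θ₂) - (θ.θ₁ - 3 * θ.θ₂ + θ.θ₃ + 1) * x) * y ^ 2
      + (x * (-3 * θ.θ₁ + θ.θ₂ + 1) - x ^ 2 * (2 * θ.θ₂ - θ.θ₁ - θ.θ₃)) * y + θ.θ₁ * x ^ 2)
        / (2 * (x - 1) * y * (x - y)) := by
  have h1' : x - 1 ≠ 0 := sub_ne_zero.2 h1
  have hy1' : y - 1 ≠ 0 := sub_ne_zero.2 hy1
  have hyx' : x - y ≠ 0 := sub_ne_zero.2 hyx.symm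
  have e : (1 - y) = -(y - 1) := by ring
  have e' : (1 - x) = -(x - 1) := by ring
  rw [l₁, l₂, e, e']
  field_simp
  ring

theorem holValue_l₁_sub_l₂ (hy : IsHolomorphicBranch θ y) (h0 : y 0 ≠ 0) :
    HolValue (𝓝[≠] 0) (fun x => x * (l₁ θ x (y x) (deriv y x) - l₂ θ x (y x) (deriv y x)))
      (θ.θ₁ - θ.θ₂) := by
  have ha := hy.1
  have hd := hy.1.deriv
  have h1 : 2 * ((0 : ℂ) - 1) * y 0 * (0 - y 0) ≠ 0 := by simp [h0]
  refine HolValue.congr (.of_analyticAt (f := fun x => (x ^ 2 * (x - 1) * deriv y x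
      + (2 * (θ.θ₁ - θ.θ₂) - (θ.θ₁ - 3 * θ.θ₂ + θ.θ₃ + 1) * x) * y x ^ 2
      + (x * (-3 * θ.θ₁ + θ.θ₂ + 1) - x ^ 2 * (2 * θ.θ₂ - θ.θ₁ - θ.θ₃)) * y x + θ.θ₁ * x ^ 2)
        / (2 * (x - 1) * y x * (x - y x))) ?_ ?_) ?_
  · fun_prop (disch := assumption)
  · field_simp
    ring
  · filter_upwards [hy.eventually_ne] with x ⟨h0, h1, hy0, hy1, hyx⟩
    exact l₁_sub_l₂ θ h0 h1 hy0 hy1 hyx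

/-- If `y(0) ≠ 0`, the vanishing of `Ω₁₂Ω₂₁` at `0` leaves `θ₁ - θ₂ = ±(σ + 1)` with
`σ = (θinf - 1) y(0)`, and one of the two entries then behaves as `x ^ (-(σ + 1))`. -/
theorem VanishingCondition.exists_nat (hy : IsHolomorphicBranch θ y) (hk : AreFactors θ y k₁ k₂)
    (h0 : y 0 ≠ 0) (hV : VanishingCondition (Omega θ y k₁ k₂)) :
    ∃ n : ℕ, (θ.θinf - 1) * y 0 = -(n + 1) ∧
      (θ.θ₁ - θ.θ₂ = n ∨ θ.θ₁ - θ.θ₂ = -n) := by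
  obtain ⟨Ω₀, hV⟩ := hV
  obtain ⟨ρ, hρ, hρ0, eρ⟩ := holValue_l₁_sub_l₂ hy h0
  obtain ⟨h, hh, hh0, ek, -⟩ := exists_eq_cpow_mul_of_isExpPrimitive (hk.1.div hk.2) hρ eρ
  rw [hρ0] at ek
  have v01 := hV.holValue 0 1
  have v10 := hV.holValue 1 0
  rw [hV.2.1] at v01
  rw [hV.2.2] at v10
  have z01 := holValue_Z_01 θ hy.1 h0
  have z10 := holValue_Z_10 θ hy.1 h0
  have e01 : ∀ᶠ x in 𝓝[Complex.slitPlane] (0 : ℂ), Omega θ y k₁ k₂ x 0 1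
      = x ^ (θ.θ₁ - θ.θ₂) * h x * Z θ x (y x) (deriv y x) 0 1 := by
    filter_upwards [ek] with x e
    rw [← e]
    simp [Omega]
  have e10 : ∀ᶠ x in 𝓝[Complex.slitPlane] (0 : ℂ), Omega θ y k₁ k₂ x 1 0
      = x ^ (-(θ.θ₁ - θ.θ₂)) * (h x)⁻¹ * Z θ x (y x) (deriv y x) 1 0 := by
    filter_upwards [ek] with x e
    rw [Complex.cpow_neg, ← mul_inv, ← e]
    simp [Omega]
  have hprod : -((θ.θinf - 1) * y 0 + 1 - (θ.θ₁ - θ.θ₂)) / 2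
      * (-((θ.θinf - 1) * y 0 + 1 + (θ.θ₁ - θ.θ₂)) / 2) = 0 := by
    refine HolValue.unique (l := 𝓝[Complex.slitPlane] 0) nhdsWithin_le_nhds
      ((z01.mul z10).mono nhdsWithin_slitPlane_le) ?_
    have := v01.mul v10
    rw [mul_zero] at this
    refine this.congr ?_
    filter_upwards [hk.eventually_ne_zero] with x ⟨h1, h2⟩
    simp only [Omega, Matrix.of_apply, Matrix.cons_val_zero, Matrix.cons_val_one]
    field_simp
  -- a natural power is read off from the entry of `Z` which does not vanish at `0`
  have aux : ∀ (s c : ℂ) (f g H : ℂ → ℂ), AnalyticAt ℂ H 0 → H 0 ≠ 0 → c ≠ 0 →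
      HolValue (𝓝[≠] 0) g c → HolValue (𝓝[Complex.slitPlane] 0) f 0 →
      (∀ᶠ x in 𝓝[Complex.slitPlane] (0 : ℂ), f x = x ^ s * H x * g x) → ∃ n : ℕ, s = n := by
    rintro s c f g H hH hH0 hc ⟨g', hg', hg0, eg⟩ ⟨f', hf', -, ef⟩ e
    refine exists_nat_of_cpow_mul_eq (hH.mul hg') (mul_ne_zero hH0 (by rwa [hg0])) hf' ?_
    filter_upwards [e, ef, eg.filter_mono nhdsWithin_slitPlane_le] with x h1 h2 h3
    rw [← h2, h1, h3, Pi.mul_apply, mul_assoc]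
  rcases mul_eq_zero.1 hprod with h1 | h1
  · have hν : θ.θ₁ - θ.θ₂ = (θ.θinf - 1) * y 0 + 1 := by linear_combination 2 * h1
    by_cases hσ : (θ.θinf - 1) * y 0 + 1 = 0
    · exact ⟨0, by push_cast; linear_combination hσ, Or.inl (by rw [hν, hσ]; simp)⟩
    · obtain ⟨n, hn⟩ := aux _ _ _ _ _ (hh.inv hh0) (inv_ne_zero hh0) (by
        rw [hν]
        intro h
        exact hσ (by linear_combination -h)) z10 v10 e10
      exact ⟨n, by linear_combination -hν - hn, Or.inr (by linear_combination -hn)⟩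
  · have hν : θ.θ₁ - θ.θ₂ = -((θ.θinf - 1) * y 0 + 1) := by linear_combination -2 * h1
    by_cases hσ : (θ.θinf - 1) * y 0 + 1 = 0
    · exact ⟨0, by push_cast; linear_combination hσ, Or.inl (by rw [hν, hσ]; simp)⟩
    · obtain ⟨n, hn⟩ := aux _ _ _ _ _ hh hh0 (by
        rw [hν]
        intro h
        exact hσ (by linear_combination -h)) z01 v01 e01
      exact ⟨n, by linear_combination hν - hn, Or.inl hn⟩

theorem holValue_l₁_of_ne (hy : AnalyticAt ℂ y 0) (h0 : y 0 ≠ 0) (h1 : y 0 ≠ 1) {τ : ℂ}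
    (hτ : θ.θ₃ * y 0 = τ * (y 0 - 1)) :
    HolValue (𝓝[≠] 0) (fun x => x * l₁ θ x (y x) (deriv y x))
      (-(θ.θ₂ - θ.θ₁ + 1 - τ) / 2) := by
  have hd := hy.deriv
  have h1' : y 0 - 1 ≠ 0 := sub_ne_zero.2 h1
  have h2 : 2 * ((0 : ℂ) - 1) * (y 0 - 1) * y 0 ≠ 0 := by simp [h0, h1']
  refine HolValue.congr (.of_analyticAt (f := fun x => (x * (1 - x) * deriv y x
      + (θ.θ₂ - θ.θ₁ - θ.θ₃ + 1) * y x ^ 2 + ((θ.θ₁ + θ.θ₃) * x + θ.θ₁ - θ.θ₂ - 1) * y x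
      - θ.θ₁ * x) / (2 * (x - 1) * (y x - 1) * y x)) ?_ ?_) ?_
  · fun_prop (disch := assumption)
  · field_simp
    linear_combination -y 0 * hτ
  · filter_upwards [self_mem_nhdsWithin] with x hx
    have hx : x ≠ 0 := hx
    rw [l₁, mul_div_assoc', show 2 * x * (x - 1) * (y x - 1) * y x
      = x * (2 * (x - 1) * (y x - 1) * y x) by ring, mul_div_mul_left _ _ hx]

theorem holValue_mul_Z_20_of_ne (θ : Params) (hy : AnalyticAt ℂ y 0) (h1 : y 0 ≠ 1) :
    HolValue (𝓝[≠] 0) (fun x => x * Z θ x (y x) (deriv y x) 2 0)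
      (((1 - θ.θinf) * y 0 + θ.θinf - θ.θ₃ - 1) * y 0 / (2 * (y 0 - 1))) := by
  have hd := hy.deriv
  have h1' : y 0 - 1 ≠ 0 := sub_ne_zero.2 h1
  have h2 : 2 * (y 0 - 1) ≠ 0 := by simp [h1']
  refine HolValue.congr (.of_analyticAt (f := fun x => ((x - x ^ 2) * deriv y x
    + (1 - θ.θinf) * y x ^ 2 + ((θ.θ₃ - θ.θ₁) * x + θ.θinf - θ.θ₃ - 1) * y x + θ.θ₁ * x)
      / (2 * (y x - 1))) ?_ ?_) ?_
  · fun_prop (disch := assumption)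
  · field_simp
    ring
  · filter_upwards [self_mem_nhdsWithin] with x hx
    have hx : x ≠ 0 := hx
    simp only [Z, Matrix.of_apply, Matrix.cons_val', Matrix.cons_val_zero,
      Matrix.cons_val_fin_one, Matrix.cons_val]
    rw [mul_div_assoc', mul_comm 2 x, mul_assoc x, mul_div_mul_left _ _ hx]

theorem holValue_mul_Z_21_of_ne (θ : Params) (hy : AnalyticAt ℂ y 0) (h1 : y 0 ≠ 1) :
    HolValue (𝓝[≠] 0) (fun x => x * Z θ x (y x) (deriv y x) 2 1)
      (((1 - θ.θinf) * y 0 + θ.θinf - θ.θ₃ - 1) * y 0 / (2 * (1 - y 0))) := by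
  have hd := hy.deriv
  have h1' : 1 - y 0 ≠ 0 := sub_ne_zero.2 h1.symm
  have h2 : 2 * (1 - y 0) ≠ 0 := by simp [h1']
  refine HolValue.congr (.of_analyticAt (f := fun x => ((x - x ^ 2) * deriv y x
    + (1 - θ.θinf) * y x ^ 2 + ((θ.θinf + θ.θ₂) * x + θ.θinf - θ.θ₃ - 1) * y x
    - x * (θ.θinf + θ.θ₂ - θ.θ₃)) / (2 * (1 - y x))) ?_ ?_) ?_
  · fun_prop (disch := assumption)
  · field_simp
    ring
  · filter_upwards [self_mem_nhdsWithin] with x hx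
    have hx : x ≠ 0 := hx
    simp only [Z, Matrix.of_apply, Matrix.cons_val', Matrix.cons_val_zero, Matrix.cons_val_one,
      Matrix.cons_val_fin_one, Matrix.cons_val]
    rw [mul_div_assoc', mul_comm 2 x, mul_assoc x, mul_div_mul_left _ _ hx]

/-- The data needed to continue `Ω` to `x = 0` when `x Z₃₁`, `x Z₃₂` are holomorphic and `Z₁₃`,
`Z₂₃` vanish at `0`. -/
structure PlusData (θ : Params) (y : ℂ → ℂ) (n : ℕ) : Prop where
  l₁ : HolValue (𝓝[≠] 0) (fun x => x * l₁ θ x (y x) (deriv y x))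
    (-(θ.θ₂ - θ.θ₁ + 1 + (n + 1)) / 2)
  Z02 : HolValue (𝓝[≠] 0) (fun x => Z θ x (y x) (deriv y x) 0 2) 0
  Z12 : HolValue (𝓝[≠] 0) (fun x => Z θ x (y x) (deriv y x) 1 2) 0
  Z20 : ∃ c, HolValue (𝓝[≠] 0) (fun x => x * Z θ x (y x) (deriv y x) 2 0) c
  Z21 : ∃ c, HolValue (𝓝[≠] 0) (fun x => x * Z θ x (y x) (deriv y x) 2 1) c

/-- The data needed to continue `Ω` to `x = 0` when all entries of `Z` are holomorphic there. -/
structure MinusData (θ : Params) (y : ℂ → ℂ) (n : ℕ) : Prop where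
  l₁ : HolValue (𝓝[≠] 0) (fun x => x * l₁ θ x (y x) (deriv y x))
    (-(θ.θ₂ - θ.θ₁ + 1 - (n + 1)) / 2)
  Z02 : HolValue (𝓝[≠] 0) (fun x => Z θ x (y x) (deriv y x) 0 2) (-θ.θ₃)
  Z12 : HolValue (𝓝[≠] 0) (fun x => Z θ x (y x) (deriv y x) 1 2) (-θ.θ₃)
  Z20 : ∃ c, HolValue (𝓝[≠] 0) (fun x => Z θ x (y x) (deriv y x) 2 0) c
  Z21 : ∃ c, HolValue (𝓝[≠] 0) (fun x => Z θ x (y x) (deriv y x) 2 1) c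

/-- If `θ₃ = 0` and `y(0) = 1`, then `y - 1` vanishes to the order `n + 1`, so that
`x y' / (y - 1)` is holomorphic at `0` with value `n + 1`. -/
theorem plusData_of_one (hy : IsHolomorphicBranch θ y) {n : ℕ} (h3 : θ.θ₃ = 0) (h0 : y 0 = 1)
    (hn : θ.θinf - 1 = -(n + 1)) : PlusData θ y n := by
  obtain ⟨m, u, S₁, S₂, h⟩ := exists_orderData hy.1 (c₀ := 1) (c₁ := 0)
    (hy.eventually_ne.mono fun x hx => by simpa using hx.2.2.2.1)
  have hm := exponent_at_one hy h3 h0 h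
  have hm' : m = n + 1 := by
    rw [hn, neg_sq] at hm
    have : m ^ 2 = (n + 1) ^ 2 := by exact_mod_cast hm
    exact Nat.pow_left_injective (by norm_num : (2 : ℕ) ≠ 0) this
  subst hm'
  have hy0 : y 0 ≠ 0 := by simp [h0]
  have ha := hy.1
  have hu := h.an_u
  have hu0 := h.u_ne
  have hS := h.an_S₁
  have hS0 := h.S₁_zero
  have hN : (0 : ℂ) - 1 ≠ 0 := by simp
  have key : ∀ᶠ x in 𝓝[≠] (0 : ℂ), x ≠ 0 ∧ x - 1 ≠ 0 ∧ y x ≠ 0 ∧ y x - 1 ≠ 0 ∧ u x ≠ 0 ∧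
      x * deriv y x = (y x - 1) * (S₁ x / u x) := by
    filter_upwards [hy.eventually_ne, h.eq.filter_mono nhdsWithin_le_nhds,
      h.deriv_eq.filter_mono nhdsWithin_le_nhds,
      (hu.continuousAt.eventually_ne hu0).filter_mono nhdsWithin_le_nhds]
      with x ⟨a, b, c, d, _⟩ e1 e2 e3
    refine ⟨a, sub_ne_zero.2 b, c, sub_ne_zero.2 d, e3, ?_⟩
    rw [sub_zero] at e2
    rw [e2, e1]
    field_simp
    ring
  refine ⟨?_, ?_, ?_, ?_, ?_⟩
  · have h2 : 2 * ((0 : ℂ) - 1) * y 0 ≠ 0 := by simp [hy0]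
    refine HolValue.congr (.of_analyticAt (f := fun x => ((1 - x) * (S₁ x / u x)
      + (θ.θ₂ - θ.θ₁ + 1) * y x + θ.θ₁ * x) / (2 * (x - 1) * y x)) ?_ ?_) ?_
    · fun_prop (disch := assumption)
    · rw [hS0, h0]
      field_simp
      push_cast
      ring
    · filter_upwards [key] with x ⟨a, b, c, d, e, f⟩
      rw [l₁, h3]
      rw [mul_right_comm x (1 - x), f]
      field_simp
      ring
  · convert holValue_Z_02 θ hy.1 hy0 using 1
    rw [h0, h3]
    ring
  · convert holValue_Z_12 θ hy.1 hy0 using 1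
    rw [h0, h3]
    ring
  · refine ⟨_, HolValue.congr (.of_analyticAt (f := fun x => ((1 - x) * (S₁ x / u x)
      - (θ.θinf - 1) * y x - θ.θ₁ * x) / 2) (by fun_prop (disch := assumption)) rfl) ?_⟩
    filter_upwards [key] with x ⟨a, b, c, d, e, f⟩
    simp only [Z, Matrix.of_apply, Matrix.cons_val', Matrix.cons_val_zero, Matrix.cons_val_one,
      Matrix.cons_val_fin_one, Matrix.cons_val]
    have f' : (x - x ^ 2) * deriv y x = (1 - x) * ((y x - 1) * (S₁ x / u x)) := by
      rw [← f]
      ring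
    rw [f', h3]
    field_simp
    ring
  · refine ⟨_, HolValue.congr (.of_analyticAt (f := fun x => -((1 - x) * (S₁ x / u x)
      - (θ.θinf - 1) * y x + (θ.θinf + θ.θ₂) * x) / 2)
      (by fun_prop (disch := assumption)) rfl) ?_⟩
    filter_upwards [key] with x ⟨a, b, c, d, e, f⟩
    simp only [Z, Matrix.of_apply, Matrix.cons_val', Matrix.cons_val_zero, Matrix.cons_val_one,
      Matrix.cons_val_fin_one, Matrix.cons_val]
    have f' : (x - x ^ 2) * deriv y x = (1 - x) * ((y x - 1) * (S₁ x / u x)) := by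
      rw [← f]
      ring
    have g : 1 - y x = -(y x - 1) := by ring
    rw [f', h3, g]
    field_simp
    ring

theorem y_zero_ne_zero {n : ℕ} (hσ : (θ.θinf - 1) * y 0 = -(n + 1)) : y 0 ≠ 0 := by
  intro h
  rw [h, mul_zero] at hσ
  have : ((n + 1 : ℕ) : ℂ) = 0 := by
    push_cast
    linear_combination hσ
  exact absurd this (Nat.cast_ne_zero.2 n.succ_ne_zero)

theorem plusData (hy : IsHolomorphicBranch θ y) {n : ℕ} (hσ : (θ.θinf - 1) * y 0 = -(n + 1))
    (h3 : θ.θinf - 1 + θ.θ₃ = -(n + 1)) : PlusData θ y n := by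
  have h0 := y_zero_ne_zero hσ
  by_cases h1 : y 0 = 1
  · refine plusData_of_one hy ?_ h1 ?_
    · rw [h1] at hσ
      linear_combination h3 - hσ
    · rw [h1] at hσ
      linear_combination hσ
  · refine ⟨?_, ?_, ?_, ⟨_, holValue_mul_Z_20_of_ne θ hy.1 h1⟩,
      ⟨_, holValue_mul_Z_21_of_ne θ hy.1 h1⟩⟩
    · convert holValue_l₁_of_ne (τ := -(n + 1)) hy.1 h0 h1 ?_ using 1
      · ring
      · linear_combination y 0 * h3 - hσ
    · convert holValue_Z_02 θ hy.1 h0 using 1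
      linear_combination (h3 - hσ) / 2
    · convert holValue_Z_12 θ hy.1 h0 using 1
      linear_combination (h3 - hσ) / 2

theorem minusData (hy : IsHolomorphicBranch θ y) {n : ℕ} (hσ : (θ.θinf - 1) * y 0 = -(n + 1))
    (h3 : θ.θinf - 1 - θ.θ₃ = -(n + 1)) (h1 : y 0 ≠ 1) : MinusData θ y n := by
  have h0 := y_zero_ne_zero hσ
  have key : (1 - θ.θinf) * y 0 + θ.θinf - θ.θ₃ - 1 = 0 := by linear_combination h3 - hσ
  refine ⟨?_, ?_, ?_, ?_, ?_⟩
  · convert holValue_l₁_of_ne (τ := n + 1) hy.1 h0 h1 ?_ using 1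
    linear_combination -y 0 * h3 + hσ
  · convert holValue_Z_02 θ hy.1 h0 using 1
    linear_combination (h3 - hσ) / 2
  · convert holValue_Z_12 θ hy.1 h0 using 1
    linear_combination (h3 - hσ) / 2
  · have h := holValue_mul_Z_20_of_ne θ hy.1 h1
    rw [key, zero_mul, zero_div] at h
    obtain ⟨c, hc⟩ := h.inv_mul
    refine ⟨c, hc.congr ?_⟩
    filter_upwards [self_mem_nhdsWithin] with x hx
    rw [inv_mul_cancel_left₀ (show x ≠ 0 from hx)]
  · have h := holValue_mul_Z_21_of_ne θ hy.1 h1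
    rw [key, zero_mul, zero_div] at h
    obtain ⟨c, hc⟩ := h.inv_mul
    refine ⟨c, hc.congr ?_⟩
    filter_upwards [self_mem_nhdsWithin] with x hx
    rw [inv_mul_cancel_left₀ (show x ≠ 0 from hx)]

end NonzeroValue

/-! ### The vanishing condition for `y(0) ≠ 0` -/

section Resonant

variable {θ : Params} {y k₁ k₂ : ℂ → ℂ} {n : ℕ}

theorem exists_integralFactors_of_ne_zero (hy : IsHolomorphicBranch θ y)
    (hk : AreFactors θ y k₁ k₂) (h0 : y 0 ≠ 0) {n₁ n₂ : ℤ} {r : ℂ}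
    (h : HolValue (𝓝[≠] 0) (fun x => x * l₁ θ x (y x) (deriv y x)) r) (h1 : r = n₁)
    (h2 : r - (θ.θ₁ - θ.θ₂) = n₂) :
    ∃ h₁ h₂, IntegralFactors θ y k₁ k₂ n₁ n₂ h₁ h₂ := by
  refine hk.exists_integralFactors (h1 ▸ h) (h2 ▸ (h.sub (holValue_l₁_sub_l₂ hy h0)).congr ?_)
  exact Eventually.of_forall fun x => by ring

/-- The off-diagonal entries of `Ω`, listed one by one, suffice for the vanishing condition. -/
theorem IntegralFactors.vanishingCondition {h₁ h₂ : ℂ → ℂ} {n₁ n₂ : ℤ}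
    (h : IntegralFactors θ y k₁ k₂ n₁ n₂ h₁ h₂) (hk : AreFactors θ y k₁ k₂)
    (v01 : HolValue (𝓝[≠] 0) (fun x => continuation θ y n₁ n₂ h₁ h₂ x 0 1) 0)
    (v10 : HolValue (𝓝[≠] 0) (fun x => continuation θ y n₁ n₂ h₁ h₂ x 1 0) 0)
    (v02 : ∃ c, HolValue (𝓝[≠] 0) (fun x => continuation θ y n₁ n₂ h₁ h₂ x 0 2) c)
    (v20 : ∃ c, HolValue (𝓝[≠] 0) (fun x => continuation θ y n₁ n₂ h₁ h₂ x 2 0) c)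
    (v12 : ∃ c, HolValue (𝓝[≠] 0) (fun x => continuation θ y n₁ n₂ h₁ h₂ x 1 2) c)
    (v21 : ∃ c, HolValue (𝓝[≠] 0) (fun x => continuation θ y n₁ n₂ h₁ h₂ x 2 1) c) :
    VanishingCondition (Omega θ y k₁ k₂) := by
  refine vanishingCondition_of_holValue (fun i j => ?_) (h.holValue_omega v01)
    (h.holValue_omega v10)
  obtain ⟨c02, v02⟩ := v02
  obtain ⟨c20, v20⟩ := v20
  obtain ⟨c12, v12⟩ := v12
  obtain ⟨c21, v21⟩ := v21
  fin_cases i <;> fin_cases j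
  exacts [⟨_, holValue_Omega_diag hk 0⟩, ⟨_, h.holValue_omega v01⟩, ⟨_, h.holValue_omega v02⟩,
    ⟨_, h.holValue_omega v10⟩, ⟨_, holValue_Omega_diag hk 1⟩, ⟨_, h.holValue_omega v12⟩,
    ⟨_, h.holValue_omega v20⟩, ⟨_, h.holValue_omega v21⟩, ⟨_, holValue_Omega_diag hk 2⟩]

theorem zero_pow_mul_natCast (n : ℕ) : (0 : ℂ) ^ n * n = 0 := by
  rcases n with _ | n <;> simp

open IntegralFactors in
/-- Here `k₁`, `k₂` behave as `x ^ (-1)`, `x ^ (-1 - n)`, and `Ω₁₂`, `Ω₁₃`, `Ω₃₁`, `Ω₃₂` are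
holomorphic by inspection, while `(Ω₂₁, Ω₂₃)` may have a pole of order `n`. It solves a linear
system whose residue matrix has the eigenvalues `-n`, `0`, and the vanishing of `x ^ n Ω₂₁` at `0`
excludes the pole. -/
theorem PlusData.of_sub_eq (hD : PlusData θ y n) (hy : IsHolomorphicBranch θ y)
    (hk : AreFactors θ y k₁ k₂) (hσ : (θ.θinf - 1) * y 0 = -(n + 1)) (hν : θ.θ₁ - θ.θ₂ = n) :
    VanishingCondition (Omega θ y k₁ k₂) ∧
      (1 ≤ n → HolValue (𝓝[Complex.slitPlane] 0) (fun x => Omega θ y k₁ k₂ x 2 1) 0) := by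
  have h0 := y_zero_ne_zero hσ
  obtain ⟨h₁, h₂, hF⟩ := exists_integralFactors_of_ne_zero hy hk h0 (n₁ := -1) (n₂ := -1 - n) hD.l₁
    (by push_cast; linear_combination hν / 2) (by push_cast; linear_combination -hν / 2)
  obtain ⟨c02, v02⟩ := hD.Z02.neg_one_zpow_mul
  obtain ⟨c12, v12⟩ := hD.Z12.neg_one_zpow_mul
  obtain ⟨c20, v20⟩ := hD.Z20
  obtain ⟨c21, v21⟩ := hD.Z21
  have w01 := (hF.holValue 0 1 n (by simp) ((holValue_Z_01 θ hy.1 h0).pow_mul' n)).eq_zero (by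
    rw [hσ, hν]
    linear_combination ![h₁ 0, h₂ 0, 1] 0 / ![h₁ 0, h₂ 0, 1] 1 * zero_pow_mul_natCast n)
  have w02 := hF.holValue 0 2 (-1) (by simp) v02
  have w20 := hF.holValue 2 0 1 (by simp) v20.one_zpow_mul
  have w21 := hF.holValue 2 1 (n + 1) (by simp) (v21.pow_succ_mul n)
  have u10 := (hF.holValue_zpow_mul 1 0 n 0 (by simp; ring)
    (holValue_Z_10 θ hy.1 h0).zero_zpow_mul).eq_zero (by rw [hσ, hν]; ring)
  have u12 := hF.holValue_zpow_mul 1 2 n (-1) (by simp) v12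
  obtain ⟨w10, w12⟩ := holValue_of_regularSingular w20.div_sub_one w02
    (HolValue.const (θ.θ₂ - θ.θ₃)).div_sub_one u10 u12 (by
      filter_upwards [hF.regularPoint hy] with x hx
      refine (hasDerivAt_Omega_10 hx).congr_deriv ?_
      simp only [continuation]
      linear_combination (-1 / x * Omega θ y (fun x => x ^ (-1 : ℤ) * h₁ x)
        (fun x => x ^ (-1 - n : ℤ) * h₂ x) x 1 0) * hν) (by
      filter_upwards [hF.regularPoint hy] with x hx
      refine (hasDerivAt_Omega_12 hx).congr_deriv ?_
      simp only [continuation]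
      ring)
  refine ⟨hF.vanishingCondition hk w01 w10 ⟨_, w02⟩ ⟨_, w20⟩ w12 ⟨_, w21⟩, fun hn => ?_⟩
  refine hF.holValue_omega (w21.eq_zero ?_)
  rw [zero_pow (by omega)]
  ring

open IntegralFactors in
/-- As `PlusData.of_sub_eq`, with `(Ω₁₂, Ω₁₃)` as the pair that solves a linear system. -/
theorem PlusData.of_sub_eq_neg (hD : PlusData θ y n) (hy : IsHolomorphicBranch θ y)
    (hk : AreFactors θ y k₁ k₂) (hσ : (θ.θinf - 1) * y 0 = -(n + 1)) (hν : θ.θ₁ - θ.θ₂ = -n) :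
    VanishingCondition (Omega θ y k₁ k₂) ∧
      (1 ≤ n → HolValue (𝓝[Complex.slitPlane] 0) (fun x => Omega θ y k₁ k₂ x 2 0) 0) := by
  have h0 := y_zero_ne_zero hσ
  obtain ⟨h₁, h₂, hF⟩ := exists_integralFactors_of_ne_zero hy hk h0 (n₁ := -1 - n) (n₂ := -1) hD.l₁
    (by push_cast; linear_combination hν / 2) (by push_cast; linear_combination -hν / 2)
  obtain ⟨c02, v02⟩ := hD.Z02.neg_one_zpow_mul
  obtain ⟨c12, v12⟩ := hD.Z12.neg_one_zpow_mul
  obtain ⟨c20, v20⟩ := hD.Z20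
  obtain ⟨c21, v21⟩ := hD.Z21
  have w10 := (hF.holValue 1 0 n (by simp) ((holValue_Z_10 θ hy.1 h0).pow_mul' n)).eq_zero (by
    rw [hσ, hν]
    linear_combination ![h₁ 0, h₂ 0, 1] 1 / ![h₁ 0, h₂ 0, 1] 0 * zero_pow_mul_natCast n)
  have w12 := hF.holValue 1 2 (-1) (by simp) v12
  have w21 := hF.holValue 2 1 1 (by simp) v21.one_zpow_mul
  have w20 := hF.holValue 2 0 (n + 1) (by simp) (v20.pow_succ_mul n)
  have u01 := (hF.holValue_zpow_mul 0 1 n 0 (by simp; ring)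
    (holValue_Z_01 θ hy.1 h0).zero_zpow_mul).eq_zero (by rw [hσ, hν]; ring)
  have u02 := hF.holValue_zpow_mul 0 2 n (-1) (by simp) v02
  obtain ⟨w01, w02⟩ := holValue_of_regularSingular w21.div_sub_one.neg w12.div_sub_one.neg
    (HolValue.const 0) u01 u02 (by
      filter_upwards [hF.regularPoint hy] with x hx
      refine (hasDerivAt_Omega_01 hx).congr_deriv ?_
      simp only [continuation]
      linear_combination (1 / x * Omega θ y (fun x => x ^ (-1 - n : ℤ) * h₁ x)
        (fun x => x ^ (-1 : ℤ) * h₂ x) x 0 1) * hν) (by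
      filter_upwards [hF.regularPoint hy] with x hx
      refine (hasDerivAt_Omega_02 hx).congr_deriv ?_
      have hx0 := hx.1
      have hx1 := sub_ne_zero.2 hx.2.1
      simp only [continuation]
      field_simp
      ring)
  refine ⟨hF.vanishingCondition hk w01 w10 w02 ⟨_, w20⟩ ⟨_, w12⟩ ⟨_, w21⟩, fun hn => ?_⟩
  refine hF.holValue_omega (w20.eq_zero ?_)
  rw [zero_pow (by omega)]
  ring

open IntegralFactors in
/-- As `PlusData.of_sub_eq`, with `(Ω₂₁, Ω₃₁)` as the pair that solves a linear system. -/
theorem MinusData.of_sub_eq (hD : MinusData θ y n) (hy : IsHolomorphicBranch θ y)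
    (hk : AreFactors θ y k₁ k₂) (hσ : (θ.θinf - 1) * y 0 = -(n + 1)) (hν : θ.θ₁ - θ.θ₂ = n) :
    VanishingCondition (Omega θ y k₁ k₂) ∧
      ∃ c ≠ 0, HolValue (𝓝[Complex.slitPlane] 0) (fun x => Omega θ y k₁ k₂ x 1 2) (-θ.θ₃ * c) := by
  have h0 := y_zero_ne_zero hσ
  obtain ⟨h₁, h₂, hF⟩ := exists_integralFactors_of_ne_zero hy hk h0 (n₁ := n) (n₂ := 0) hD.l₁
    (by push_cast; linear_combination hν / 2) (by push_cast; linear_combination -hν / 2)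
  obtain ⟨c20, v20⟩ := hD.Z20
  obtain ⟨c21, v21⟩ := hD.Z21
  have w01 := (hF.holValue 0 1 n (by simp) ((holValue_Z_01 θ hy.1 h0).pow_mul' n)).eq_zero (by
    rw [hσ, hν]
    linear_combination ![h₁ 0, h₂ 0, 1] 0 / ![h₁ 0, h₂ 0, 1] 1 * zero_pow_mul_natCast n)
  have w02 := hF.holValue 0 2 n (by simp) (hD.Z02.pow_mul' n)
  have w12 := hF.holValue 1 2 0 (by simp) hD.Z12.zero_zpow_mul
  have w21 := hF.holValue 2 1 0 (by simp) v21.zero_zpow_mul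
  have u10 := (hF.holValue_zpow_mul 1 0 n 0 (by simp)
    (holValue_Z_10 θ hy.1 h0).zero_zpow_mul).eq_zero (by rw [hσ, hν]; ring)
  have u20 := hF.holValue_zpow_mul 2 0 n 0 (by simp) v20.zero_zpow_mul
  obtain ⟨w10, w20⟩ := holValue_of_regularSingular w12.div_sub_one w21.div_sub_one
    (HolValue.const 0) u10 u20 (by
      filter_upwards [hF.regularPoint hy] with x hx
      refine (hasDerivAt_Omega_10 hx).congr_deriv ?_
      simp only [continuation]
      linear_combination (-1 / x * Omega θ y (fun x => x ^ (n : ℤ) * h₁ x)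
        (fun x => x ^ (0 : ℤ) * h₂ x) x 1 0) * hν) (by
      filter_upwards [hF.regularPoint hy] with x hx
      refine (hasDerivAt_Omega_20 hx).congr_deriv ?_
      have hx0 := hx.1
      have hx1 := sub_ne_zero.2 hx.2.1
      simp only [continuation]
      field_simp
      ring)
  refine ⟨hF.vanishingCondition hk w01 w10 ⟨_, w02⟩ w20 ⟨_, w12⟩ ⟨_, w21⟩, h₂ 0, hF.ne₂, ?_⟩
  convert hF.holValue_omega w12 using 1
  simp
  ring

open IntegralFactors in
/-- As `PlusData.of_sub_eq`, with `(Ω₁₂, Ω₃₂)` as the pair that solves a linear system. -/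
theorem MinusData.of_sub_eq_neg (hD : MinusData θ y n) (hy : IsHolomorphicBranch θ y)
    (hk : AreFactors θ y k₁ k₂) (hσ : (θ.θinf - 1) * y 0 = -(n + 1)) (hν : θ.θ₁ - θ.θ₂ = -n) :
    VanishingCondition (Omega θ y k₁ k₂) ∧
      ∃ c ≠ 0, HolValue (𝓝[Complex.slitPlane] 0) (fun x => Omega θ y k₁ k₂ x 0 2) (-θ.θ₃ * c) := by
  have h0 := y_zero_ne_zero hσ
  obtain ⟨h₁, h₂, hF⟩ := exists_integralFactors_of_ne_zero hy hk h0 (n₁ := 0) (n₂ := n) hD.l₁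
    (by push_cast; linear_combination hν / 2) (by push_cast; linear_combination -hν / 2)
  obtain ⟨c20, v20⟩ := hD.Z20
  obtain ⟨c21, v21⟩ := hD.Z21
  have w10 := (hF.holValue 1 0 n (by simp) ((holValue_Z_10 θ hy.1 h0).pow_mul' n)).eq_zero (by
    rw [hσ, hν]
    linear_combination ![h₁ 0, h₂ 0, 1] 1 / ![h₁ 0, h₂ 0, 1] 0 * zero_pow_mul_natCast n)
  have w12 := hF.holValue 1 2 n (by simp) (hD.Z12.pow_mul' n)
  have w02 := hF.holValue 0 2 0 (by simp) hD.Z02.zero_zpow_mul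
  have w20 := hF.holValue 2 0 0 (by simp) v20.zero_zpow_mul
  have u01 := (hF.holValue_zpow_mul 0 1 n 0 (by simp)
    (holValue_Z_01 θ hy.1 h0).zero_zpow_mul).eq_zero (by rw [hσ, hν]; ring)
  have u21 := hF.holValue_zpow_mul 2 1 n 0 (by simp) v21.zero_zpow_mul
  obtain ⟨w01, w21⟩ := holValue_of_regularSingular w02.div_sub_one.neg w20.neg
    (HolValue.const (θ.θ₃ - θ.θ₂)).div_sub_one u01 u21 (by
      filter_upwards [hF.regularPoint hy] with x hx
      refine (hasDerivAt_Omega_01 hx).congr_deriv ?_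
      simp only [continuation]
      linear_combination (1 / x * Omega θ y (fun x => x ^ (0 : ℤ) * h₁ x)
        (fun x => x ^ (n : ℤ) * h₂ x) x 0 1) * hν) (by
      filter_upwards [hF.regularPoint hy] with x hx
      refine (hasDerivAt_Omega_21 hx).congr_deriv ?_
      simp only [continuation]
      ring)
  refine ⟨hF.vanishingCondition hk w01 w10 ⟨_, w02⟩ ⟨_, w20⟩ ⟨_, w12⟩ w21, h₁ 0, hF.ne₁, ?_⟩
  convert hF.holValue_omega w02 using 1
  simp
  ring

end Resonant

/-! ### Branches with `y(0) = 0` -/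

section ZeroValue

variable {θ : Params} {y k₁ k₂ : ℂ → ℂ}

/-- `y = x v` near `0`, with `v` holomorphic. -/
structure Quotient (y v : ℂ → ℂ) : Prop where
  an : AnalyticAt ℂ v 0
  an_y : AnalyticAt ℂ y 0
  y_zero : y 0 = 0
  v_zero : v 0 = deriv y 0
  eq : ∀ᶠ x in 𝓝 0, y x = x * v x

theorem exists_quotient (hy : AnalyticAt ℂ y 0) (h0 : y 0 = 0) : ∃ v, Quotient y v := by
  obtain ⟨v, hv, e⟩ := exists_eq_mul_of_apply_zero hy h0
  refine ⟨v, hv, hy, h0, ?_, e⟩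
  rw [EventuallyEq.deriv_eq e, ((hasDerivAt_id' (0 : ℂ)).fun_mul
    hv.differentiableAt.hasDerivAt).deriv]
  simp

namespace Quotient

variable {v : ℂ → ℂ}

theorem eventually (q : Quotient y v) (hy : IsHolomorphicBranch θ y) :
    ∀ᶠ x in 𝓝[≠] (0 : ℂ), y x = x * v x ∧ x ≠ 0 ∧ x - 1 ≠ 0 ∧ y x - 1 ≠ 0 ∧ v x ≠ 0 ∧
      1 - v x ≠ 0 := by
  filter_upwards [hy.eventually_ne, q.eq.filter_mono nhdsWithin_le_nhds]
    with x ⟨a, b, c, d, e⟩ h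
  refine ⟨h, a, sub_ne_zero.2 b, sub_ne_zero.2 d, ?_, ?_⟩
  · rintro h0
    exact c (by rw [h, h0, mul_zero])
  · intro h0
    exact e (by linear_combination h - x * h0)

theorem Z_01 (q : Quotient y v) (hy : IsHolomorphicBranch θ y) (h : deriv y 0 ≠ 0) :
    HolValue (𝓝[≠] 0) (fun x => Z θ x (y x) (deriv y x) 0 1)
      (((θ.θ₁ - θ.θ₂) * deriv y 0 - θ.θ₁) / (2 * deriv y 0)) := by
  have a1 := q.an
  have a2 := q.an_y.deriv
  have h1 : 2 * ((0 : ℂ) - 1) * v 0 ≠ 0 := by simp [q.v_zero, h]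
  refine HolValue.congr (.of_analyticAt (f := fun x => ((x - 1) * deriv y x
    + (θ.θinf - 1) * x * v x ^ 2 + (θ.θ₂ - θ.θ₁ + 1 - (θ.θinf + θ.θ₂) * x) * v x + θ.θ₁)
      / (2 * (x - 1) * v x)) (by fun_prop (disch := assumption)) ?_) ?_
  · rw [q.v_zero]
    field_simp
    ring
  · filter_upwards [q.eventually hy] with x ⟨e, b1, b2, b3, b4, b5⟩
    simp only [Z, Matrix.of_apply, Matrix.cons_val', Matrix.cons_val_zero, Matrix.cons_val_one,
      Matrix.cons_val_fin_one, Matrix.cons_val, e]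
    field_simp

theorem Z_02 (q : Quotient y v) (hy : IsHolomorphicBranch θ y) (h : deriv y 0 ≠ 0) :
    HolValue (𝓝[≠] 0) (fun x => Z θ x (y x) (deriv y x) 0 2)
      (-((θ.θinf + θ.θ₃) * deriv y 0 - θ.θ₁) / (2 * deriv y 0)) := by
  have a1 := q.an
  have a2 := q.an_y.deriv
  have h1 : 2 * ((0 : ℂ) - 1) * v 0 ≠ 0 := by simp [q.v_zero, h]
  refine HolValue.congr (.of_analyticAt (f := fun x => ((1 - x) * deriv y x
    + (1 - θ.θinf) * x * v x ^ 2 + ((θ.θ₁ - θ.θ₃) * x + θ.θinf + θ.θ₃ - 1) * v x - θ.θ₁)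
      / (2 * (x - 1) * v x)) (by fun_prop (disch := assumption)) ?_) ?_
  · rw [q.v_zero]
    field_simp
    ring
  · filter_upwards [q.eventually hy] with x ⟨e, b1, b2, b3, b4, b5⟩
    simp only [Z, Matrix.of_apply, Matrix.cons_val', Matrix.cons_val_zero, Matrix.cons_val_one,
      Matrix.cons_val_fin_one, Matrix.cons_val, e]
    field_simp

theorem mul_l₁ (q : Quotient y v) (hy : IsHolomorphicBranch θ y) (h : deriv y 0 ≠ 0) :
    HolValue (𝓝[≠] 0) (fun x => x * l₁ θ x (y x) (deriv y x))
      (((θ.θ₁ - θ.θ₂) * deriv y 0 - θ.θ₁) / (2 * deriv y 0)) := by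
  have a0 := q.an_y
  have a1 := q.an
  have a2 := q.an_y.deriv
  have h1 : 2 * ((0 : ℂ) - 1) * (y 0 - 1) * v 0 ≠ 0 := by simp [q.v_zero, q.y_zero, h]
  refine HolValue.congr (.of_analyticAt (f := fun x => ((1 - x) * deriv y x
    + (θ.θ₂ - θ.θ₁ - θ.θ₃ + 1) * x * v x ^ 2 + ((θ.θ₁ + θ.θ₃) * x + θ.θ₁ - θ.θ₂ - 1) * v x - θ.θ₁)
      / (2 * (x - 1) * (y x - 1) * v x)) (by fun_prop (disch := assumption)) ?_) ?_
  · rw [q.v_zero, q.y_zero]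
    field_simp
    ring
  · filter_upwards [q.eventually hy] with x ⟨e, b1, b2, b3, b4, b5⟩
    rw [e] at b3
    rw [l₁, e]
    field_simp

theorem Z_10 (q : Quotient y v) (hy : IsHolomorphicBranch θ y) (h : deriv y 0 ≠ 1) :
    HolValue (𝓝[≠] 0) (fun x => Z θ x (y x) (deriv y x) 1 0)
      (((θ.θ₁ - θ.θ₂) * deriv y 0 - θ.θ₁) / (2 * (1 - deriv y 0))) := by
  have a1 := q.an
  have a2 := q.an_y.deriv
  have h0 : 1 - deriv y 0 ≠ 0 := sub_ne_zero.2 h.symm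
  have h1 : 2 * (1 - v 0) ≠ 0 := by simp [q.v_zero, h0]
  refine HolValue.congr (.of_analyticAt (f := fun x => ((x - 1) * deriv y x
    + (θ.θinf - 1) * x * v x ^ 2 + (θ.θ₁ - θ.θ₂ + 1 - (θ.θinf - θ.θ₂) * x) * v x - θ.θ₁)
      / (2 * (1 - v x))) (by fun_prop (disch := assumption)) ?_) ?_
  · rw [q.v_zero]
    field_simp
    ring
  · filter_upwards [q.eventually hy] with x ⟨e, b1, b2, b3, b4, b5⟩
    simp only [Z, Matrix.of_apply, Matrix.cons_val', Matrix.cons_val_zero, Matrix.cons_val_one,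
      Matrix.cons_val_fin_one, Matrix.cons_val, e]
    rw [show x - x * v x = x * (1 - v x) by ring]
    field_simp

theorem Z_12 (q : Quotient y v) (hy : IsHolomorphicBranch θ y) (h : deriv y 0 ≠ 1) :
    HolValue (𝓝[≠] 0) (fun x => Z θ x (y x) (deriv y x) 1 2)
      (((θ.θinf + θ.θ₃) * deriv y 0 - (θ.θinf - θ.θ₂ + θ.θ₃)) / (2 * (1 - deriv y 0))) := by
  have a1 := q.an
  have a2 := q.an_y.deriv
  have h0 : 1 - deriv y 0 ≠ 0 := sub_ne_zero.2 h.symm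
  have h1 : 2 * (1 - v 0) ≠ 0 := by simp [q.v_zero, h0]
  refine HolValue.congr (.of_analyticAt (f := fun x => ((1 - x) * deriv y x
    + (1 - θ.θinf) * x * v x ^ 2 + ((θ.θinf - θ.θ₂) * x + θ.θinf + θ.θ₃ - 1) * v x
    - (θ.θinf - θ.θ₂ + θ.θ₃)) / (2 * (1 - v x))) (by fun_prop (disch := assumption)) ?_) ?_
  · rw [q.v_zero]
    field_simp
    ring
  · filter_upwards [q.eventually hy] with x ⟨e, b1, b2, b3, b4, b5⟩
    simp only [Z, Matrix.of_apply, Matrix.cons_val', Matrix.cons_val_zero, Matrix.cons_val_one,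
      Matrix.cons_val_fin_one, Matrix.cons_val, e]
    rw [show x - x * v x = x * (1 - v x) by ring]
    field_simp

theorem mul_l₂ (q : Quotient y v) (hy : IsHolomorphicBranch θ y) (h : deriv y 0 ≠ 1) :
    HolValue (𝓝[≠] 0) (fun x => x * l₂ θ x (y x) (deriv y x))
      (((θ.θ₁ - θ.θ₂) * deriv y 0 - θ.θ₁) / (2 * (1 - deriv y 0))) := by
  have a0 := q.an_y
  have a1 := q.an
  have a2 := q.an_y.deriv
  have h0 : 1 - deriv y 0 ≠ 0 := sub_ne_zero.2 h.symm
  have h1 : 2 * ((0 : ℂ) - 1) * (y 0 - 1) * (1 - v 0) ≠ 0 := by simp [q.v_zero, q.y_zero, h0]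
  refine HolValue.congr (.of_analyticAt (f := fun x => (-(x - 1) ^ 2 * deriv y x
    + ((θ.θ₁ - 3 * θ.θ₂ + θ.θ₃ + 1) * x - θ.θ₁ + θ.θ₂ + θ.θ₃ - 1) * x * v x ^ 2
    + ((2 * θ.θ₂ - θ.θ₁ - θ.θ₃) * x ^ 2 + (3 * θ.θ₂ - 3 * θ.θ₃ - 1) * x + θ.θ₁ - θ.θ₂ + 1) * v x
    + (θ.θ₁ - 2 * θ.θ₂ + 2 * θ.θ₃) * x - θ.θ₁)
      / (2 * (x - 1) * (y x - 1) * (1 - v x))) (by fun_prop (disch := assumption)) ?_) ?_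
  · rw [q.v_zero, q.y_zero]
    field_simp
    ring
  · filter_upwards [q.eventually hy] with x ⟨e, b1, b2, b3, b4, b5⟩
    rw [e] at b3
    rw [l₂, e, show x - x * v x = x * (1 - v x) by ring, show 1 - x = -(x - 1) by ring,
      show 1 - x * v x = -(x * v x - 1) by ring]
    field_simp
    ring

theorem Z_20 (q : Quotient y v) (hy : IsHolomorphicBranch θ y) :
    ∃ c, HolValue (𝓝[≠] 0) (fun x => Z θ x (y x) (deriv y x) 2 0) c := by
  have a0 := q.an_y
  have a1 := q.an
  have a2 := q.an_y.deriv
  have h1 : 2 * (y 0 - 1) ≠ 0 := by simp [q.y_zero]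
  refine ⟨_, HolValue.congr (.of_analyticAt (f := fun x => ((1 - x) * deriv y x
    + (1 - θ.θinf) * x * v x ^ 2 + ((θ.θ₃ - θ.θ₁) * x + θ.θinf - θ.θ₃ - 1) * v x + θ.θ₁)
      / (2 * (y x - 1))) (by fun_prop (disch := assumption)) rfl) ?_⟩
  filter_upwards [q.eventually hy] with x ⟨e, b1, b2, b3, b4, b5⟩
  rw [e] at b3
  simp only [Z, Matrix.of_apply, Matrix.cons_val', Matrix.cons_val_zero, Matrix.cons_val_one,
    Matrix.cons_val_fin_one, Matrix.cons_val, e]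
  field_simp

theorem Z_21 (q : Quotient y v) (hy : IsHolomorphicBranch θ y) :
    ∃ c, HolValue (𝓝[≠] 0) (fun x => Z θ x (y x) (deriv y x) 2 1) c := by
  have a0 := q.an_y
  have a1 := q.an
  have a2 := q.an_y.deriv
  have h1 : 2 * (1 - y 0) ≠ 0 := by simp [q.y_zero]
  refine ⟨_, HolValue.congr (.of_analyticAt (f := fun x => ((1 - x) * deriv y x
    + (1 - θ.θinf) * x * v x ^ 2 + ((θ.θinf + θ.θ₂) * x + θ.θinf - θ.θ₃ - 1) * v x
    - (θ.θinf + θ.θ₂ - θ.θ₃)) / (2 * (1 - y x))) (by fun_prop (disch := assumption)) rfl) ?_⟩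
  filter_upwards [q.eventually hy] with x ⟨e, b1, b2, b3, b4, b5⟩
  rw [e] at b3
  simp only [Z, Matrix.of_apply, Matrix.cons_val', Matrix.cons_val_zero, Matrix.cons_val_one,
    Matrix.cons_val_fin_one, Matrix.cons_val, e]
  rw [show 1 - x * v x = -(x * v x - 1) by ring]
  field_simp

end Quotient

/-- What the expansion `y = x ^ (k + 1) u` in the case `θ₁ = 0`, `y(0) = y'(0) = 0` says on `l₁`
and the entries of `Z`. -/
structure FlatData (θ : Params) (y : ℂ → ℂ) (k : ℕ) : Prop where
  pos : 1 ≤ k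
  l₁ : HolValue (𝓝[≠] 0) (fun x => x * l₁ θ x (y x) (deriv y x)) ((k - θ.θ₂) / 2)
  Z01 : HolValue (𝓝[≠] 0) (fun x => Z θ x (y x) (deriv y x) 0 1) ((k - θ.θ₂) / 2)
  Z02 : ∃ c, HolValue (𝓝[≠] 0) (fun x => Z θ x (y x) (deriv y x) 0 2) c
  Z10 : ∃ c, HolValue (𝓝[≠] 0) (fun x => x ^ (-k : ℤ) * Z θ x (y x) (deriv y x) 1 0)
    (c * (k + θ.θ₂))
  Z20 : ∃ c, HolValue (𝓝[≠] 0) (fun x => x ^ (-k : ℤ) * Z θ x (y x) (deriv y x) 2 0) c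
  sq : (k : ℂ) ^ 2 = θ.θ₂ ^ 2

theorem exists_flatData (hy : IsHolomorphicBranch θ y) (h1 : θ.θ₁ = 0) (h0 : y 0 = 0)
    (h0' : deriv y 0 = 0) : ∃ k, FlatData θ y k := by
  obtain ⟨m, u, S₁, S₂, h⟩ := exists_orderData hy.1 (c₀ := 0) (c₁ := 0)
    (hy.eventually_ne.mono fun x hx => by simpa using hx.2.2.1)
  have hm := exponent_at_zero hy h1 h0 h0' h
  obtain ⟨n, rfl⟩ := h.exists_add_two hy.1 h0 h0'
  have ha := hy.1
  have hu := h.an_u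
  have hu0 := h.u_ne
  have hS := h.an_S₁
  have hS0 := h.S₁_zero
  have hN : (0 : ℂ) - 1 ≠ 0 := by simp
  have key : ∀ᶠ x in 𝓝[≠] (0 : ℂ), x ≠ 0 ∧ x - 1 ≠ 0 ∧ y x ≠ 0 ∧ y x - 1 ≠ 0 ∧ u x ≠ 0 ∧
      1 - x ^ (n + 1) * u x ≠ 0 ∧ deriv y x = x ^ (n + 1) * S₁ x ∧ y x = x * x ^ (n + 1) * u x := by
    filter_upwards [hy.eventually_ne, h.eq.filter_mono nhdsWithin_le_nhds,
      h.deriv_eq.filter_mono nhdsWithin_le_nhds,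
      (hu.continuousAt.eventually_ne hu0).filter_mono nhdsWithin_le_nhds]
      with x ⟨a, b, c, d, e⟩ e1 e2 e3
    have e4 : y x = x * x ^ (n + 1) * u x := by
      rw [e1]
      ring
    refine ⟨a, sub_ne_zero.2 b, c, sub_ne_zero.2 d, e3, fun h => e ?_, ?_, e4⟩
    · linear_combination e4 - x * h
    · refine mul_left_cancel₀ a ?_
      linear_combination e2
  refine ⟨n + 1, by omega, ?_, ?_, ?_, ?_, ?_, ?_⟩
  · have h2 : 2 * ((0 : ℂ) - 1) * (y 0 - 1) ≠ 0 := by simp [h0]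
    refine HolValue.congr (.of_analyticAt (f := fun x => ((1 - x) * (S₁ x / u x)
      + (θ.θ₂ - θ.θ₃ + 1) * y x + θ.θ₃ * x - θ.θ₂ - 1) / (2 * (x - 1) * (y x - 1)))
      (by fun_prop (disch := assumption)) ?_) ?_
    · rw [hS0, h0]
      field_simp
      push_cast
      ring
    · filter_upwards [key] with x ⟨a, b, c, d, e, f, g, i⟩
      rw [i] at d ⊢
      rw [l₁, h1, g]
      field_simp
      ring
  · have h2 : 2 * ((0 : ℂ) - 1) ≠ 0 := by simp
    refine HolValue.congr (.of_analyticAt (f := fun x => ((x - 1) * (S₁ x / u x)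
      + (θ.θinf - 1) * y x + θ.θ₂ + 1 - (θ.θinf + θ.θ₂) * x) / (2 * (x - 1)))
      (by fun_prop (disch := assumption)) ?_) ?_
    · rw [hS0, h0]
      field_simp
      push_cast
      ring
    · filter_upwards [key] with x ⟨a, b, c, d, e, f, g, i⟩
      simp only [Z, Matrix.of_apply, Matrix.cons_val', Matrix.cons_val_zero, Matrix.cons_val_one,
        Matrix.cons_val_fin_one, Matrix.cons_val, h1, g, i]
      field_simp
      ring
  · have h2 : 2 * ((0 : ℂ) - 1) ≠ 0 := by simp
    refine ⟨_, HolValue.congr (.of_analyticAt (f := fun x => ((1 - x) * (S₁ x / u x)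
      + (1 - θ.θinf) * y x - θ.θ₃ * x + θ.θinf + θ.θ₃ - 1) / (2 * (x - 1)))
      (by fun_prop (disch := assumption)) rfl) ?_⟩
    filter_upwards [key] with x ⟨a, b, c, d, e, f, g, i⟩
    simp only [Z, Matrix.of_apply, Matrix.cons_val', Matrix.cons_val_zero, Matrix.cons_val_one,
      Matrix.cons_val_fin_one, Matrix.cons_val, h1, g, i]
    field_simp
    ring
  · have h2 : 2 * (1 - (0 : ℂ) ^ (n + 1) * u 0) ≠ 0 := by simp
    refine ⟨-u 0 / 2, HolValue.congr (.of_analyticAt (f := fun x => ((x - 1) * S₁ x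
      + u x * ((θ.θinf - 1) * y x + 1 - θ.θ₂ - (θ.θinf - θ.θ₂) * x))
        / (2 * (1 - x ^ (n + 1) * u x))) (by fun_prop (disch := assumption)) ?_) ?_⟩
    · rw [hS0, h0, zero_pow n.succ_ne_zero]
      field_simp
      push_cast
      ring
    · filter_upwards [key] with x ⟨a, b, c, d, e, f, g, i⟩
      simp only [Z, Matrix.of_apply, Matrix.cons_val', Matrix.cons_val_zero, Matrix.cons_val_one,
        Matrix.cons_val_fin_one, Matrix.cons_val, h1, g, i]
      rw [_root_.zpow_neg, zpow_natCast,
        show x - x * x ^ (n + 1) * u x = x * (1 - x ^ (n + 1) * u x) by ring]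
      have hX : x ^ (n + 1) ≠ 0 := pow_ne_zero _ a
      generalize x ^ (n + 1) = X at *
      field_simp
      ring
  · have h2 : 2 * (y 0 - 1) ≠ 0 := by simp [h0]
    refine ⟨_, HolValue.congr (.of_analyticAt (f := fun x => ((1 - x) * S₁ x
      + u x * ((1 - θ.θinf) * y x + θ.θ₃ * x + θ.θinf - θ.θ₃ - 1)) / (2 * (y x - 1)))
      (by fun_prop (disch := assumption)) rfl) ?_⟩
    filter_upwards [key] with x ⟨a, b, c, d, e, f, g, i⟩
    rw [i] at d ⊢
    simp only [Z, Matrix.of_apply, Matrix.cons_val', Matrix.cons_val_zero, Matrix.cons_val_one,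
      Matrix.cons_val_fin_one, Matrix.cons_val, h1, g]
    rw [_root_.zpow_neg, zpow_natCast]
    have hX : x ^ (n + 1) ≠ 0 := pow_ne_zero _ a
    generalize x ^ (n + 1) = X at *
    field_simp
    ring
  · push_cast at hm ⊢
    linear_combination hm

/-- What the expansion `y = x + x ^ (k + 1) u` in the case `θ₂ = 0`, `y(0) = 0`, `y'(0) = 1` says
on `l₂` and the entries of `Z`. -/
structure TangentData (θ : Params) (y : ℂ → ℂ) (k : ℕ) : Prop where
  pos : 1 ≤ k
  l₂ : HolValue (𝓝[≠] 0) (fun x => x * l₂ θ x (y x) (deriv y x)) ((k - θ.θ₁) / 2)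
  Z10 : HolValue (𝓝[≠] 0) (fun x => Z θ x (y x) (deriv y x) 1 0) ((k - θ.θ₁) / 2)
  Z12 : ∃ c, HolValue (𝓝[≠] 0) (fun x => Z θ x (y x) (deriv y x) 1 2) c
  Z01 : ∃ c, HolValue (𝓝[≠] 0) (fun x => x ^ (-k : ℤ) * Z θ x (y x) (deriv y x) 0 1)
    (c * (k + θ.θ₁))
  Z21 : ∃ c, HolValue (𝓝[≠] 0) (fun x => x ^ (-k : ℤ) * Z θ x (y x) (deriv y x) 2 1) c
  sq : (k : ℂ) ^ 2 = θ.θ₁ ^ 2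

theorem exists_tangentData (hy : IsHolomorphicBranch θ y) (h2 : θ.θ₂ = 0) (h0 : y 0 = 0)
    (h0' : deriv y 0 = 1) : ∃ k, TangentData θ y k := by
  obtain ⟨m, u, S₁, S₂, h⟩ := exists_orderData hy.1 (c₀ := 0) (c₁ := 1)
    (hy.eventually_ne.mono fun x hx => by simpa using hx.2.2.2.2)
  have hm := exponent_at_diagonal hy h2 h0 h0' h
  obtain ⟨n, rfl⟩ := h.exists_add_two hy.1 h0 h0'
  have ha := hy.1
  have hu := h.an_u
  have hu0 := h.u_ne
  have hS := h.an_S₁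
  have hS0 := h.S₁_zero
  have hN : (0 : ℂ) - 1 ≠ 0 := by simp
  have key : ∀ᶠ x in 𝓝[≠] (0 : ℂ), x ≠ 0 ∧ x - 1 ≠ 0 ∧ y x - 1 ≠ 0 ∧ u x ≠ 0 ∧
      1 + x ^ (n + 1) * u x ≠ 0 ∧ deriv y x = 1 + x ^ (n + 1) * S₁ x ∧
      y x = x * (1 + x ^ (n + 1) * u x) ∧ x ^ (n + 1) ≠ 0 := by
    filter_upwards [hy.eventually_ne, h.eq.filter_mono nhdsWithin_le_nhds,
      h.deriv_eq.filter_mono nhdsWithin_le_nhds,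
      (hu.continuousAt.eventually_ne hu0).filter_mono nhdsWithin_le_nhds]
      with x ⟨a, b, c, d, e⟩ e1 e2 e3
    have e4 : y x = x * (1 + x ^ (n + 1) * u x) := by
      rw [e1]
      ring
    refine ⟨a, sub_ne_zero.2 b, sub_ne_zero.2 d, e3, fun h => c ?_, ?_, e4, pow_ne_zero _ a⟩
    · rw [e4, h, mul_zero]
    · refine mul_left_cancel₀ a ?_
      linear_combination e2
  refine ⟨n + 1, by omega, ?_, ?_, ?_, ?_, ?_, ?_⟩
  · have h3 : 2 * ((0 : ℂ) - 1) * (y 0 - 1) ≠ 0 := by simp [h0]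
    refine HolValue.congr (.of_analyticAt (f := fun x => ((x - 1) ^ 2 * (S₁ x / u x)
      - ((θ.θ₁ + θ.θ₃ + 1) * x - θ.θ₁ + θ.θ₃ - 1) * (x + y x)
      + (θ.θ₁ + θ.θ₃) * x ^ 2 + (3 * θ.θ₃ + 1) * x - θ.θ₁ - 1) / (2 * (x - 1) * (y x - 1)))
      (by fun_prop (disch := assumption)) ?_) ?_
    · rw [hS0, h0]
      field_simp
      push_cast
      ring
    · filter_upwards [key] with x ⟨a, b, d, e, f, g, i, hX⟩
      rw [i] at d ⊢
      rw [l₂, h2, g, show x - x * (1 + x ^ (n + 1) * u x) = -(x * x ^ (n + 1) * u x) by ring,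
        show 1 - x = -(x - 1) by ring, show 1 - x * (1 + x ^ (n + 1) * u x)
          = -(x * (1 + x ^ (n + 1) * u x) - 1) by ring]
      generalize x ^ (n + 1) = X at *
      field_simp
      ring
  · refine HolValue.congr (.of_analyticAt (f := fun x => -((x - 1) * (S₁ x / u x)
      + (θ.θinf - 1) * (x + y x) + θ.θ₁ + 1 - θ.θinf * x) / 2)
      (by fun_prop (disch := assumption)) ?_) ?_
    · rw [hS0, h0]
      field_simp
      push_cast
      ring
    · filter_upwards [key] with x ⟨a, b, d, e, f, g, i, hX⟩
      simp only [Z, Matrix.of_apply, Matrix.cons_val', Matrix.cons_val_zero, Matrix.cons_val_one,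
        Matrix.cons_val_fin_one, Matrix.cons_val, h2, g, i]
      rw [show x - x * (1 + x ^ (n + 1) * u x) = -(x * x ^ (n + 1) * u x) by ring]
      generalize x ^ (n + 1) = X at *
      field_simp
      ring
  · refine ⟨_, HolValue.congr (.of_analyticAt (f := fun x => -((1 - x) * (S₁ x / u x)
      + (1 - θ.θinf) * (x + y x) + θ.θinf * x + θ.θinf + θ.θ₃ - 1) / 2)
      (by fun_prop (disch := assumption)) rfl) ?_⟩
    filter_upwards [key] with x ⟨a, b, d, e, f, g, i, hX⟩
    simp only [Z, Matrix.of_apply, Matrix.cons_val', Matrix.cons_val_zero, Matrix.cons_val_one,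
      Matrix.cons_val_fin_one, Matrix.cons_val, h2, g, i]
    rw [show x - x * (1 + x ^ (n + 1) * u x) = -(x * x ^ (n + 1) * u x) by ring]
    generalize x ^ (n + 1) = X at *
    field_simp
    ring
  · have h3 : 2 * ((0 : ℂ) - 1) * (1 + (0 : ℂ) ^ (n + 1) * u 0) ≠ 0 := by simp
    refine ⟨u 0 / 2, HolValue.congr (.of_analyticAt (f := fun x => ((x - 1) * S₁ x
      + u x * ((θ.θinf - 1) * (x + y x) + 1 - θ.θ₁ - θ.θinf * x))
        / (2 * (x - 1) * (1 + x ^ (n + 1) * u x))) (by fun_prop (disch := assumption)) ?_) ?_⟩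
    · rw [hS0, h0, zero_pow n.succ_ne_zero]
      field_simp
      push_cast
      ring
    · filter_upwards [key] with x ⟨a, b, d, e, f, g, i, hX⟩
      simp only [Z, Matrix.of_apply, Matrix.cons_val', Matrix.cons_val_zero, Matrix.cons_val_one,
        Matrix.cons_val_fin_one, Matrix.cons_val, h2, g, i]
      rw [_root_.zpow_neg, zpow_natCast]
      generalize x ^ (n + 1) = X at *
      field_simp
      ring
  · have h3 : 2 * (1 - y 0) ≠ 0 := by simp [h0]
    refine ⟨_, HolValue.congr (.of_analyticAt (f := fun x => ((1 - x) * S₁ x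
      + u x * ((1 - θ.θinf) * (x + y x) + θ.θinf * x + θ.θinf - θ.θ₃ - 1)) / (2 * (1 - y x)))
      (by fun_prop (disch := assumption)) rfl) ?_⟩
    filter_upwards [key] with x ⟨a, b, d, e, f, g, i, hX⟩
    rw [i] at d ⊢
    simp only [Z, Matrix.of_apply, Matrix.cons_val', Matrix.cons_val_zero, Matrix.cons_val_one,
      Matrix.cons_val_fin_one, Matrix.cons_val, h2, g]
    rw [_root_.zpow_neg, zpow_natCast, show 1 - x * (1 + x ^ (n + 1) * u x)
          = -(x * (1 + x ^ (n + 1) * u x) - 1) by ring]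
    generalize x ^ (n + 1) = X at *
    field_simp
    ring
  · push_cast at hm ⊢
    linear_combination hm

end ZeroValue

/-! ### The vanishing condition for `y(0) = 0` -/

section ZeroValue

variable {θ : Params} {y k₁ k₂ : ℂ → ℂ}

theorem Quotient.Z_02_eq {v : ℂ → ℂ} (q : Quotient y v) (hy : IsHolomorphicBranch θ y)
    (h : deriv y 0 ≠ 0) (hν : (θ.θ₁ - θ.θ₂) * deriv y 0 = θ.θ₁) :
    HolValue (𝓝[≠] 0) (fun x => Z θ x (y x) (deriv y x) 0 2)
      (-(θ.θinf + θ.θ₃ - (θ.θ₁ - θ.θ₂)) / 2) := by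
  convert q.Z_02 hy h using 1
  field_simp
  linear_combination hν

theorem Quotient.Z_12_eq {v : ℂ → ℂ} (q : Quotient y v) (hy : IsHolomorphicBranch θ y)
    (h : deriv y 0 ≠ 1) (hν : (θ.θ₁ - θ.θ₂) * deriv y 0 = θ.θ₁) :
    HolValue (𝓝[≠] 0) (fun x => Z θ x (y x) (deriv y x) 1 2)
      (-(θ.θinf + θ.θ₃ + (θ.θ₁ - θ.θ₂)) / 2) := by
  have h0 : 1 - deriv y 0 ≠ 0 := sub_ne_zero.2 h.symm
  convert q.Z_12 hy h using 1
  field_simp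
  linear_combination hν

theorem holValue_zero_of_slope {f : ℂ → ℂ} {c : ℂ} (hν : (θ.θ₁ - θ.θ₂) * deriv y 0 = θ.θ₁)
    (h : HolValue (𝓝[≠] 0) f (((θ.θ₁ - θ.θ₂) * deriv y 0 - θ.θ₁) / c)) :
    HolValue (𝓝[≠] 0) f 0 :=
  h.eq_zero (by rw [hν, sub_self, zero_div])

/-- All entries of `Z` are holomorphic at `0` and `k₁`, `k₂` are holomorphic units. -/
theorem vanishingCondition_of_slope_ne (hy : IsHolomorphicBranch θ y) (hk : AreFactors θ y k₁ k₂)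
    (h0 : y 0 = 0) (hν : (θ.θ₁ - θ.θ₂) * deriv y 0 = θ.θ₁) (hd0 : deriv y 0 ≠ 0)
    (hd1 : deriv y 0 ≠ 1) :
    VanishingCondition (Omega θ y k₁ k₂) ∧
      (∃ c ≠ 0, HolValue (𝓝[Complex.slitPlane] 0) (fun x => Omega θ y k₁ k₂ x 0 2)
        (c * (θ.θinf + θ.θ₃ - (θ.θ₁ - θ.θ₂)))) ∧
      ∃ c ≠ 0, HolValue (𝓝[Complex.slitPlane] 0) (fun x => Omega θ y k₁ k₂ x 1 2)
        (c * (θ.θinf + θ.θ₃ + (θ.θ₁ - θ.θ₂))) := by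
  obtain ⟨v, q⟩ := exists_quotient hy.1 h0
  obtain ⟨h₁, h₂, hF⟩ := hk.exists_integralFactors (n₁ := 0) (n₂ := 0)
    (by simpa using holValue_zero_of_slope hν (q.mul_l₁ hy hd0))
    (by simpa using holValue_zero_of_slope hν (q.mul_l₂ hy hd1))
  obtain ⟨c20, v20⟩ := q.Z_20 hy
  obtain ⟨c21, v21⟩ := q.Z_21 hy
  have w01 := (hF.holValue 0 1 0 (by simp) (holValue_zero_of_slope hν
    (q.Z_01 hy hd0)).zero_zpow_mul).eq_zero (mul_zero _)
  have w10 := (hF.holValue 1 0 0 (by simp) (holValue_zero_of_slope hν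
    (q.Z_10 hy hd1)).zero_zpow_mul).eq_zero (mul_zero _)
  have w02 := hF.holValue 0 2 0 (by simp) (q.Z_02_eq hy hd0 hν).zero_zpow_mul
  have w12 := hF.holValue 1 2 0 (by simp) (q.Z_12_eq hy hd1 hν).zero_zpow_mul
  have w20 := hF.holValue 2 0 0 (by simp) v20.zero_zpow_mul
  have w21 := hF.holValue 2 1 0 (by simp) v21.zero_zpow_mul
  refine ⟨hF.vanishingCondition hk w01 w10 ⟨_, w02⟩ ⟨_, w20⟩ ⟨_, w12⟩ ⟨_, w21⟩,
    ⟨-h₁ 0 / 2, by simp [hF.ne₁], ?_⟩, -h₂ 0 / 2, by simp [hF.ne₂], ?_⟩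
  · convert hF.holValue_omega w02 using 1
    simp
    ring
  · convert hF.holValue_omega w12 using 1
    simp
    ring

/-- Here `y = x ^ (k + 1) u` and `θ₂ = ± k`; for `θ₂ = -k` the pole of `k₁⁻¹` is cancelled by the
zeros of `Z₂₁`, `Z₃₁`. -/
theorem vanishingCondition_of_slope_zero (hy : IsHolomorphicBranch θ y)
    (hk : AreFactors θ y k₁ k₂) (h0 : y 0 = 0) (h1 : θ.θ₁ = 0) (hd : deriv y 0 = 0) :
    VanishingCondition (Omega θ y k₁ k₂) ∧
      (∀ k : ℕ, 1 ≤ k → θ.θ₂ = k →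
        HolValue (𝓝[Complex.slitPlane] 0) (fun x => Omega θ y k₁ k₂ x 2 0) 0) ∧
      ∃ c ≠ 0, HolValue (𝓝[Complex.slitPlane] 0) (fun x => Omega θ y k₁ k₂ x 1 2)
        (c * (θ.θinf + θ.θ₃ + (θ.θ₁ - θ.θ₂))) := by
  have hν : (θ.θ₁ - θ.θ₂) * deriv y 0 = θ.θ₁ := by rw [hd, h1, mul_zero]
  have hd1 : deriv y 0 ≠ 1 := by simp [hd]
  obtain ⟨v, q⟩ := exists_quotient hy.1 h0
  obtain ⟨k, hD⟩ := exists_flatData hy h1 h0 hd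
  have hl2 := holValue_zero_of_slope hν (q.mul_l₂ hy hd1)
  obtain ⟨c21, v21⟩ := q.Z_21 hy
  obtain ⟨c02, v02⟩ := hD.Z02
  obtain ⟨c10, v10⟩ := hD.Z10
  obtain ⟨c20, v20⟩ := hD.Z20
  have hkp := hD.pos
  rcases sq_eq_sq_iff_eq_or_eq_neg.1 hD.sq with h2 | h2
  · obtain ⟨h₁, h₂, hF⟩ := hk.exists_integralFactors (n₁ := 0) (n₂ := 0)
      (by simpa [h2] using hD.l₁) (by simpa using hl2)
    have w01 := (hF.holValue 0 1 0 (by simp) hD.Z01.zero_zpow_mul).eq_zero (by rw [h2]; simp)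
    have w10 := (hF.holValue 1 0 0 (by simp)
      (v10.of_zpow_neg_mul hkp).zero_zpow_mul).eq_zero (mul_zero _)
    have w02 := hF.holValue 0 2 0 (by simp) v02.zero_zpow_mul
    have w12 := hF.holValue 1 2 0 (by simp) (q.Z_12_eq hy hd1 hν).zero_zpow_mul
    have w20 := (hF.holValue 2 0 0 (by simp)
      (v20.of_zpow_neg_mul hkp).zero_zpow_mul).eq_zero (mul_zero _)
    have w21 := hF.holValue 2 1 0 (by simp) v21.zero_zpow_mul
    refine ⟨hF.vanishingCondition hk w01 w10 ⟨_, w02⟩ ⟨_, w20⟩ ⟨_, w12⟩ ⟨_, w21⟩,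
      fun _ _ _ => hF.holValue_omega w20, -h₂ 0 / 2, by simp [hF.ne₂], ?_⟩
    convert hF.holValue_omega w12 using 1
    simp
    ring
  · obtain ⟨h₁, h₂, hF⟩ := hk.exists_integralFactors (n₁ := k) (n₂ := 0)
      (by
        convert hD.l₁ using 1
        push_cast
        linear_combination h2 / 2) (by simpa using hl2)
    have w01 := (hF.holValue 0 1 k (by simp) (hD.Z01.pow_mul' k)).eq_zero (by
      rw [zero_pow (by omega)]
      ring)
    have w10 := (hF.holValue 1 0 (-k) (by simp) v10).eq_zero (by
      rw [h2]
      ring)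
    have w02 := hF.holValue 0 2 k (by simp) (v02.pow_mul' k)
    have w12 := hF.holValue 1 2 0 (by simp) (q.Z_12_eq hy hd1 hν).zero_zpow_mul
    have w20 := hF.holValue 2 0 (-k) (by simp) v20
    have w21 := hF.holValue 2 1 0 (by simp) v21.zero_zpow_mul
    refine ⟨hF.vanishingCondition hk w01 w10 ⟨_, w02⟩ ⟨_, w20⟩ ⟨_, w12⟩ ⟨_, w21⟩,
      fun j hj hj' => ?_, -h₂ 0 / 2, by simp [hF.ne₂], ?_⟩
    · have : ((k + j : ℕ) : ℂ) = 0 := by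
        push_cast
        linear_combination h2 - hj'
      have := Nat.cast_eq_zero.1 this
      omega
    · convert hF.holValue_omega w12 using 1
      simp
      ring

/-- Here `y = x + x ^ (k + 1) u` and `θ₁ = ± k`; for `θ₁ = -k` the pole of `k₂⁻¹` is cancelled by
the zeros of `Z₁₂`, `Z₃₂`. -/
theorem vanishingCondition_of_slope_one (hy : IsHolomorphicBranch θ y)
    (hk : AreFactors θ y k₁ k₂) (h0 : y 0 = 0) (h2 : θ.θ₂ = 0) (hd : deriv y 0 = 1) :
    VanishingCondition (Omega θ y k₁ k₂) ∧
      (∀ k : ℕ, 1 ≤ k → θ.θ₁ = k →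
        HolValue (𝓝[Complex.slitPlane] 0) (fun x => Omega θ y k₁ k₂ x 2 1) 0) ∧
      ∃ c ≠ 0, HolValue (𝓝[Complex.slitPlane] 0) (fun x => Omega θ y k₁ k₂ x 0 2)
        (c * (θ.θinf + θ.θ₃ - (θ.θ₁ - θ.θ₂))) := by
  have hν : (θ.θ₁ - θ.θ₂) * deriv y 0 = θ.θ₁ := by rw [hd, h2, mul_one, sub_zero]
  have hd0 : deriv y 0 ≠ 0 := by simp [hd]
  obtain ⟨v, q⟩ := exists_quotient hy.1 h0
  obtain ⟨k, hD⟩ := exists_tangentData hy h2 h0 hd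
  have hl1 := holValue_zero_of_slope hν (q.mul_l₁ hy hd0)
  obtain ⟨c20, v20⟩ := q.Z_20 hy
  obtain ⟨c12, v12⟩ := hD.Z12
  obtain ⟨c01, v01⟩ := hD.Z01
  obtain ⟨c21, v21⟩ := hD.Z21
  have hkp := hD.pos
  rcases sq_eq_sq_iff_eq_or_eq_neg.1 hD.sq with h1 | h1
  · obtain ⟨h₁, h₂, hF⟩ := hk.exists_integralFactors (n₁ := 0) (n₂ := 0)
      (by simpa using hl1) (by simpa [h1] using hD.l₂)
    have w10 := (hF.holValue 1 0 0 (by simp) hD.Z10.zero_zpow_mul).eq_zero (by rw [h1]; simp)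
    have w01 := (hF.holValue 0 1 0 (by simp)
      (v01.of_zpow_neg_mul hkp).zero_zpow_mul).eq_zero (mul_zero _)
    have w12 := hF.holValue 1 2 0 (by simp) v12.zero_zpow_mul
    have w02 := hF.holValue 0 2 0 (by simp) (q.Z_02_eq hy hd0 hν).zero_zpow_mul
    have w21 := (hF.holValue 2 1 0 (by simp)
      (v21.of_zpow_neg_mul hkp).zero_zpow_mul).eq_zero (mul_zero _)
    have w20 := hF.holValue 2 0 0 (by simp) v20.zero_zpow_mul
    refine ⟨hF.vanishingCondition hk w01 w10 ⟨_, w02⟩ ⟨_, w20⟩ ⟨_, w12⟩ ⟨_, w21⟩,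
      fun _ _ _ => hF.holValue_omega w21, -h₁ 0 / 2, by simp [hF.ne₁], ?_⟩
    convert hF.holValue_omega w02 using 1
    simp
    ring
  · obtain ⟨h₁, h₂, hF⟩ := hk.exists_integralFactors (n₁ := 0) (n₂ := k)
      (by simpa using hl1) (by
        convert hD.l₂ using 1
        push_cast
        linear_combination h1 / 2)
    have w10 := (hF.holValue 1 0 k (by simp) (hD.Z10.pow_mul' k)).eq_zero (by
      rw [zero_pow (by omega)]
      ring)
    have w01 := (hF.holValue 0 1 (-k) (by simp) v01).eq_zero (by
      rw [h1]
      ring)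
    have w12 := hF.holValue 1 2 k (by simp) (v12.pow_mul' k)
    have w02 := hF.holValue 0 2 0 (by simp) (q.Z_02_eq hy hd0 hν).zero_zpow_mul
    have w21 := hF.holValue 2 1 (-k) (by simp) v21
    have w20 := hF.holValue 2 0 0 (by simp) v20.zero_zpow_mul
    refine ⟨hF.vanishingCondition hk w01 w10 ⟨_, w02⟩ ⟨_, w20⟩ ⟨_, w12⟩ ⟨_, w21⟩,
      fun j hj hj' => ?_, -h₁ 0 / 2, by simp [hF.ne₁], ?_⟩
    · have : ((k + j : ℕ) : ℂ) = 0 := by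
        push_cast
        linear_combination h1 - hj'
      have := Nat.cast_eq_zero.1 this
      omega
    · convert hF.holValue_omega w02 using 1
      simp
      ring

/-- For `y(0) = 0` the vanishing condition holds as soon as `(θ₁ - θ₂) y'(0) = θ₁`. -/
theorem vanishingCondition_of_slope (hy : IsHolomorphicBranch θ y) (hk : AreFactors θ y k₁ k₂)
    (h0 : y 0 = 0) (hν : (θ.θ₁ - θ.θ₂) * deriv y 0 = θ.θ₁) :
    VanishingCondition (Omega θ y k₁ k₂) := by
  by_cases hd0 : deriv y 0 = 0
  · exact (vanishingCondition_of_slope_zero hy hk h0 (by rw [← hν, hd0, mul_zero]) hd0).1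
  by_cases hd1 : deriv y 0 = 1
  · rw [hd1] at hν
    exact (vanishingCondition_of_slope_one hy hk h0 (by linear_combination -hν) hd1).1
  exact (vanishingCondition_of_slope_ne hy hk h0 hν hd0 hd1).1

theorem exists_holValue_Omega_02 (hy : IsHolomorphicBranch θ y) (hk : AreFactors θ y k₁ k₂)
    (h0 : y 0 = 0) (hν : (θ.θ₁ - θ.θ₂) * deriv y 0 = θ.θ₁) (hd0 : deriv y 0 ≠ 0) :
    ∃ c ≠ 0, HolValue (𝓝[Complex.slitPlane] 0) (fun x => Omega θ y k₁ k₂ x 0 2)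
      (c * (θ.θinf + θ.θ₃ - (θ.θ₁ - θ.θ₂))) := by
  by_cases hd1 : deriv y 0 = 1
  · rw [hd1] at hν
    exact (vanishingCondition_of_slope_one hy hk h0 (by linear_combination -hν) hd1).2.2
  exact (vanishingCondition_of_slope_ne hy hk h0 hν hd0 hd1).2.1

theorem exists_holValue_Omega_12 (hy : IsHolomorphicBranch θ y) (hk : AreFactors θ y k₁ k₂)
    (h0 : y 0 = 0) (hν : (θ.θ₁ - θ.θ₂) * deriv y 0 = θ.θ₁) (hd1 : deriv y 0 ≠ 1) :
    ∃ c ≠ 0, HolValue (𝓝[Complex.slitPlane] 0) (fun x => Omega θ y k₁ k₂ x 1 2)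
      (c * (θ.θinf + θ.θ₃ + (θ.θ₁ - θ.θ₂))) := by
  by_cases hd0 : deriv y 0 = 0
  · exact (vanishingCondition_of_slope_zero hy hk h0 (by rw [← hν, hd0, mul_zero]) hd0).2.2
  exact (vanishingCondition_of_slope_ne hy hk h0 hν hd0 hd1).2.2

/-- The product `Ω₁₂ Ω₂₁ = Z₁₂ Z₂₁` does not involve the factors, and its value at `0` is a multiple
of `((θ₁ - θ₂) y'(0) - θ₁) ^ 2`. -/
theorem VanishingCondition.slope_eq (hy : IsHolomorphicBranch θ y) (hk : AreFactors θ y k₁ k₂)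
    (h0 : y 0 = 0) (hd0 : deriv y 0 ≠ 0) (hd1 : deriv y 0 ≠ 1)
    (hV : VanishingCondition (Omega θ y k₁ k₂)) : (θ.θ₁ - θ.θ₂) * deriv y 0 = θ.θ₁ := by
  obtain ⟨Ω₀, hV⟩ := hV
  obtain ⟨v, q⟩ := exists_quotient hy.1 h0
  have hd1' : 1 - deriv y 0 ≠ 0 := sub_ne_zero.2 hd1.symm
  have v01 := hV.holValue 0 1
  have v10 := hV.holValue 1 0
  rw [hV.2.1] at v01
  rw [hV.2.2] at v10
  have h : ((θ.θ₁ - θ.θ₂) * deriv y 0 - θ.θ₁) / (2 * deriv y 0)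
      * (((θ.θ₁ - θ.θ₂) * deriv y 0 - θ.θ₁) / (2 * (1 - deriv y 0))) = 0 := by
    refine HolValue.unique (l := 𝓝[Complex.slitPlane] 0) nhdsWithin_le_nhds
      (((q.Z_01 hy hd0).mul (q.Z_10 hy hd1)).mono nhdsWithin_slitPlane_le) ?_
    have := v01.mul v10
    rw [mul_zero] at this
    refine this.congr ?_
    filter_upwards [hk.eventually_ne_zero] with x ⟨h1, h2⟩
    simp only [Omega, Matrix.of_apply, Matrix.cons_val_zero, Matrix.cons_val_one]
    field_simp
  simpa [hd0, hd1', sub_eq_zero] using h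

end ZeroValue

variable {θ : Params} {y k₁ k₂ : ℂ → ℂ}

/-! ### Which branches satisfy the vanishing condition -/

theorem FamilyGeneric.not_vanishingCondition (h : FamilyGeneric θ y) (hy : IsHolomorphicBranch θ y)
    (hk : AreFactors θ y k₁ k₂) : ¬ VanishingCondition (Omega θ y k₁ k₂) := by
  obtain ⟨h1, h⟩ := h
  have h1' : θ.θinf - 1 ≠ 0 := sub_ne_zero.2 h1
  obtain ⟨τ, hN, hy0⟩ : ∃ τ, NotInt (θ.θinf + τ) ∧ y 0 = (θ.θinf - 1 + τ) / (θ.θinf - 1) := by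
    rcases h with h | h
    · exact ⟨_, h⟩
    · exact ⟨-θ.θ₃, by simpa [sub_eq_add_neg] using h.1, by simpa [sub_eq_add_neg] using h.2⟩
  have hσ : (θ.θinf - 1) * y 0 = θ.θinf - 1 + τ := by
    rw [hy0]
    field_simp
  intro hV
  obtain ⟨n, hn, -⟩ := hV.exists_nat hy hk (by
    intro h0
    rw [h0, mul_zero] at hσ
    exact hN 1 (by push_cast; linear_combination -hσ))
  exact hN (-n) (by push_cast; linear_combination hn - hσ)

theorem FamilyFree.not_vanishingCondition (h : FamilyFree θ y) (hy : IsHolomorphicBranch θ y)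
    (hk : AreFactors θ y k₁ k₂) : ¬ VanishingCondition (Omega θ y k₁ k₂) := by
  obtain ⟨-, h1, h0⟩ := h
  intro hV
  obtain ⟨n, hn, -⟩ := hV.exists_nat hy hk h0
  rw [h1, sub_self, zero_mul] at hn
  exact Nat.cast_add_one_ne_zero n (by linear_combination hn)

theorem FamilyT1.mul_apply_zero {N : ℤ} (h : FamilyT1 θ N y) : (θ.θinf - 1) * y 0 = N := by
  have h1 : θ.θinf - 1 ≠ 0 := sub_ne_zero.2 h.2.1
  rw [h.2.2.1]
  field_simp

theorem FamilyT1.apply_zero_ne {N : ℤ} (h : FamilyT1 θ N y) : y 0 ≠ 0 := by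
  intro h0
  have := h.mul_apply_zero
  rw [h0, mul_zero] at this
  exact h.1 (by exact_mod_cast this.symm)

theorem FamilyT1.vanishingCondition_iff {N : ℤ} (h : FamilyT1 θ N y)
    (hy : IsHolomorphicBranch θ y) (hk : AreFactors θ y k₁ k₂) :
    VanishingCondition (Omega θ y k₁ k₂) ↔
      N ≤ -1 ∧ (θ.θ₁ - θ.θ₂ = N + 1 ∨ θ.θ₁ - θ.θ₂ = -(N + 1)) := by
  have hσ := h.mul_apply_zero
  constructor
  · intro hV
    obtain ⟨n, hn, hν⟩ := hV.exists_nat hy hk h.apply_zero_ne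
    have hN : N = -(n + 1) := by
      rw [hσ] at hn
      exact_mod_cast hn
    refine ⟨by omega, ?_⟩
    rw [hN]
    push_cast
    rcases hν with hν | hν
    · exact Or.inr (by rw [hν]; ring)
    · exact Or.inl (by rw [hν]; ring)
  · rintro ⟨hN, hν⟩
    obtain ⟨n, rfl⟩ : ∃ n : ℕ, N = -(n + 1) := ⟨(-N - 1).toNat, by omega⟩
    push_cast at hσ hν
    have hν : θ.θ₁ - θ.θ₂ = n ∨ θ.θ₁ - θ.θ₂ = -n :=
      hν.symm.imp (fun e => by rw [e]; ring) (fun e => by rw [e]; ring)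
    have hD : PlusData θ y n ∨ MinusData θ y n := by
      have h3 := h.2.2.2.1
      push_cast at h3
      by_cases h4 : θ.θinf - 1 + θ.θ₃ = -(n + 1)
      · exact Or.inl (plusData hy hσ h4)
      · have h3 := h3.resolve_left h4
        refine Or.inr (minusData hy hσ h3 fun h1 => h4 ?_)
        rw [h1] at hσ
        linear_combination 2 * hσ - h3
    rcases hD with hD | hD <;> rcases hν with hν | hν
    · exact (hD.of_sub_eq hy hk hσ hν).1
    · exact (hD.of_sub_eq_neg hy hk hσ hν).1
    · exact (hD.of_sub_eq hy hk hσ hν).1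
    · exact (hD.of_sub_eq_neg hy hk hσ hν).1

theorem FamilyT2Minus.slope (h : FamilyT2Minus θ y) : (θ.θ₁ - θ.θ₂) * deriv y 0 = θ.θ₁ := by
  have h1 : θ.θ₁ - θ.θ₂ ≠ 0 := by simpa using h.1 0
  rw [h.2.2]
  field_simp

theorem FamilyT2Plus.vanishingCondition_iff (h : FamilyT2Plus θ y) (hy : IsHolomorphicBranch θ y)
    (hk : AreFactors θ y k₁ k₂) : VanishingCondition (Omega θ y k₁ k₂) ↔ θ.θ₂ = 0 := by
  obtain ⟨hN, h0, hd⟩ := h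
  have h1 : θ.θ₁ + θ.θ₂ ≠ 0 := by simpa using hN 0
  constructor
  · intro hV
    by_contra h2
    have hd1 : deriv y 0 ≠ 1 := by
      rw [hd, Ne, div_eq_one_iff_eq h1]
      intro h
      exact h2 (by linear_combination -h)
    by_cases h3 : θ.θ₁ = 0
    · rw [h3, zero_div] at hd
      obtain ⟨k, hD⟩ := exists_flatData hy h3 h0 hd
      rcases sq_eq_sq_iff_eq_or_eq_neg.1 hD.sq with h4 | h4
      · exact hN k (by push_cast; linear_combination h3 - h4)
      · exact hN (-k) (by push_cast; linear_combination h3 + h4)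
    · have hs := hV.slope_eq hy hk h0 (by rw [hd]; exact div_ne_zero h3 h1) hd1
      rw [hd] at hs
      field_simp at hs
      exact h2 (by linear_combination -hs / 2)
  · intro h2
    refine vanishingCondition_of_slope hy hk h0 ?_
    rw [h2, add_zero] at hd h1
    rw [hd, h2, div_self h1]
    ring

/-- For `θ₁ ∈ {0, N}` one has `θ₁ = 0` or `θ₂ = 0`, so that the second alternative `θ₁ + θ₂ = N`
does no harm. -/
theorem FamilyT4.slope {N : ℤ} (h : FamilyT4 θ N y)
    (h' : θ.θ₁ - θ.θ₂ = N ∨ θ.θ₁ = 0 ∨ θ.θ₁ = N) : (θ.θ₁ - θ.θ₂) * deriv y 0 = θ.θ₁ := by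
  obtain ⟨hN, -, hd, hpm, -⟩ := h
  have hN' : (N : ℂ) ≠ 0 := by exact_mod_cast hN
  rw [hd]
  rcases h' with h | h | h
  · rw [h]
    field_simp
  · simp [h]
  · have h2 : θ.θ₂ = 0 := by
      rcases hpm with h' | h'
      · linear_combination h - h'
      · linear_combination h' - h
    rw [h, h2]
    field_simp
    ring

theorem FamilyT4.vanishingCondition_iff {N : ℤ} (h : FamilyT4 θ N y)
    (hy : IsHolomorphicBranch θ y) (hk : AreFactors θ y k₁ k₂) :
    VanishingCondition (Omega θ y k₁ k₂) ↔ θ.θ₁ - θ.θ₂ = N ∨ θ.θ₁ = 0 ∨ θ.θ₁ = N := by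
  refine ⟨fun hV => ?_, fun h' => vanishingCondition_of_slope hy hk h.2.1 (h.slope h')⟩
  have hN : (N : ℂ) ≠ 0 := by exact_mod_cast h.1
  by_cases h1 : θ.θ₁ = 0
  · exact Or.inr (Or.inl h1)
  by_cases h2 : θ.θ₁ = N
  · exact Or.inr (Or.inr h2)
  have hd := h.2.2.1
  have hs := hV.slope_eq hy hk h.2.1 (by rw [hd]; exact div_ne_zero h1 hN)
    (by rwa [hd, Ne, div_eq_one_iff_eq hN])
  rw [hd] at hs
  refine Or.inl (mul_right_cancel₀ h1 ?_)
  field_simp at hs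
  linear_combination θ.θ₁ * hs

/-! ### The spectrum of `Ω(0)` -/

/-- Since `m 0 * m 1 * m 2 = 0`, the discriminant of the characteristic polynomial is
`((m 0 + m 1 + m 2) ^ 2 - 4 e₂) e₂ ^ 2` with `e₂` its second coefficient, and it does not vanish. -/
theorem Params.DistinctEigenvalues.isSpectrum (hθ : θ.DistinctEigenvalues) {m : Fin 3 → ℂ}
    (sum : m 0 + m 1 + m 2 = -(θ.θ₁ + θ.θ₂ + θ.θ₃))
    (pairs : m 0 * m 1 + m 0 * m 2 + m 1 * m 2 = ((θ.θ₁ + θ.θ₂ + θ.θ₃) ^ 2 - θ.θinf ^ 2) / 4)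
    (prod : m 0 * m 1 * m 2 = 0) : IsSpectrum θ m := by
  obtain ⟨h0, h1, h2⟩ := hθ
  have key : ((m 0 - m 1) * (m 0 - m 2) * (m 1 - m 2)) ^ 2
      = θ.θinf ^ 2 * ((m 0 * m 1 + m 0 * m 2 + m 1 * m 2)) ^ 2 := by
    linear_combination (m 0 * m 1 + m 0 * m 2 + m 1 * m 2) ^ 2
        * ((m 0 + m 1 + m 2 - (θ.θ₁ + θ.θ₂ + θ.θ₃)) * sum - 4 * pairs)
      + (-4 * (m 0 + m 1 + m 2) ^ 3
        + 18 * (m 0 + m 1 + m 2) * (m 0 * m 1 + m 0 * m 2 + m 1 * m 2)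
        - 27 * (m 0 * m 1 * m 2)) * prod
  have hne : θ.θinf ^ 2 * ((m 0 * m 1 + m 0 * m 2 + m 1 * m 2)) ^ 2 ≠ 0 := by
    rw [pairs]
    refine mul_ne_zero (pow_ne_zero 2 h0) (pow_ne_zero 2 (div_ne_zero ?_ (by norm_num)))
    rw [sq_sub_sq]
    exact mul_ne_zero (fun h => h2 (by linear_combination h))
      (fun h => h1 (by linear_combination -h))
  rw [← key] at hne
  refine ⟨sum, pairs, prod, fun h => hne ?_, fun h => hne ?_, fun h => hne ?_⟩ <;> rw [h] <;> ring

namespace IsResidue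

variable {A : Matrix (Fin 3) (Fin 3) ℂ} {μ m₁ m₂ a b ρ : ℂ}

theorem confluent_of_eq (hA : IsResidue θ A) (hm : IsSpectrum θ ![μ, m₁, m₂])
    (hu : a ≠ 0 ∨ LeftNondegenerate A μ) (hv : RightDegenerate A m₂)
    (ha : a = -θ.θ₃ - m₁) (hb : b = μ - m₁) : ReducesTo A μ (Confluent a b) := by
  subst ha hb
  exact hA.reducesTo_confluent hm hu hv

theorem confluentInhom_of_eq (hA : IsResidue θ A) (hm : IsSpectrum θ ![μ, m₁, m₂])
    (hu : a ≠ 0 ∨ LeftNondegenerate A μ) (h2 : m₂ = -θ.θ₁ ∨ m₂ = -θ.θ₂)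
    (ha : a = -θ.θ₃ - m₁) (hb : b = μ - m₁) (hρ : ρ = m₂ - μ) :
    ReducesTo A μ (ConfluentInhom a b ρ) := by
  subst ha hb hρ
  exact hA.reducesTo_confluentInhom hm hu h2

end IsResidue

/-! ### Reduction for `y(0) = 0` -/

variable {Ω₀ : Matrix (Fin 3) (Fin 3) ℂ}

/-- The values of `Ω₁₃`, `Ω₂₃` at `0` are multiples of `θ∞ + θ₃ ∓ (θ₁ - θ₂)`, which is `2 θ∞` if the
eigenvalue is `-θ₁`, `-θ₂` respectively. -/
theorem leftNondegenerate_of_slope (hθ : θ.DistinctEigenvalues) (hy : IsHolomorphicBranch θ y)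
    (hk : AreFactors θ y k₁ k₂) (h0 : y 0 = 0) (hν : (θ.θ₁ - θ.θ₂) * deriv y 0 = θ.θ₁)
    (h12 : θ.θ₁ ≠ θ.θ₂) (hΩ : IsCoalescentValue (Omega θ y k₁ k₂) Ω₀) :
    LeftNondegenerate Ω₀ ((θ.θinf - θ.θ₁ - θ.θ₂ - θ.θ₃) / 2) := by
  refine (hΩ.isResidue hy hk).leftNondegenerate h12 (fun h => ?_) (fun h => ?_)
  · obtain ⟨c, hc, hv⟩ := exists_holValue_Omega_02 hy hk h0 hν (fun hd => hθ.2.1 (by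
      rw [hd, mul_zero] at hν
      linear_combination 2 * h + 2 * hν))
    rw [hΩ.apply_eq hv]
    refine mul_ne_zero hc fun h' => hθ.1 ?_
    linear_combination h + h' / 2
  · obtain ⟨c, hc, hv⟩ := exists_holValue_Omega_12 hy hk h0 hν (fun hd => hθ.2.1 (by
      rw [hd] at hν
      linear_combination 2 * h + 2 * hν))
    rw [hΩ.apply_eq hv]
    refine mul_ne_zero hc fun h' => hθ.1 ?_
    linear_combination h + h' / 2

theorem reducesToGenHypergeometric_of_slope (hθ : θ.DistinctEigenvalues)
    (hy : IsHolomorphicBranch θ y) (hk : AreFactors θ y k₁ k₂) (h0 : y 0 = 0)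
    (hν : (θ.θ₁ - θ.θ₂) * deriv y 0 = θ.θ₁) (h12 : θ.θ₁ ≠ θ.θ₂)
    (hΩ : IsCoalescentValue (Omega θ y k₁ k₂) Ω₀) : ReducesToGenHypergeometric θ Ω₀ :=
  (hΩ.isResidue hy hk).reducesToGenHypergeometric hθ
    (leftNondegenerate_of_slope hθ hy hk h0 hν h12 hΩ)

theorem FamilyT3.reducesTo (h : FamilyT3 θ y) (hθ : θ.DistinctEigenvalues)
    (hy : IsHolomorphicBranch θ y) (hk : AreFactors θ y k₁ k₂)
    (hΩ : IsCoalescentValue (Omega θ y k₁ k₂) Ω₀) :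
    ReducesTo Ω₀ ((θ.θinf - θ.θ₃) / 2) (Confluent ((θ.θinf - θ.θ₃) / 2) θ.θinf) := by
  obtain ⟨h1, h2, -⟩ := h
  have hA := hΩ.isResidue hy hk
  have hv := hA.rightDegenerate_of_eq (h1.trans h2.symm)
  refine hA.confluent_of_eq (m₁ := -(θ.θinf + θ.θ₃) / 2) (m₂ := -θ.θ₁)
    (hθ.isSpectrum ?_ ?_ ?_) (Or.inl fun h => ?_) hv ?_ ?_
  · simp [h1, h2]
    ring
  · simp [h1, h2]
    ring
  · simp [h1]
  · exact hθ.2.1 (by rw [h1, h2]; linear_combination 2 * h)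
  · ring
  · ring

theorem FamilyT4.reducesTo {N M : ℤ} (h : FamilyT4 θ N y) (h' : θ.θ₁ = 0 ∨ θ.θ₁ = N)
    (hM : θ.θ₁ + θ.θ₂ = M) (hθ : θ.DistinctEigenvalues)
    (hy : IsHolomorphicBranch θ y) (hk : AreFactors θ y k₁ k₂)
    (hΩ : IsCoalescentValue (Omega θ y k₁ k₂) Ω₀) :
    (0 < M → ReducesTo Ω₀ ((θ.θinf - θ.θ₃ - M) / 2)
      (Confluent ((θ.θinf - θ.θ₃ + M) / 2) θ.θinf)) ∧
    (M < 0 → ReducesTo Ω₀ ((θ.θinf - θ.θ₃ - M) / 2)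
      (ConfluentInhom ((θ.θinf - θ.θ₃ + M) / 2) θ.θinf (-((θ.θinf - θ.θ₃ - M) / 2)))) := by
  have hν := h.slope (Or.inr h')
  obtain ⟨hN, h0, hd, hpm, -⟩ := h
  have hN' : (N : ℂ) ≠ 0 := by exact_mod_cast hN
  have hA := hΩ.isResidue hy hk
  have h12 : θ.θ₁ = 0 ∧ deriv y 0 = 0 ∨ θ.θ₂ = 0 ∧ deriv y 0 = 1 := by
    rcases h' with h | h
    · exact Or.inl ⟨h, by rw [hd, h, zero_div]⟩
    · refine Or.inr ⟨?_, by rw [hd, h, div_self hN']⟩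
      rcases hpm with h' | h'
      · linear_combination h - h'
      · linear_combination h' - h
  have hne : θ.θ₁ ≠ θ.θ₂ := by
    intro he
    have h2 : θ.θ₂ = 0 := h12.elim (fun h => he ▸ h.1) fun h => h.1
    rcases hpm with h4 | h4 <;> exact hN' (by simp [← h4, he, h2])
  have hμ : (θ.θinf - θ.θ₃ - M) / 2 = (θ.θinf - θ.θ₁ - θ.θ₂ - θ.θ₃) / 2 := by
    rw [← hM]
    ring
  have hu := leftNondegenerate_of_slope hθ hy hk h0 hν hne hΩ
  rw [← hμ] at hu
  have hs : IsSpectrum θ ![(θ.θinf - θ.θ₃ - M) / 2, -(θ.θinf + θ.θ₃ + M) / 2, 0] := by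
    refine hθ.isSpectrum ?_ ?_ ?_
    · simp [← hM]
      ring
    · simp [← hM]
      ring
    · simp
  constructor
  · intro hMp
    refine hA.confluent_of_eq hs (Or.inr hu) ?_ (by ring) (by ring)
    lift M to ℕ using hMp.le
    rw [Int.cast_natCast] at hM
    have hM1 : 1 ≤ M := by exact_mod_cast hMp
    rcases h12 with ⟨h3, h4⟩ | ⟨h3, h4⟩
    · have := hA.rightDegenerate_of_apply_two_zero (hΩ.apply_eq
        ((vanishingCondition_of_slope_zero hy hk h0 h3 h4).2.1 M hM1 (by rw [← hM, h3, zero_add])))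
      rwa [h3, neg_zero] at this
    · have := hA.rightDegenerate_of_apply_two_one (hΩ.apply_eq
        ((vanishingCondition_of_slope_one hy hk h0 h3 h4).2.1 M hM1 (by rw [← hM, h3, add_zero])))
      rwa [h3, neg_zero] at this
  · intro _
    refine hA.confluentInhom_of_eq hs (Or.inr hu) ?_ (by ring) (by ring) (by ring)
    exact h12.imp (fun h => by rw [h.1, neg_zero]) (fun h => by rw [h.1, neg_zero])

/-! ### Reduction for `y(0) = N / (θ∞ - 1)` -/

theorem FamilyT1.reducesTo_of_eq (h : FamilyT1 θ (-1) y) (h12 : θ.θ₁ = θ.θ₂)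
    (hθ : θ.DistinctEigenvalues) (hy : IsHolomorphicBranch θ y) (hk : AreFactors θ y k₁ k₂)
    (hΩ : IsCoalescentValue (Omega θ y k₁ k₂) Ω₀) :
    ReducesTo Ω₀ 0 (Confluent θ.θ₂ (θ.θ₂ + θ.θ₃)) := by
  have hA := hΩ.isResidue hy hk
  have h3 : θ.θinf ^ 2 = θ.θ₃ ^ 2 := by
    have h4 := h.2.2.2.1
    push_cast at h4
    rcases h4 with h4 | h4
    · linear_combination (θ.θinf - θ.θ₃) * h4
    · linear_combination (θ.θinf + θ.θ₃) * h4
  have hs : IsSpectrum θ ![0, -(θ.θ₂ + θ.θ₃), -θ.θ₁] := by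
    refine hθ.isSpectrum ?_ ?_ ?_
    · simp
      ring
    · simp [h3, h12]
      ring
    · simp
  refine hA.confluent_of_eq hs (Or.inl fun h0 => hs.ne02 ?_) (hA.rightDegenerate_of_eq h12)
    (by ring) (by ring)
  simp [h12, h0]

/-- The first weight can vanish only if the parameter `a` of the confluent equation does; in this
case `Ω₂₃(0)`, `Ω₁₃(0)` respectively is a nonzero multiple of `θ₃`. -/
theorem FamilyT1.reducesTo_minus {N : ℤ} (h : FamilyT1 θ N y) (hN : N ≤ -2)
    (h3 : θ.θinf - 1 - θ.θ₃ = N)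
    (hθ : θ.DistinctEigenvalues) (hy : IsHolomorphicBranch θ y) (hk : AreFactors θ y k₁ k₂)
    (hΩ : IsCoalescentValue (Omega θ y k₁ k₂) Ω₀) :
    (θ.θ₁ - θ.θ₂ = -(N + 1) →
      ReducesTo Ω₀ 0 (ConfluentInhom θ.θ₂ (θ.θ₂ + θ.θ₃) (-θ.θ₁))) ∧
    (θ.θ₁ - θ.θ₂ = N + 1 →
      ReducesTo Ω₀ 0 (ConfluentInhom θ.θ₁ (θ.θ₁ + θ.θ₃) (-θ.θ₂))) := by
  have hA := hΩ.isResidue hy hk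
  obtain ⟨n, rfl⟩ : ∃ n : ℕ, N = -(n + 1) := ⟨(-N - 1).toNat, by omega⟩
  have hn : (n : ℂ) ≠ 0 := by
    have : n ≠ 0 := by omega
    exact_mod_cast this
  have hσ := h.mul_apply_zero
  push_cast at hσ h3
  have hinf : θ.θinf = θ.θ₃ - n := by linear_combination h3
  have hD : θ.θ₃ ≠ 0 → MinusData θ y n := fun h4 => minusData hy hσ h3 fun h1 => h4 (by
    rw [h1] at hσ
    linear_combination hσ - h3)
  constructor <;> intro hν <;> push_cast at hν
  · have hν : θ.θ₁ - θ.θ₂ = n := by rw [hν]; ring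
    have h1 : θ.θ₁ = θ.θ₂ + n := by rw [← hν]; ring
    have hs : IsSpectrum θ ![0, -(θ.θ₂ + θ.θ₃), -θ.θ₁] := by
      refine hθ.isSpectrum ?_ ?_ ?_
      · simp
        ring
      · simp [hinf, h1]
        ring
      · simp
    refine hA.confluentInhom_of_eq hs ?_ (Or.inl rfl) (by ring) (by ring) (by ring)
    by_cases h2 : θ.θ₂ = 0
    · have h4 : θ.θ₃ ≠ 0 := fun h4 => hs.ne01 (by simp [h2, h4])
      obtain ⟨c, hc, hv⟩ := ((hD h4).of_sub_eq hy hk hσ hν).2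
      refine Or.inr (hA.leftNondegenerate (fun h => hn (by rw [← hν, h, sub_self]))
        (fun h => absurd h hs.ne02) fun _ => ?_)
      rw [hΩ.apply_eq hv]
      exact mul_ne_zero (neg_ne_zero.2 h4) hc
    · exact Or.inl h2
  · have hν : θ.θ₁ - θ.θ₂ = -n := by rw [hν]; ring
    have h2 : θ.θ₂ = θ.θ₁ + n := by linear_combination -hν
    have hs : IsSpectrum θ ![0, -(θ.θ₁ + θ.θ₃), -θ.θ₂] := by
      refine hθ.isSpectrum ?_ ?_ ?_
      · simp
        ring
      · simp [hinf, h2]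
        ring
      · simp
    refine hA.confluentInhom_of_eq hs ?_ (Or.inr rfl) (by ring) (by ring) (by ring)
    by_cases h1 : θ.θ₁ = 0
    · have h4 : θ.θ₃ ≠ 0 := fun h4 => hs.ne01 (by simp [h1, h4])
      obtain ⟨c, hc, hv⟩ := ((hD h4).of_sub_eq_neg hy hk hσ hν).2
      refine Or.inr (hA.leftNondegenerate (fun h => hn (by linear_combination hν - h))
        (fun _ => ?_) fun h => absurd h hs.ne02)
      rw [hΩ.apply_eq hv]
      exact mul_ne_zero (neg_ne_zero.2 h4) hc
    · exact Or.inl h1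

/-- A zero `Ω₃₁(0)` or `Ω₃₂(0)` gives the reduction with first eigenvalue `0`, unless the other
`θ` vanishes; then the roles of `0` and `-θ₃` are exchanged. -/
theorem IsResidue.reducesTo_of_rightDegenerate {A : Matrix (Fin 3) (Fin 3) ℂ} {c d : ℂ}
    (hA : IsResidue θ A) (hθ : θ.DistinctEigenvalues) (hd : RightDegenerate A (-d))
    (hsum : c + d = θ.θ₁ + θ.θ₂) (hdiff : θ.θinf = d - c - θ.θ₃) :
    (c ≠ 0 → ReducesTo A 0 (Confluent c (c + θ.θ₃))) ∧
      (c = 0 → ReducesTo A (-θ.θ₃) (Confluent (-θ.θ₃) (-θ.θ₃))) := by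
  have hs : IsSpectrum θ ![0, -(c + θ.θ₃), -d] := by
    refine hθ.isSpectrum ?_ ?_ ?_
    · simp
      linear_combination -hsum
    · rw [← hsum, hdiff]
      simp
      ring
    · simp
  refine ⟨fun hc => hA.confluent_of_eq hs (Or.inl hc) hd (by ring) (by ring), fun hc => ?_⟩
  subst hc
  have hs' : IsSpectrum θ ![-θ.θ₃, 0, -d] := by
    refine hθ.isSpectrum ?_ ?_ ?_
    · simp
      linear_combination -hsum
    · rw [← hsum, hdiff]
      simp
      ring
    · simp
  exact hA.confluent_of_eq hs' (Or.inl hs'.ne01) hd (by ring) (by ring)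

theorem FamilyT1.reducesTo_plus {N : ℤ} (h : FamilyT1 θ N y) (hN : N ≤ -2)
    (h3 : θ.θinf - 1 + θ.θ₃ = N)
    (hθ : θ.DistinctEigenvalues) (hy : IsHolomorphicBranch θ y) (hk : AreFactors θ y k₁ k₂)
    (hΩ : IsCoalescentValue (Omega θ y k₁ k₂) Ω₀) :
    (θ.θ₁ - θ.θ₂ = -(N + 1) →
      (θ.θ₁ ≠ 0 → ReducesTo Ω₀ 0 (Confluent θ.θ₁ (θ.θ₁ + θ.θ₃))) ∧
      (θ.θ₁ = 0 → ReducesTo Ω₀ (-θ.θ₃) (Confluent (-θ.θ₃) (-θ.θ₃)))) ∧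
    (θ.θ₁ - θ.θ₂ = N + 1 →
      (θ.θ₂ ≠ 0 → ReducesTo Ω₀ 0 (Confluent θ.θ₂ (θ.θ₂ + θ.θ₃))) ∧
      (θ.θ₂ = 0 → ReducesTo Ω₀ (-θ.θ₃) (Confluent (-θ.θ₃) (-θ.θ₃)))) := by
  have hA := hΩ.isResidue hy hk
  obtain ⟨n, rfl⟩ : ∃ n : ℕ, N = -(n + 1) := ⟨(-N - 1).toNat, by omega⟩
  have hσ := h.mul_apply_zero
  push_cast at hσ h3
  have hD := plusData hy hσ h3
  constructor <;> intro hν <;> push_cast at hν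
  · have hν : θ.θ₁ - θ.θ₂ = n := by rw [hν]; ring
    have hv := hΩ.apply_eq ((hD.of_sub_eq hy hk hσ hν).2 (by omega))
    exact hA.reducesTo_of_rightDegenerate hθ (hA.rightDegenerate_of_apply_two_one hv) rfl
      (by linear_combination h3 + hν)
  · have hν : θ.θ₁ - θ.θ₂ = -n := by rw [hν]; ring
    have hv := hΩ.apply_eq ((hD.of_sub_eq_neg hy hk hσ hν).2 (by omega))
    exact hA.reducesTo_of_rightDegenerate hθ (hA.rightDegenerate_of_apply_two_zero hv)
      (add_comm _ _) (by linear_combination h3 - hν)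

end PVI

end

theorem mainTheorem5 (θ : PVI.Params) (hθ : θ.DistinctEigenvalues)
    (y k₁ k₂ : ℂ → ℂ) (hy : PVI.IsHolomorphicBranch θ y) (hk : PVI.AreFactors θ y k₁ k₂) :
    -- which tabulated branches satisfy the vanishing condition
    ((PVI.FamilyGeneric θ y ∨ PVI.FamilyFree θ y →
        ¬ PVI.VanishingCondition (PVI.Omega θ y k₁ k₂)) ∧
      (∀ N : ℤ, PVI.FamilyT1 θ N y →
        (PVI.VanishingCondition (PVI.Omega θ y k₁ k₂) ↔
          N ≤ -1 ∧ (θ.θ₁ - θ.θ₂ = N + 1 ∨ θ.θ₁ - θ.θ₂ = -(N + 1)))) ∧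
      (PVI.FamilyT2Minus θ y → PVI.VanishingCondition (PVI.Omega θ y k₁ k₂)) ∧
      (PVI.FamilyT2Plus θ y →
        (PVI.VanishingCondition (PVI.Omega θ y k₁ k₂) ↔ θ.θ₂ = 0)) ∧
      (PVI.FamilyT3 θ y → PVI.VanishingCondition (PVI.Omega θ y k₁ k₂)) ∧
      (∀ N : ℤ, PVI.FamilyT4 θ N y →
        (PVI.VanishingCondition (PVI.Omega θ y k₁ k₂) ↔
          θ.θ₁ - θ.θ₂ = N ∨ θ.θ₁ = 0 ∨ θ.θ₁ = N))) ∧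
    -- reduction of the system at `x = 0` for the admissible branches
    ∀ Ω₀ : Matrix (Fin 3) (Fin 3) ℂ, PVI.IsCoalescentValue (PVI.Omega θ y k₁ k₂) Ω₀ →
      (PVI.FamilyT1 θ (-1) y → θ.θ₁ = θ.θ₂ →
        PVI.ReducesTo Ω₀ 0 (PVI.Confluent θ.θ₂ (θ.θ₂ + θ.θ₃))) ∧
      (∀ N : ℤ, N ≤ -2 → PVI.FamilyT1 θ N y → θ.θinf - 1 - θ.θ₃ = N →
        (θ.θ₁ - θ.θ₂ = -(N + 1) →
          PVI.ReducesTo Ω₀ 0 (PVI.ConfluentInhom θ.θ₂ (θ.θ₂ + θ.θ₃) (-θ.θ₁))) ∧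
        (θ.θ₁ - θ.θ₂ = N + 1 →
          PVI.ReducesTo Ω₀ 0 (PVI.ConfluentInhom θ.θ₁ (θ.θ₁ + θ.θ₃) (-θ.θ₂)))) ∧
      (∀ N : ℤ, N ≤ -2 → PVI.FamilyT1 θ N y → θ.θinf - 1 + θ.θ₃ = N →
        (θ.θ₁ - θ.θ₂ = -(N + 1) →
          (θ.θ₁ ≠ 0 → PVI.ReducesTo Ω₀ 0 (PVI.Confluent θ.θ₁ (θ.θ₁ + θ.θ₃))) ∧
          (θ.θ₁ = 0 → PVI.ReducesTo Ω₀ (-θ.θ₃) (PVI.Confluent (-θ.θ₃) (-θ.θ₃)))) ∧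
        (θ.θ₁ - θ.θ₂ = N + 1 →
          (θ.θ₂ ≠ 0 → PVI.ReducesTo Ω₀ 0 (PVI.Confluent θ.θ₂ (θ.θ₂ + θ.θ₃))) ∧
          (θ.θ₂ = 0 → PVI.ReducesTo Ω₀ (-θ.θ₃) (PVI.Confluent (-θ.θ₃) (-θ.θ₃))))) ∧
      (PVI.FamilyT2Minus θ y → PVI.ReducesToGenHypergeometric θ Ω₀) ∧
      (PVI.FamilyT3 θ y →
        PVI.ReducesTo Ω₀ ((θ.θinf - θ.θ₃) / 2)
          (PVI.Confluent ((θ.θinf - θ.θ₃) / 2) θ.θinf)) ∧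
      (∀ N : ℤ, PVI.FamilyT4 θ N y → θ.θ₁ - θ.θ₂ = N →
        PVI.ReducesToGenHypergeometric θ Ω₀) ∧
      (∀ N M : ℤ, PVI.FamilyT4 θ N y → θ.θ₁ = 0 ∨ θ.θ₁ = N → θ.θ₁ + θ.θ₂ = M →
        (0 < M →
          PVI.ReducesTo Ω₀ ((θ.θinf - θ.θ₃ - M) / 2)
            (PVI.Confluent ((θ.θinf - θ.θ₃ + M) / 2) θ.θinf)) ∧
        (M < 0 →
          PVI.ReducesTo Ω₀ ((θ.θinf - θ.θ₃ - M) / 2)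
            (PVI.ConfluentInhom ((θ.θinf - θ.θ₃ + M) / 2) θ.θinf
              (-((θ.θinf - θ.θ₃ - M) / 2))))) := by
  refine ⟨⟨?_, fun N h => h.vanishingCondition_iff hy hk, fun h => ?_,
    fun h => h.vanishingCondition_iff hy hk, fun h => ?_,
    fun N h => h.vanishingCondition_iff hy hk⟩, fun Ω₀ hΩ =>
    ⟨fun h h12 => h.reducesTo_of_eq h12 hθ hy hk hΩ,
      fun N hN h h3 => h.reducesTo_minus hN h3 hθ hy hk hΩ,
      fun N hN h h3 => h.reducesTo_plus hN h3 hθ hy hk hΩ, fun h => ?_,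
      fun h => h.reducesTo hθ hy hk hΩ, fun N h hν => ?_,
      fun N M h h' hM => h.reducesTo h' hM hθ hy hk hΩ⟩⟩
  · rintro (h | h)
    · exact h.not_vanishingCondition hy hk
    · exact h.not_vanishingCondition hy hk
  · exact PVI.vanishingCondition_of_slope hy hk h.2.1 h.slope
  · exact PVI.vanishingCondition_of_slope hy hk h.2.2 (by rw [h.1, h.2.1, sub_zero, zero_mul])
  · exact PVI.reducesToGenHypergeometric_of_slope hθ hy hk h.2.1 h.slope
      (fun h12 => h.1 0 (by rw [h12, sub_self, Int.cast_zero])) hΩ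
  · refine PVI.reducesToGenHypergeometric_of_slope hθ hy hk h.2.1 (h.slope (Or.inl hν))
      (fun h12 => h.1 ?_) hΩ
    rw [h12, sub_self] at hν
    exact_mod_cast hν.symm
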